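/- Let $\mathcal V$ be a set of values with a total order $\le_{\mathcal V}$ (the priority; larger values have higher priority). A \emph{history} is a finite set $H$ of operations $o=(id,p,m(v),t_{\sf inv},t_{\sf res})$, where $id$ is an identifier, $p$ a process, $m(v)$ is one of $\mathtt{enq}(v),\mathtt{deq}(v),\mathtt{peek}(v)$ with $v\in\mathcal V$ or the argument-free operation $\mathtt{empty}$, and $t_{\sf inv}<t_{\sf res}$ are non-negative rational invocation and response times. $H$ is \emph{unambiguous} if for each value $v$ occurring in $H$ there is exactly one operation $\mathtt{enq}(v)$ and at most one operation $\mathtt{deq}(v)$ in $H$ (any number of $\mathtt{peek}$ and $\mathtt{empty}$ operations is allowed). The \emph{sequential priority queue} has as states the increasingly sorted finite lists over $\mathcal V$, initially the empty list; $\mathtt{enq}(v)$ inserts $v$ into the list in sorted position, $\mathtt{deq}(v)$ is possible if $v$ is the last (greatest) entry of the list and removes it, $\mathtt{peek}(v)$ is possible if $v$ is the last entry and leaves the list unchanged, and $\mathtt{empty}$ is possible if the list is empty and leaves it unchanged. $H$ is \emph{linearizable} if there is an injective map $\ell:H\to\mathbb Q_{\ge 0}$ with $t_{\sf inv}(o)<\ell(o)<t_{\sf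 res}(o)$ for all $o\in H$ such that the operations of $H$, listed in increasing order of $\ell$, form a sequence that the sequential priority queue can execute from the empty list. \textbf{Theorem.} Linearizability of unambiguous priority-queue histories can be decided in $O(n\log n)$ time, where $n$ is the number of operations of the history. That is, there are a single program and a function $T$ with $T(n)=O(n\log n)$ such that for every totally ordered set of values, every unambiguous history $H$ with $n$ operations, and every listing of the operations of $H$ as input, the program halts after at most $T(n)$ steps and accepts if and only if $H$ is linearizable. Here programs are finite systems of mutually recursive first-order functions that compute with cells (ordered pairs), the empty datum and atoms (the identifiers, processes, times and values of the input); the elementary steps, of unit cost, are reading a variable, building the empty datum or a cell, taking a component of a cell, testing for the empty datum, binding a variable, calling a function, and comparing two times or two values. No arithmetic or hashing is available, and each step takes constant time on a random-access machine with unit-cost comparisons of times and values. -/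

import Mathlib

/-!
Linearizability of concurrent priority-queue histories, and a first-order programming language with
a unit-cost step count in which running times are measured.
-/

namespace PQMonitor

section Histories

/-- Abstract operations `m(v)` of the priority queue. The operation `empty` carries no value. -/
inductive AbsOp (V : Type*) where
  | enq (v : V)
  | deq (v : V)
  | peek (v : V)
  | empty

/-- The value component of an abstract operation (`none` for `empty`). -/
def AbsOp.value {V : Type*} : AbsOp V → Option V
  | .enq v => some v
  | .deq v => some v
  | .peek v => some v
  | .empty => none

/-- An operation of a concurrent history: identifier, process, method with its argument, and
rational invocation and response times. -/
structure Operation (P V : Type*) where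
  id : ℕ
  proc : P
  op : AbsOp V
  inv : ℚ≥0
  res : ℚ≥0
  inv_lt_res : inv < res

/-- The set of values occurring in a history (a history is a finite set of operations). -/
def values {P V : Type*} (H : Finset (Operation P V)) : Set V :=
  {v | ∃ o ∈ H, o.op.value = some v}

/-- Unambiguity: each value of the history is added by exactly one operation and removed by at
most one. There is no restriction on the number of `peek` and `empty` operations. -/
def Unambiguous {P V : Type*} (H : Finset (Operation P V)) : Prop :=
  ∀ v ∈ values H,
    (∃! o, o ∈ H ∧ o.op = .enq v) ∧
    (∀ o ∈ H, ∀ o' ∈ H, o.op = .deq v → o'.op = .deq v → o = o')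

/-- The transitions of the sequential priority queue. A state is the list of the stored values in
increasing order; the last entry has the highest priority. -/
inductive Step {V : Type*} [LinearOrder V] : List V → AbsOp V → List V → Prop
  | enq (s : List V) (v : V) : Step s (.enq v) ((v :: s).insertionSort (· ≤ ·))
  | peek (s : List V) (v : V) : Step (s ++ [v]) (.peek v) (s ++ [v])
  | deq (s : List V) (v : V) : Step (s ++ [v]) (.deq v) s
  | empty : Step [] .empty []

/-- `Run s τ s'`: a sequence of transitions labelled `τ` leads from `s` to `s'`. -/
inductive Run {V : Type*} [LinearOrder V] : List V → List (AbsOp V) → List V → Prop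
  | nil (s : List V) : Run s [] s
  | cons {s s' s'' : List V} {a : AbsOp V} {τ : List (AbsOp V)} :
      Step s a s' → Run s' τ s'' → Run s (a :: τ) s''

/-- The sequential specification of the priority queue: all label sequences of runs that start in
the empty queue. -/
def spec (V : Type*) [LinearOrder V] : Set (List (AbsOp V)) :=
  {τ | ∃ s, Run [] τ s}

/-- A linearization: an injective choice of a time strictly between invocation and response. -/
def IsLinearization {P V : Type*} (H : Finset (Operation P V)) (l : Operation P V → ℚ≥0) : Prop :=
  Set.InjOn l H ∧ ∀ o ∈ H, o.inv < l o ∧ l o < o.res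

/-- `τ` is the sequence of abstract operations obtained by listing `H` in increasing order
of `l`. -/
def Induces {P V : Type*} (H : Finset (Operation P V)) (l : Operation P V → ℚ≥0)
    (τ : List (AbsOp V)) : Prop :=
  ∃ s : List (Operation P V), (s : Multiset (Operation P V)) = H.val ∧
    s.Pairwise (fun a b => l a < l b) ∧ τ = s.map Operation.op

/-- A history is linearizable if one of its linearizations induces a sequence of the sequential
specification. -/
def Linearizable {P V : Type*} [LinearOrder V] (H : Finset (Operation P V)) : Prop :=
  ∃ l : Operation P V → ℚ≥0, IsLinearization H l ∧ ∃ τ ∈ spec V, Induces H l τ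

end Histories

section Machine

/-- The data of the machine: binary trees of cells (`pair`) over the empty datum `nil` and atoms,
which are identifiers, processes, times and values. -/
inductive Datum (P V : Type*) where
  | nil
  | ident (i : ℕ)
  | proc (p : P)
  | time (t : ℚ≥0)
  | val (v : V)
  | pair (a b : Datum P V)

namespace Datum

variable {P V : Type*}

/-- First component of a cell; `nil` on other data. -/
def fst : Datum P V → Datum P V
  | pair a _ => a
  | _ => nil

/-- Second component of a cell; `nil` on other data. -/
def snd : Datum P V → Datum P V
  | pair _ b => b
  | _ => nil

/-- Truth values are data: `nil` is false, everything else is true. -/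
def IsTrue (d : Datum P V) : Prop := d ≠ nil

/-- The datum of a Boolean. -/
def ofBool : Bool → Datum P V
  | true => pair nil nil
  | false => nil

/-- Comparison of two times or of two values; false on all other pairs of data. -/
def le [LinearOrder V] : Datum P V → Datum P V → Datum P V
  | time s, time t => ofBool (decide (s ≤ t))
  | val v, val w => ofBool (decide (v ≤ w))
  | _, _ => nil

/-- A list of data as a `nil`-terminated chain of cells. -/
def ofList : List (Datum P V) → Datum P V
  | [] => nil
  | d :: ds => pair d (ofList ds)

/-- A natural number in unary; used only for the four method names. -/
def ofNat : ℕ → Datum P V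
  | 0 => nil
  | k + 1 => pair nil (ofNat k)

end Datum

/-- Expressions of the first-order language. Variables are de Bruijn indices into the current
environment; `bind e b` evaluates `b` with the value of `e` as new variable `0`; `call f e` calls
the `f`-th function of the program on the value of `e`. Neither the atoms nor their types occur in
expressions. -/
inductive Expr where
  | var (i : ℕ)
  | nil
  | pair (e₁ e₂ : Expr)
  | fst (e : Expr)
  | snd (e : Expr)
  | le (e₁ e₂ : Expr)
  | ite (c e₁ e₂ : Expr)
  | bind (e b : Expr)
  | call (f : ℕ) (e : Expr)

/-- A program is a finite list of bodies of mutually recursive functions of one argument. -/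
abbrev Program := List Expr

/-- Call-by-value big-step semantics with step count: `Eval p env e d t` says that in the program
`p` the expression `e` evaluates in the environment `env` to the datum `d` in exactly `t` steps.
Every evaluated node of an expression costs one step. For a fixed program each step is a bounded
number of elementary operations (following a pointer, allocating a cell, testing for `nil`,
comparing two times or two values, jumping), so that a random-access machine executes it in constant
time. There is no arithmetic and no other access to the atoms than comparison. -/
inductive Eval {P V : Type*} [LinearOrder V] (p : Program) :
    List (Datum P V) → Expr → Datum P V → ℕ → Prop
  | var (env : List (Datum P V)) (i : ℕ) : Eval p env (.var i) (env.getD i .nil) 1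
  | nil (env : List (Datum P V)) : Eval p env .nil .nil 1
  | pair {env : List (Datum P V)} {e₁ e₂ : Expr} {d₁ d₂ : Datum P V} {t₁ t₂ : ℕ} :
      Eval p env e₁ d₁ t₁ → Eval p env e₂ d₂ t₂ →
      Eval p env (.pair e₁ e₂) (.pair d₁ d₂) (t₁ + t₂ + 1)
  | fst {env : List (Datum P V)} {e : Expr} {d : Datum P V} {t : ℕ} :
      Eval p env e d t → Eval p env (.fst e) d.fst (t + 1)
  | snd {env : List (Datum P V)} {e : Expr} {d : Datum P V} {t : ℕ} :
      Eval p env e d t → Eval p env (.snd e) d.snd (t + 1)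
  | le {env : List (Datum P V)} {e₁ e₂ : Expr} {d₁ d₂ : Datum P V} {t₁ t₂ : ℕ} :
      Eval p env e₁ d₁ t₁ → Eval p env e₂ d₂ t₂ →
      Eval p env (.le e₁ e₂) (Datum.le d₁ d₂) (t₁ + t₂ + 1)
  | iteTrue {env : List (Datum P V)} {c e₁ e₂ : Expr} {d d' : Datum P V} {t t' : ℕ} :
      Eval p env c d t → d.IsTrue → Eval p env e₁ d' t' →
      Eval p env (.ite c e₁ e₂) d' (t + t' + 1)
  | iteFalse {env : List (Datum P V)} {c e₁ e₂ : Expr} {d d' : Datum P V} {t t' : ℕ} :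
      Eval p env c d t → ¬ d.IsTrue → Eval p env e₂ d' t' →
      Eval p env (.ite c e₁ e₂) d' (t + t' + 1)
  | bind {env : List (Datum P V)} {e b : Expr} {d d' : Datum P V} {t t' : ℕ} :
      Eval p env e d t → Eval p (d :: env) b d' t' →
      Eval p env (.bind e b) d' (t + t' + 1)
  | call {env : List (Datum P V)} {f : ℕ} {e body : Expr} {d d' : Datum P V} {t t' : ℕ} :
      Eval p env e d t → p[f]? = some body → Eval p [d] body d' t' →
      Eval p env (.call f e) d' (t + t' + 1)

/-- Evaluation is deterministic, in its result and in its number of steps. -/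
theorem Eval.unique {P V : Type*} [LinearOrder V] {p : Program} {env : List (Datum P V)}
    {e : Expr} {d d' : Datum P V} {t t' : ℕ} (h : Eval p env e d t) (h' : Eval p env e d' t') :
    d = d' ∧ t = t' := by
  induction h generalizing d' t' with
  | var => cases h'; exact ⟨rfl, rfl⟩
  | nil => cases h'; exact ⟨rfl, rfl⟩
  | pair _ _ ih₁ ih₂ =>
    cases h' with
    | pair g₁ g₂ =>
      obtain ⟨rfl, rfl⟩ := ih₁ g₁
      obtain ⟨rfl, rfl⟩ := ih₂ g₂
      exact ⟨rfl, rfl⟩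
  | fst _ ih => cases h' with | fst g => obtain ⟨rfl, rfl⟩ := ih g; exact ⟨rfl, rfl⟩
  | snd _ ih => cases h' with | snd g => obtain ⟨rfl, rfl⟩ := ih g; exact ⟨rfl, rfl⟩
  | le _ _ ih₁ ih₂ =>
    cases h' with
    | le g₁ g₂ =>
      obtain ⟨rfl, rfl⟩ := ih₁ g₁
      obtain ⟨rfl, rfl⟩ := ih₂ g₂
      exact ⟨rfl, rfl⟩
  | iteTrue _ hd _ ih₁ ih₂ =>
    cases h' with
    | iteTrue g₁ _ g₂ =>
      obtain ⟨rfl, rfl⟩ := ih₁ g₁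
      obtain ⟨rfl, rfl⟩ := ih₂ g₂
      exact ⟨rfl, rfl⟩
    | iteFalse g₁ gd _ => exact absurd ((ih₁ g₁).1 ▸ hd) gd
  | iteFalse _ hd _ ih₁ ih₂ =>
    cases h' with
    | iteTrue g₁ gd _ => exact absurd gd ((ih₁ g₁).1 ▸ hd)
    | iteFalse g₁ _ g₂ =>
      obtain ⟨rfl, rfl⟩ := ih₁ g₁
      obtain ⟨rfl, rfl⟩ := ih₂ g₂
      exact ⟨rfl, rfl⟩
  | bind _ _ ih₁ ih₂ =>
    cases h' with
    | bind g₁ g₂ =>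
      obtain ⟨rfl, rfl⟩ := ih₁ g₁
      obtain ⟨rfl, rfl⟩ := ih₂ g₂
      exact ⟨rfl, rfl⟩
  | call _ hb _ ih₁ ih₂ =>
    cases h' with
    | call g₁ gb g₂ =>
      obtain ⟨rfl, rfl⟩ := ih₁ g₁
      rw [hb] at gb
      cases gb
      obtain ⟨rfl, rfl⟩ := ih₂ g₂
      exact ⟨rfl, rfl⟩

/-- `Runs p x d t`: started on the input `x`, the program `p` (its function `0`) halts after
exactly `t` steps with output `d`. -/
def Runs {P V : Type*} [LinearOrder V] (p : Program) (x d : Datum P V) (t : ℕ) : Prop :=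
  ∃ body, p[0]? = some body ∧ Eval p [x] body d t

end Machine

section Encoding

variable {P V : Type*}

/-- The code of a method name. -/
def encodeMethod : AbsOp V → Datum P V
  | .enq _ => Datum.ofNat 0
  | .deq _ => Datum.ofNat 1
  | .peek _ => Datum.ofNat 2
  | .empty => Datum.ofNat 3

/-- The code of the value component; `nil` if there is none. -/
def encodeValue (a : AbsOp V) : Datum P V :=
  match a.value with
  | some v => .val v
  | none => .nil

/-- An operation as the list of its six components. -/
def encodeOperation (o : Operation P V) : Datum P V :=
  Datum.ofList
    [.ident o.id, .proc o.proc, encodeMethod o.op, encodeValue o.op, .time o.inv, .time o.res]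

/-- The input of a monitor: the operations of the history, one after the other. -/
def encodeHistory (L : List (Operation P V)) : Datum P V :=
  Datum.ofList (L.map encodeOperation)

end Encoding

end PQMonitor

/-! The invocation and response times cut the time axis into gaps. A value `w` is certainly in the
queue throughout a gap if some operation on `w` has responded before it and either some operation on
`w` is invoked after it or `w` is never removed (`CoreCovers`). The heart of the proof is the
criterion `linearizable_iff_placeable`: each operation other than an insertion needs, independently
of all others, a gap inside its interval that is compatible with the insertion and the removal of
its value and in which no value of higher priority is certainly present. The global scheduling
problem thus becomes a family of local ones.

Necessity is seen in the gap around the linearization point. For sufficiency, each non-insertion is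
put into its last suitable gap, with one restriction: it must not be later than the first free gap
by which all operations on its value have been invoked (`Late`), provided that the value is removed.
A value is inserted in the earliest gap used by its operations, or in the last gap of its insertion
if that is earlier. The late choice and the restriction together ensure that a free gap strictly
between insertion and removal is already covered by the certain presence of the value
(`exists_isPlacement`). Hence a value present in a gap without being inserted or removed there
cannot obstruct an operation of lower priority. The remaining conflicts lie within one gap and are
resolved by its internal order (`block`): removals of old values by falling priority, then values
that come and go or merely stay, then insertions of lasting values by rising priority
(`IsPlacement.exists_deq`).

To test the criterion, values are treated by falling priority. A tree over the gaps holds those not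
yet covered by a greater value; an operation asks whether a remaining gap lies in its window, and
after each value the gaps in which it is certainly present are deleted. Operations `empty` come
last. Both queries and deletions visit only logarithmically many nodes because the tree is balanced
and deletion never increases its depth (`Seg.WF.cost_le`). Sorting is a merge sort along a balanced
tree.

Running time is reduced to counting function calls: between calls only boundedly many nodes of the
fixed program are evaluated (`wp_sound`, `calls_of_wp`). -/

namespace PQMonitor

/-! ### The sequential priority queue described by which operations have occurred -/

section Specification

variable {V : Type*} [LinearOrder V]

/-- The operation `a` is possible after the sequence `τ` of operations. -/
def Enabled (τ : List (AbsOp V)) : AbsOp V → Prop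
  | .enq _ => True
  | .deq v => .enq v ∈ τ ∧ .deq v ∉ τ ∧ ∀ w, v < w → .enq w ∈ τ → .deq w ∈ τ
  | .peek v => .enq v ∈ τ ∧ .deq v ∉ τ ∧ ∀ w, v < w → .enq w ∈ τ → .deq w ∈ τ
  | .empty => ∀ w, .enq w ∈ τ → .deq w ∈ τ

/-- No value is added twice or removed twice. -/
def Distinct (τ : List (AbsOp V)) : Prop :=
  τ.Pairwise fun a b => ∀ v, (a = .enq v → b ≠ .enq v) ∧ (a = .deq v → b ≠ .deq v)

theorem run_append_singleton {s s'' : List V} {τ : List (AbsOp V)} {a : AbsOp V} :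
    Run s (τ ++ [a]) s'' ↔ ∃ s', Run s τ s' ∧ Step s' a s'' := by
  induction τ generalizing s with
  | nil =>
    constructor
    · intro h
      cases h with
      | cons h1 h2 => cases h2; exact ⟨s, .nil s, h1⟩
    · rintro ⟨s', h1, h2⟩
      cases h1
      exact .cons h2 (.nil _)
  | cons b τ ih =>
    constructor
    · intro h
      cases h with
      | cons h1 h2 =>
        obtain ⟨s', h3, h4⟩ := ih.1 h2
        exact ⟨s', .cons h1 h3, h4⟩
    · rintro ⟨s', h1, h2⟩
      cases h1 with
      | cons h3 h4 => exact .cons h3 (ih.2 ⟨s', h4, h2⟩)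

/-- The list `s` is the state reached by the sequence `τ`. -/
structure IsState (τ : List (AbsOp V)) (s : List V) : Prop where
  sorted : s.Pairwise (· < ·)
  mem_iff : ∀ v, v ∈ s ↔ .enq v ∈ τ ∧ .deq v ∉ τ
  enq_of_deq : ∀ v, .deq v ∈ τ → .enq v ∈ τ

theorem IsState.nil : IsState ([] : List (AbsOp V)) [] := ⟨by simp, by simp, by simp⟩

theorem IsState.le_of_concat {τ : List (AbsOp V)} {s : List V} {v : V}
    (h : IsState τ (s ++ [v])) :
    AbsOp.enq v ∈ τ ∧ AbsOp.deq v ∉ τ ∧ ∀ w, v < w → AbsOp.enq w ∈ τ → AbsOp.deq w ∈ τ := by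
  have h1 := (h.mem_iff v).1 (by simp)
  refine ⟨h1.1, h1.2, fun w hw hq => ?_⟩
  by_contra hd
  have hm := (h.mem_iff w).2 ⟨hq, hd⟩
  have hs := h.sorted
  rw [List.pairwise_append] at hs
  rcases List.mem_append.1 hm with hm | hm
  · exact absurd (hs.2.2 w hm v (by simp)) (not_lt.2 hw.le)
  · simp at hm; exact hw.ne' hm

theorem IsState.enabled {τ : List (AbsOp V)} {s s' : List V} {a : AbsOp V}
    (h : IsState τ s) (hs : Step s a s') : Enabled τ a := by
  cases hs with
  | enq => trivial
  | peek s v => exact h.le_of_concat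
  | deq s v => exact h.le_of_concat
  | empty =>
    intro w hw
    by_contra hd
    exact absurd ((h.mem_iff w).2 ⟨hw, hd⟩) (by simp)

/-- Distinctness is essential: if a value could be inserted again after its removal, membership in
the state would no longer be determined by the sets of insertions and removals. -/
theorem IsState.step {τ : List (AbsOp V)} {s s' : List V} {a : AbsOp V}
    (h : IsState τ s) (hs : Step s a s') (hd : Distinct (τ ++ [a])) : IsState (τ ++ [a]) s' := by
  have hd' : ∀ b ∈ τ, ∀ v, (b = .enq v → a ≠ .enq v) ∧ (b = .deq v → a ≠ .deq v) := by
    intro b hb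
    exact (List.pairwise_append.1 hd).2.2 b hb a (by simp)
  cases hs with
  | enq _ v =>
    have hq : AbsOp.enq v ∉ τ := fun hm => (hd' _ hm v).1 rfl rfl
    have hv : v ∉ s := fun hm => hq ((h.mem_iff v).1 hm).1
    have hdq : AbsOp.deq v ∉ τ := fun hm => hq (h.enq_of_deq v hm)
    refine ⟨?_, fun w => ?_, fun w => ?_⟩
    · have h1 := List.pairwise_insertionSort (r := (· ≤ ·)) (v :: s)
      have h2 : ((v :: s).insertionSort (· ≤ ·)).Nodup := by
        rw [(List.perm_insertionSort _ _).nodup_iff, List.nodup_cons]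
        exact ⟨hv, h.sorted.imp ne_of_lt⟩
      exact (h1.and h2).imp fun hab => lt_of_le_of_ne hab.1 hab.2
    · rw [(List.perm_insertionSort (· ≤ ·) (v :: s)).mem_iff, List.mem_cons, h.mem_iff]
      by_cases hw : w = v
      · subst hw; simp [hdq]
      · simp [hw]
    · have := h.enq_of_deq w
      simp only [List.mem_append, List.mem_singleton, reduceCtorEq, or_false]
      tauto
  | peek s v =>
    refine ⟨h.sorted, fun w => ?_, fun w => ?_⟩
    · simpa using h.mem_iff w
    · simpa using h.enq_of_deq w
  | deq s v =>
    have hc := h.le_of_concat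
    have hs := List.pairwise_append.1 h.sorted
    refine ⟨hs.1, fun w => ?_, fun w => ?_⟩
    · have h1 := h.mem_iff w
      simp only [List.mem_append, List.mem_singleton, reduceCtorEq, or_false,
        AbsOp.deq.injEq] at h1 ⊢
      by_cases hw : w = v
      · subst hw
        simp only [or_true, not_true_eq_false, and_false, iff_false]
        exact fun hm => (hs.2.2 w hm w (by simp)).ne rfl
      · simpa [hw] using h1
    · have := h.enq_of_deq w
      simp only [List.mem_append, List.mem_singleton, reduceCtorEq, or_false, AbsOp.deq.injEq]
      rintro (hm | rfl)
      · exact this hm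
      · exact hc.1
  | empty =>
    refine ⟨h.sorted, fun w => ?_, fun w => ?_⟩
    · simpa using h.mem_iff w
    · simpa using h.enq_of_deq w

theorem IsState.eq_concat {τ : List (AbsOp V)} {s : List V} {v : V} (h : IsState τ s)
    (h1 : AbsOp.enq v ∈ τ) (h2 : AbsOp.deq v ∉ τ)
    (h3 : ∀ w, v < w → AbsOp.enq w ∈ τ → AbsOp.deq w ∈ τ) : ∃ s', s = s' ++ [v] := by
  have hm := (h.mem_iff v).2 ⟨h1, h2⟩
  rcases List.eq_nil_or_concat' s with rfl | ⟨s', w, rfl⟩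
  · simp at hm
  · refine ⟨s', ?_⟩
    have hw := (h.mem_iff w).1 (by simp)
    have hs := (List.pairwise_append.1 h.sorted).2.2
    rcases List.mem_append.1 hm with hm | hm
    · exact absurd (h3 w (hs v hm w (by simp)) hw.1) hw.2
    · simp at hm; simp [hm]

theorem IsState.exists_step {τ : List (AbsOp V)} {s : List V} {a : AbsOp V}
    (h : IsState τ s) (ha : Enabled τ a) : ∃ s', Step s a s' := by
  cases a with
  | enq v => exact ⟨_, .enq s v⟩
  | deq v =>
    obtain ⟨s', rfl⟩ := h.eq_concat ha.1 ha.2.1 ha.2.2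
    exact ⟨_, .deq s' v⟩
  | peek v =>
    obtain ⟨s', rfl⟩ := h.eq_concat ha.1 ha.2.1 ha.2.2
    exact ⟨_, .peek s' v⟩
  | empty =>
    cases s with
    | nil => exact ⟨_, .empty⟩
    | cons v s =>
      have := (h.mem_iff v).1 (by simp)
      exact absurd (ha v this.1) this.2

theorem Run.isState {τ : List (AbsOp V)} {s : List V} (h : Run [] τ s) (hd : Distinct τ) :
    IsState τ s := by
  induction τ using List.reverseRecOn generalizing s with
  | nil => cases h; exact .nil
  | append_singleton τ a ih =>
    obtain ⟨s', h1, h2⟩ := run_append_singleton.1 h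
    exact (ih h1 (List.pairwise_append.1 hd).1).step h2 hd

/-- A sequence without repeated insertions or removals of a value belongs to the specification
if and only if each of its operations is enabled after its predecessors. -/
theorem mem_spec_iff {τ : List (AbsOp V)} (hd : Distinct τ) :
    τ ∈ spec V ↔ ∀ τ₁ a τ₂, τ = τ₁ ++ a :: τ₂ → Enabled τ₁ a := by
  induction τ using List.reverseRecOn with
  | nil => exact ⟨fun _ τ₁ a τ₂ h => by simp at h, fun _ => ⟨[], .nil _⟩⟩
  | append_singleton τ a ih =>
    have hd' : Distinct τ := (List.pairwise_append.1 hd).1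
    specialize ih hd'
    constructor
    · rintro ⟨s, hs⟩ τ₁ b τ₂ h
      obtain ⟨s', h1, h2⟩ := run_append_singleton.1 hs
      rcases List.eq_nil_or_concat' τ₂ with rfl | ⟨τ₃, c, rfl⟩
      · obtain ⟨rfl, rfl⟩ : τ = τ₁ ∧ a = b := by simpa using h
        exact (h1.isState hd').enabled h2
      · have h' : τ ++ [a] = (τ₁ ++ b :: τ₃) ++ [c] := by simpa using h
        obtain ⟨rfl, -⟩ := List.append_inj' h' rfl
        exact ih.1 ⟨s', h1⟩ _ _ _ rfl
    · intro h
      obtain ⟨s, hs⟩ := ih.2 fun τ₁ b τ₂ hb => h τ₁ b (τ₂ ++ [a]) (by simp [hb])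
      obtain ⟨s', hs'⟩ := (hs.isState hd').exists_step (h τ a [] rfl)
      exact ⟨s', run_append_singleton.2 ⟨s, hs, hs'⟩⟩

end Specification

/-! ### The gap criterion: necessity, and linearizations from sort keys -/

section Criterion

variable {P V : Type*}

/-- The invocation and response times of a history. -/
def times (H : Finset (Operation P V)) : Finset ℚ≥0 :=
  H.image Operation.inv ∪ H.image Operation.res

/-- The interval between two consecutive times of a history. -/
def IsGap (H : Finset (Operation P V)) (lo hi : ℚ≥0) : Prop :=
  lo ∈ times H ∧ hi ∈ times H ∧ lo < hi ∧ ∀ t ∈ times H, t ≤ lo ∨ hi ≤ t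

/-- In each linearization the value `w` is present throughout the gap from `lo` to `hi`. -/
def CoreCovers (H : Finset (Operation P V)) (w : V) (lo hi : ℚ≥0) : Prop :=
  (∃ o ∈ H, o.op.value = some w ∧ o.res ≤ lo) ∧
    ((∃ o ∈ H, o.op.value = some w ∧ hi ≤ o.inv) ∨ ∀ o ∈ H, o.op ≠ .deq w)

/-- The gap lies in the interval of `o` and between the invocation of the insertion and the
response of the removal of the value of `o`. -/
def InClip (H : Finset (Operation P V)) (o : Operation P V) (lo hi : ℚ≥0) : Prop :=
  o.inv ≤ lo ∧ hi ≤ o.res ∧ ∀ v, o.op.value = some v →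
    (∀ e ∈ H, e.op = .enq v → e.inv ≤ lo) ∧ ∀ d ∈ H, d.op = .deq v → hi ≤ d.res

/-- The priority of an operation, least for `empty`. -/
def AbsOp.priority (a : AbsOp V) : WithBot V := a.value

/-- The operation inserts a value. -/
def AbsOp.IsEnq (a : AbsOp V) : Prop := ∃ v, a = .enq v

variable {H : Finset (Operation P V)}

theorem inv_mem_times {o : Operation P V} (h : o ∈ H) : o.inv ∈ times H :=
  Finset.mem_union_left _ (Finset.mem_image_of_mem _ h)

theorem res_mem_times {o : Operation P V} (h : o ∈ H) : o.res ∈ times H :=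
  Finset.mem_union_right _ (Finset.mem_image_of_mem _ h)

/-- The gap is bounded by the greatest time below `x` and the least time at or above it. It is
half-open so that `x` may itself be one of the times. -/
theorem exists_isGap_of_lt {a b x : ℚ≥0} (ha : a ∈ times H) (hb : b ∈ times H) (hax : a < x)
    (hxb : x ≤ b) : ∃ lo hi, IsGap H lo hi ∧ lo < x ∧ x ≤ hi := by
  obtain ⟨lo, hlo, hlo'⟩ := Finset.exists_max_image ((times H).filter (· < x)) id
    ⟨a, by simp [ha, hax]⟩
  obtain ⟨hi, hhi, hhi'⟩ := Finset.exists_min_image ((times H).filter (x ≤ ·)) id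
    ⟨b, by simp [hb, hxb]⟩
  simp only [Finset.mem_filter, id, and_imp] at hlo hhi hlo' hhi'
  refine ⟨lo, hi, ⟨hlo.1, hhi.1, hlo.2.trans_le hhi.2, fun t ht => ?_⟩, hlo.2, hhi.2⟩
  rcases lt_or_ge t x with h | h
  · exact .inl (hlo' t ht h)
  · exact .inr (hhi' t ht h)

theorem IsGap.le_of_lt {lo hi t : ℚ≥0} (h : IsGap H lo hi) (ht : t ∈ times H) (hl : lo < t) :
    hi ≤ t := (h.2.2.2 t ht).resolve_left (not_le.2 hl)

theorem IsGap.le_of_lt' {lo hi t : ℚ≥0} (h : IsGap H lo hi) (ht : t ∈ times H) (hl : t < hi) :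
    t ≤ lo := (h.2.2.2 t ht).resolve_right (not_le.2 hl)

theorem IsGap.unique {lo hi hi' : ℚ≥0} (h : IsGap H lo hi) (h' : IsGap H lo hi') : hi = hi' :=
  le_antisymm (h.le_of_lt h'.2.1 h'.2.2.1) (h'.le_of_lt h.2.1 h.2.2.1)

theorem distinct_of_unambiguous (hU : Unambiguous H) {s : List (Operation P V)}
    (hs : (s : Multiset (Operation P V)) = H.val) : Distinct (s.map Operation.op) := by
  have hn : s.Nodup := by
    have := H.nodup; rw [← hs] at this; simpa using this
  have hm : ∀ o, o ∈ s ↔ o ∈ H := fun o => by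
    rw [← Finset.mem_val, ← hs, Multiset.mem_coe]
  rw [Distinct, List.pairwise_map]
  refine hn.imp_of_mem fun {a b} ha hb hab v => ⟨fun h1 h2 => ?_, fun h1 h2 => ?_⟩
  · exact hab ((hU v ⟨a, (hm a).1 ha, by simp [h1, AbsOp.value]⟩).1.unique
      ⟨(hm a).1 ha, h1⟩ ⟨(hm b).1 hb, h2⟩)
  · exact hab ((hU v ⟨a, (hm a).1 ha, by simp [h1, AbsOp.value]⟩).2 a ((hm a).1 ha) b
      ((hm b).1 hb) h1 h2)

theorem exists_enq (hU : Unambiguous H) {o : Operation P V} (ho : o ∈ H) {v : V}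
    (hv : o.op.value = some v) : ∃ e ∈ H, e.op = .enq v := by
  obtain ⟨e, he, -⟩ := (hU v ⟨o, ho, hv⟩).1
  exact ⟨e, he.1, he.2⟩

theorem Unambiguous.enq_unique (hU : Unambiguous H) {e e' : Operation P V} (he : e ∈ H)
    (he' : e' ∈ H) {v : V} (h : e.op = .enq v) (h' : e'.op = .enq v) : e = e' :=
  (hU v ⟨e, he, by simp [h, AbsOp.value]⟩).1.unique ⟨he, h⟩ ⟨he', h'⟩

theorem Unambiguous.deq_unique (hU : Unambiguous H) {e e' : Operation P V} (he : e ∈ H)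
    (he' : e' ∈ H) {v : V} (h : e.op = .deq v) (h' : e'.op = .deq v) : e = e' :=
  (hU v ⟨e, he, by simp [h, AbsOp.value]⟩).2 e he e' he' h h'

theorem isEnq_iff_of_value {a : AbsOp V} {v : V} (h : a.value = some v) : a.IsEnq ↔ a = .enq v := by
  constructor
  · rintro ⟨w, rfl⟩; cases h; rfl
  · rintro rfl; exact ⟨v, rfl⟩

theorem priority_of_value {a : AbsOp V} {v : V} (h : a.value = some v) :
    a.priority = (v : WithBot V) := h

theorem not_isEnq_deq {v : V} : ¬ (AbsOp.deq v).IsEnq := by rintro ⟨w, hw⟩; cases hw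

variable [LinearOrder V]

/-- No value of priority greater than `x` is forced to be present in the gap. -/
def Free (H : Finset (Operation P V)) (x : WithBot V) (lo hi : ℚ≥0) : Prop :=
  ∀ w : V, x < (w : WithBot V) → ¬ CoreCovers H w lo hi

/-- Each operation other than an insertion has a gap in which it can be executed. -/
def Placeable (H : Finset (Operation P V)) : Prop :=
  ∀ o ∈ H, ¬ o.op.IsEnq → ∃ lo hi, IsGap H lo hi ∧ InClip H o lo hi ∧ Free H o.op.priority lo hi

theorem Enabled.of_value {τ : List (AbsOp V)} {a : AbsOp V} (h : Enabled τ a) (ha : ¬ a.IsEnq)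
    {v : V} (hv : a.value = some v) : AbsOp.enq v ∈ τ ∧ AbsOp.deq v ∉ τ := by
  cases a with
  | enq v => exact absurd ⟨v, rfl⟩ ha
  | deq w => cases hv; exact ⟨h.1, h.2.1⟩
  | peek w => cases hv; exact ⟨h.1, h.2.1⟩
  | empty => cases hv

theorem Enabled.of_priority_lt {τ : List (AbsOp V)} {a : AbsOp V} (h : Enabled τ a)
    (ha : ¬ a.IsEnq) {w : V} (hw : a.priority < (w : WithBot V)) (hq : AbsOp.enq w ∈ τ) :
    AbsOp.deq w ∈ τ := by
  cases a with
  | enq v => exact absurd ⟨v, rfl⟩ ha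
  | deq v => exact h.2.2 w (WithBot.coe_lt_coe.1 hw) hq
  | peek v => exact h.2.2 w (WithBot.coe_lt_coe.1 hw) hq
  | empty => exact h w hq

/-- Giving `empty` the priority `⊥` merges the conditions for removal, peek and emptiness into two:
the value of the operation, if any, is present, and nothing of greater priority is. -/
theorem enabled_of {τ : List (AbsOp V)} {a : AbsOp V}
    (h1 : ¬ a.IsEnq → ∀ v, a.value = some v → AbsOp.enq v ∈ τ ∧ AbsOp.deq v ∉ τ)
    (h2 : ¬ a.IsEnq → ∀ w : V, a.priority < (w : WithBot V) → AbsOp.enq w ∈ τ → AbsOp.deq w ∈ τ) :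
    Enabled τ a := by
  cases a with
  | enq v => trivial
  | deq v =>
    have h : ¬ (AbsOp.deq v).IsEnq := by rintro ⟨w, hw⟩; cases hw
    exact ⟨(h1 h v rfl).1, (h1 h v rfl).2, fun w hw => h2 h w (WithBot.coe_lt_coe.2 hw)⟩
  | peek v =>
    have h : ¬ (AbsOp.peek v).IsEnq := by rintro ⟨w, hw⟩; cases hw
    exact ⟨(h1 h v rfl).1, (h1 h v rfl).2, fun w hw => h2 h w (WithBot.coe_lt_coe.2 hw)⟩
  | empty =>
    have h : ¬ (AbsOp.empty : AbsOp V).IsEnq := by rintro ⟨w, hw⟩; cases hw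
    exact fun w => h2 h w (WithBot.bot_lt_coe w)

/-- The properties of a linearization of a history that make it executable. -/
theorem exists_executable_of_linearizable (hU : Unambiguous H) (hL : Linearizable H) :
    ∃ l : Operation P V → ℚ≥0, (∀ o ∈ H, o.inv < l o ∧ l o < o.res) ∧
      (∀ o ∈ H, ¬ o.op.IsEnq → ∀ v, o.op.value = some v →
        (∃ e ∈ H, e.op = .enq v ∧ l e < l o) ∧ ∀ d ∈ H, d.op = .deq v → l o ≤ l d) ∧
      ∀ o ∈ H, ¬ o.op.IsEnq → ∀ w : V, o.op.priority < (w : WithBot V) →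
        ∀ e ∈ H, e.op = .enq w → l e < l o → ∃ d ∈ H, d.op = .deq w ∧ l d < l o := by
  obtain ⟨l, ⟨-, hl⟩, τ, hτ, s, hs, hp, rfl⟩ := hL
  have hm : ∀ o, o ∈ s ↔ o ∈ H := fun o => by
    rw [← Finset.mem_val, ← hs, Multiset.mem_coe]
  rw [mem_spec_iff (distinct_of_unambiguous hU hs)] at hτ
  have key : ∀ o ∈ H, ∃ s₁ s₂, s = s₁ ++ o :: s₂ ∧ Enabled (s₁.map Operation.op) o.op ∧
      ∀ a ∈ H, a ∈ s₁ ↔ l a < l o := by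
    intro o ho
    obtain ⟨s₁, s₂, rfl⟩ := List.append_of_mem ((hm o).2 ho)
    refine ⟨s₁, s₂, rfl, hτ _ _ (s₂.map Operation.op) (by simp), fun a ha => ?_⟩
    have hp' := List.pairwise_append.1 hp
    have ha' := (hm a).2 ha
    constructor
    · intro h; exact hp'.2.2 a h o (by simp)
    · intro h
      simp only [List.mem_append, List.mem_cons] at ha'
      rcases ha' with h' | rfl | h'
      · exact h'
      · exact absurd h (lt_irrefl _)
      · exact absurd ((List.pairwise_cons.1 hp'.2.1).1 a h') (not_lt.2 h.le)
  refine ⟨l, hl, fun o ho hq v hv => ?_, fun o ho hq w hw e he hew hlt => ?_⟩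
  · obtain ⟨s₁, s₂, rfl, hen, hlt⟩ := key o ho
    obtain ⟨h1, h2⟩ := hen.of_value hq hv
    constructor
    · obtain ⟨e, he, hev⟩ := List.mem_map.1 h1
      have he' := (hm e).1 (by simp [he])
      exact ⟨e, he', hev, (hlt e he').1 he⟩
    · intro d hd hdv
      by_contra! hc
      exact h2 (List.mem_map.2 ⟨d, (hlt d hd).2 hc, hdv⟩)
  · obtain ⟨s₁, s₂, rfl, hen, hlt'⟩ := key o ho
    have := hen.of_priority_lt hq hw (List.mem_map.2 ⟨e, (hlt' e he).2 hlt, hew⟩)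
    obtain ⟨d, hd, hdv⟩ := List.mem_map.1 this
    have hd' := (hm d).1 (by simp [hd])
    exact ⟨d, hd', hdv, (hlt' d hd').1 hd⟩

/-- The gap around the linearization point of `o` works. Operations linearized no later were invoked
before the gap, and those linearized no earlier respond after it. A certainly present greater value
would be inserted before `o` and removed only later or never, so `o` could not be executed. -/
theorem placeable_of_linearizable (hU : Unambiguous H) (hL : Linearizable H) : Placeable H := by
  obtain ⟨l, hl, hv, hw⟩ := exists_executable_of_linearizable hU hL
  have hbefore : ∀ o ∈ H, ∀ v, o.op.value = some v → ∀ e ∈ H, e.op = .enq v → l e ≤ l o := by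
    intro o ho v hov e he hev
    by_cases hq : o.op.IsEnq
    · rw [isEnq_iff_of_value hov] at hq
      rw [hU.enq_unique he ho hev hq]
    · obtain ⟨e', he', hev', hlt⟩ := (hv o ho hq v hov).1
      rw [hU.enq_unique he he' hev hev']
      exact hlt.le
  have hafter : ∀ o ∈ H, ∀ v, o.op.value = some v → ∀ d ∈ H, d.op = .deq v → l o ≤ l d := by
    intro o ho v hov d hd hdv
    by_cases hq : o.op.IsEnq
    · rw [isEnq_iff_of_value hov] at hq
      exact hbefore d hd v (by simp [hdv, AbsOp.value]) o ho hq
    · exact (hv o ho hq v hov).2 d hd hdv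
  intro o ho hq
  obtain ⟨lo, hi, hg, h1, h2⟩ := exists_isGap_of_lt (inv_mem_times ho) (res_mem_times ho)
    (hl o ho).1 (hl o ho).2.le
  have hlow : ∀ a ∈ H, l a ≤ l o → a.inv ≤ lo := fun a ha h =>
    hg.le_of_lt' (inv_mem_times ha) (((hl a ha).1.trans_le h).trans_le h2)
  have hhigh : ∀ a ∈ H, l o ≤ l a → hi ≤ a.res := fun a ha h =>
    hg.le_of_lt (res_mem_times ha) (h1.trans_le (h.trans (hl a ha).2.le))
  refine ⟨lo, hi, hg, ⟨hlow o ho le_rfl, hhigh o ho le_rfl, fun v hov =>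
    ⟨fun e he hev => hlow e he (hbefore o ho v hov e he hev),
     fun d hd hdv => hhigh d hd (hafter o ho v hov d hd hdv)⟩⟩, fun w hpw hc => ?_⟩
  obtain ⟨⟨o₁, ho₁, hw₁, hr⟩, h⟩ := hc
  obtain ⟨e, he, hew⟩ := exists_enq hU ho₁ hw₁
  have : l e < l o :=
    ((hbefore o₁ ho₁ w hw₁ e he hew).trans_lt (hl o₁ ho₁).2).trans_le (hr.trans h1.le)
  obtain ⟨d, hd, hdw, hlt⟩ := hw o ho hq w hpw e he hew this
  rcases h with ⟨o₂, ho₂, hw₂, hi₂⟩ | h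
  · have h3 : l o < l o₂ := (h2.trans hi₂).trans_lt (hl o₂ ho₂).1
    exact absurd (hafter o₂ ho₂ w hw₂ d hd hdw) (not_le.2 (hlt.trans h3))
  · exact h d hd hdw

/-- A history is linearizable if its operations can be placed in gaps and ordered by keys such
that the sequential specification is obeyed. -/
theorem linearizable_of_key {K : Type*} [LinearOrder K] (hU : Unambiguous H)
    (key : Operation P V → K) (lo hi : Operation P V → ℚ≥0)
    (hb : ∀ o ∈ H, o.inv ≤ lo o ∧ lo o < hi o ∧ hi o ≤ o.res)
    (hmono : ∀ a ∈ H, ∀ b ∈ H, key a ≤ key b → (lo a = lo b ∧ hi a = hi b) ∨ hi a ≤ lo b)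
    (henq : ∀ o ∈ H, ¬ o.op.IsEnq → ∀ v, o.op.value = some v →
      ∃ e ∈ H, e.op = .enq v ∧ key e < key o)
    (hdeq : ∀ o ∈ H, ¬ o.op.IsEnq → ∀ v, o.op.value = some v → o.op ≠ .deq v →
      ∀ d ∈ H, d.op = .deq v → key o < key d)
    (hprio : ∀ o ∈ H, ¬ o.op.IsEnq → ∀ w : V, o.op.priority < (w : WithBot V) →
      ∀ e ∈ H, e.op = .enq w → key e ≤ key o → ∃ d ∈ H, d.op = .deq w ∧ key d < key o) :
    Linearizable H := by
  classical
  -- Operations with equal keys may come in either order. This is why the priority hypothesis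
  -- accepts `key e ≤ key o` while everything that must precede or follow is demanded strictly.
  set s := H.toList.insertionSort (fun a b => key a ≤ key b) with hsdef
  have hperm : s.Perm H.toList := List.perm_insertionSort _ _
  have hs : (s : Multiset (Operation P V)) = H.val := by
    rw [Multiset.coe_eq_coe.2 hperm]; simp
  have hm : ∀ o, o ∈ s ↔ o ∈ H := fun o => by rw [hperm.mem_iff]; simp
  have hn : s.Nodup := by rw [hperm.nodup_iff]; exact H.nodup_toList
  have hsort : s.Pairwise (fun a b => key a ≤ key b) := by
    have : Std.Total (fun a b : Operation P V => key a ≤ key b) := ⟨fun a b => le_total _ _⟩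
    have : IsTrans _ (fun a b : Operation P V => key a ≤ key b) := ⟨fun a b c => le_trans⟩
    exact List.pairwise_insertionSort _ _
  set n := s.length with hndef
  -- The operation at position `i` is put at the fraction `(i + 1) / (n + 1)` of its gap. The
  -- position is global, so distinctness and order inside a gap are automatic without counting its
  -- operations.
  let x : ℕ → ℚ≥0 := fun i => (i + 1) / (n + 1)
  have hx0 : ∀ i, 0 < x i := fun i => by positivity
  have hx1 : ∀ i, i < n → x i < 1 := fun i hi => by
    rw [div_lt_one (by positivity)]; exact_mod_cast Nat.succ_lt_succ hi
  have hxm : ∀ i j, i < j → x i < x j := fun i j h => by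
    apply div_lt_div_of_pos_right _ (by positivity)
    exact_mod_cast Nat.succ_lt_succ h
  let l : Operation P V → ℚ≥0 := fun o => lo o + (hi o - lo o) * x (s.idxOf o)
  have hl : ∀ o ∈ H, lo o < l o ∧ l o < hi o := by
    intro o ho
    have h1 : 0 < hi o - lo o := tsub_pos_of_lt (hb o ho).2.1
    refine ⟨lt_add_of_pos_right _ (mul_pos h1 (hx0 _)), ?_⟩
    calc l o < lo o + (hi o - lo o) * 1 := by
          apply add_lt_add_right
          exact mul_lt_mul_of_pos_left (hx1 _ (List.idxOf_lt_length_iff.2 ((hm o).2 ho))) h1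
      _ = hi o := by rw [mul_one]; exact add_tsub_cancel_of_le (hb o ho).2.1.le
  have hlt : s.Pairwise (fun a b => l a < l b) := by
    rw [List.pairwise_iff_getElem] at hsort ⊢
    intro i j hi' hj hij
    have h1 : s.idxOf s[i] = i := hn.idxOf_getElem i hi'
    have h2 : s.idxOf s[j] = j := hn.idxOf_getElem j hj
    have hi2 := (hm _).1 (List.getElem_mem hi')
    have hj2 := (hm _).1 (List.getElem_mem hj)
    rcases hmono _ hi2 _ hj2 (hsort i j hi' hj hij) with ⟨h3, h4⟩ | h3
    · simp only [l, h1, h2, h3, h4]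
      apply add_lt_add_right
      exact mul_lt_mul_of_pos_left (hxm _ _ hij) (tsub_pos_of_lt (hb _ hj2).2.1)
    · exact (hl _ hi2).2.trans_le (h3.trans (hl _ hj2).1.le)
  refine ⟨l, ⟨?_, fun o ho => ⟨(hb o ho).1.trans_lt (hl o ho).1,
    (hl o ho).2.trans_le (hb o ho).2.2⟩⟩, s.map Operation.op, ?_, s, hs, hlt, rfl⟩
  · intro a ha b hb hab
    have : (s.map l).Nodup := List.pairwise_map.2 (hlt.imp fun h => h.ne)
    exact List.inj_on_of_nodup_map this ((hm a).2 ha) ((hm b).2 hb) hab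
  · rw [mem_spec_iff (distinct_of_unambiguous hU hs)]
    intro τ₁ a τ₂ hτ
    obtain ⟨s₁, s', hs', rfl, h'⟩ := List.map_eq_append_iff.1 hτ
    obtain ⟨o, s₂, rfl, rfl, rfl⟩ := List.map_eq_cons_iff.1 h'
    have ho : o ∈ H := (hm o).1 (by simp [hs'])
    have hp := hsort
    rw [hs', List.pairwise_append] at hp
    have hbef : ∀ b ∈ s₁, b ∈ H ∧ key b ≤ key o ∧ b ≠ o := by
      intro b hb'
      refine ⟨(hm b).1 (by simp [hs', hb']), hp.2.2 b hb' o (by simp), ?_⟩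
      rintro rfl
      rw [hs', List.nodup_append] at hn
      exact hn.2.2 b hb' b (by simp) rfl
    have hbef' : ∀ b ∈ H, key b < key o → b ∈ s₁ := by
      intro b hb' hk
      have hb2 := (hm b).2 hb'
      rw [hs'] at hb2
      simp only [List.mem_append, List.mem_cons] at hb2
      rcases hb2 with h | rfl | h
      · exact h
      · exact absurd hk (lt_irrefl _)
      · exact absurd ((List.pairwise_cons.1 hp.2.1).1 b h) (not_le.2 hk)
    apply enabled_of
    · intro hq v hv
      obtain ⟨e, he, hev, hlt'⟩ := henq o ho hq v hv
      refine ⟨List.mem_map.2 ⟨e, hbef' e he hlt', hev⟩, fun hd => ?_⟩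
      obtain ⟨d, hd, hdv⟩ := List.mem_map.1 hd
      obtain ⟨hd1, hd2, hd3⟩ := hbef d hd
      by_cases hod : o.op = .deq v
      · exact hd3 (hU.deq_unique hd1 ho hdv hod)
      · exact absurd (hdeq o ho hq v hv hod d hd1 hdv) (not_lt.2 hd2)
    · intro hq w hw he
      obtain ⟨e, he, hew⟩ := List.mem_map.1 he
      obtain ⟨he1, he2, -⟩ := hbef e he
      obtain ⟨d, hd, hdw, hk⟩ := hprio o ho hq w hw e he1 hew he2
      exact List.mem_map.2 ⟨d, hbef' d hd hk, hdw⟩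

end Criterion

/-! ### Choosing a gap for every operation -/

section Placement

variable {P V : Type*} [LinearOrder V] {H : Finset (Operation P V)}

/-- No operation on `v` is invoked after `lo`, and `v` is removed. -/
def Late (H : Finset (Operation P V)) (v : V) (lo : ℚ≥0) : Prop :=
  (∃ d ∈ H, d.op = .deq v) ∧ ∀ o ∈ H, o.op.value = some v → o.inv ≤ lo

/-- The gap is free and suitable for `o`, and no earlier free gap is late. -/
def Admissible (H : Finset (Operation P V)) (o : Operation P V) (lo : ℚ≥0) : Prop :=
  ∃ hi, IsGap H lo hi ∧ InClip H o lo hi ∧ Free H o.op.priority lo hi ∧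
    ∀ v, o.op.value = some v → ∀ lo' hi', IsGap H lo' hi' → Free H (v : WithBot V) lo' hi' →
      lo' < lo → ¬ Late H v lo'

/-- If late free gaps precede the given one, the earliest of them can be used instead: lateness puts
all invocations on the value before it, and being earlier it still ends before the relevant
responses. -/
theorem exists_admissible (hP : Placeable H) {o : Operation P V} (ho : o ∈ H)
    (hq : ¬ o.op.IsEnq) : ∃ lo, Admissible H o lo := by
  classical
  obtain ⟨lo, hi, hg, hc, hf⟩ := hP o ho hq
  by_cases hL : ∃ v, o.op.value = some v ∧ ∃ lo' hi', IsGap H lo' hi' ∧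
      Free H (v : WithBot V) lo' hi' ∧ lo' < lo ∧ Late H v lo'
  · obtain ⟨v, hv, lo', hi', hg', hf', hlt, hl⟩ := hL
    obtain ⟨x, hx, hmin⟩ := Finset.exists_min_image
      ((times H).filter fun y => (∃ z, IsGap H y z ∧ Free H (v : WithBot V) y z) ∧ Late H v y) id
      ⟨lo', by simp only [Finset.mem_filter]; exact ⟨hg'.1, ⟨hi', hg', hf'⟩, hl⟩⟩
    simp only [Finset.mem_filter, id, and_imp] at hx hmin
    obtain ⟨hx1, ⟨z, hxz, hfx⟩, hxl⟩ := hx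
    have hxlo : x < lo := (hmin lo' hg'.1 ⟨hi', hg', hf'⟩ hl).trans_lt hlt
    have hz : z ≤ hi := (hxz.le_of_lt hg.1 hxlo).trans hg.2.2.1.le
    refine ⟨x, z, hxz, ⟨hxl.2 o ho hv, hz.trans hc.2.1, fun w hw => ?_⟩, ?_, ?_⟩
    · obtain rfl : v = w := by rw [hv] at hw; exact Option.some.inj hw
      exact ⟨fun e he hev => hxl.2 e he (by simp [hev, AbsOp.value]),
        fun d hd hdv => hz.trans ((hc.2.2 v hv).2 d hd hdv)⟩
    · rw [priority_of_value hv]; exact hfx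
    · intro w hw y y' hy hfy hyx hyl
      obtain rfl : v = w := by rw [hv] at hw; exact Option.some.inj hw
      exact absurd (hmin y hy.1 ⟨y', hy, hfy⟩ hyl) (not_le.2 hyx)
  · exact ⟨lo, hi, hg, hc, hf, fun v hv lo' hi' hg' hf' hlt hl =>
      hL ⟨v, hv, lo', hi', hg', hf', hlt, hl⟩⟩

theorem exists_last_admissible (hP : Placeable H) (o : Operation P V) :
    ∃ x, o ∈ H → ¬ o.op.IsEnq → Admissible H o x ∧ ∀ y, Admissible H o y → y ≤ x := by
  classical
  by_cases ho : o ∈ H ∧ ¬ o.op.IsEnq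
  · obtain ⟨lo, hlo⟩ := exists_admissible hP ho.1 ho.2
    have hT : ∀ y, Admissible H o y → y ∈ times H := fun y hy => by
      obtain ⟨_, h, _⟩ := hy; exact h.1
    obtain ⟨x, hx, hmax⟩ := Finset.exists_max_image
      ((times H).filter fun y => Admissible H o y) id
      ⟨lo, by simp only [Finset.mem_filter]; exact ⟨hT lo hlo, hlo⟩⟩
    simp only [Finset.mem_filter, id, and_imp] at hx hmax
    exact ⟨x, fun _ _ => ⟨hx.2, fun y hy => hmax y (hT y hy) hy⟩⟩
  · exact ⟨0, fun h1 h2 => absurd ⟨h1, h2⟩ ho⟩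

/-- A placement of the operations in gaps: `g o` is the gap of the operation `o`, unless it is an
insertion, and the values `v` are inserted in the gap `ge v` and removed in the gap `gd v`. -/
structure IsPlacement (H : Finset (Operation P V)) (g : Operation P V → ℚ≥0) (ge gd : V → ℚ≥0) :
    Prop where
  gap : ∀ o ∈ H, ¬ o.op.IsEnq → ∃ hi, IsGap H (g o) hi ∧ InClip H o (g o) hi ∧
    Free H o.op.priority (g o) hi
  gap_enq : ∀ e ∈ H, ∀ v, e.op = .enq v → ∃ hi, IsGap H (ge v) hi ∧ e.inv ≤ ge v ∧ hi ≤ e.res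
  enq_le : ∀ o ∈ H, ¬ o.op.IsEnq → ∀ v, o.op.value = some v → ge v ≤ g o
  le_deq : ∀ o ∈ H, ¬ o.op.IsEnq → ∀ v, o.op.value = some v → g o ≤ gd v
  deq_eq : ∀ d ∈ H, ∀ v, d.op = .deq v → g d = gd v
  lt_of_no_deq : ∀ v, (∀ d ∈ H, d.op ≠ .deq v) → ∀ lo hi, IsGap H lo hi → lo < gd v
  covers : ∀ e ∈ H, ∀ v, e.op = .enq v → ∀ lo hi, IsGap H lo hi →
    Free H (v : WithBot V) lo hi → ge v < lo → lo < gd v → CoreCovers H v lo hi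

/-- Every non-insertion goes to its last admissible gap. Maximality shows both that no operation
comes after the removal of its value and that a value inserted before a free gap has an operation
that has responded by then; admissibility of the removal shows that a later operation on it is still
to be invoked. -/
theorem exists_isPlacement (hU : Unambiguous H) (hP : Placeable H) :
    ∃ g ge gd, IsPlacement H g ge gd := by
  classical
  choose g hg using exists_last_admissible hP
  have hgap : ∀ o ∈ H, ¬ o.op.IsEnq → ∃ hi, IsGap H (g o) hi ∧ InClip H o (g o) hi ∧
      Free H o.op.priority (g o) hi := by
    intro o ho hq
    obtain ⟨hi, h1, h2, h3, -⟩ := (hg o ho hq).1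
    exact ⟨hi, h1, h2, h3⟩
  have hge : ∀ v, ∃ x, ∀ e ∈ H, e.op = .enq v →
      (∃ hi, IsGap H x hi ∧ e.inv ≤ x ∧ hi ≤ e.res) ∧
      (∀ o ∈ H, ¬ o.op.IsEnq → o.op.value = some v → x ≤ g o) ∧
      ∀ lo hi, IsGap H lo hi → x < lo → e.res ≤ lo ∨
        ∃ o ∈ H, ¬ o.op.IsEnq ∧ o.op.value = some v ∧ g o < lo := by
    intro v
    by_cases hv : ∃ e ∈ H, e.op = .enq v
    · obtain ⟨e, he, hev⟩ := hv
      -- With `x = e.res` this is the last gap in the interval of the insertion, used unless an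
      -- operation on the value is placed earlier.
      obtain ⟨p, p', hp, hp1, hp2⟩ := exists_isGap_of_lt (inv_mem_times he) (res_mem_times he)
        e.inv_lt_res le_rfl
      have hpe : e.inv ≤ p := hp.le_of_lt' (inv_mem_times he) (e.inv_lt_res.trans_le hp2)
      have hpe' : p' ≤ e.res := hp.le_of_lt (res_mem_times he) hp1
      obtain ⟨x, hx, hmin⟩ := Finset.exists_min_image
        (insert p ((H.filter fun o => ¬ o.op.IsEnq ∧ o.op.value = some v).image g)) id
        ⟨p, by simp⟩
      simp only [Finset.mem_insert, Finset.mem_image, Finset.mem_filter, id] at hx hmin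
      have hxp : x ≤ p := hmin p (.inl rfl)
      refine ⟨x, fun e' he' hev' => ?_⟩
      obtain rfl := hU.enq_unique he he' hev hev'
      refine ⟨?_, fun o ho hq hov => hmin _ (.inr ⟨o, ⟨ho, hq, hov⟩, rfl⟩), ?_⟩
      · rcases hx with rfl | ⟨o, ⟨ho, hq, hov⟩, rfl⟩
        · exact ⟨p', hp, hpe, hpe'⟩
        · obtain ⟨hi, h1, h2, -⟩ := hgap o ho hq
          refine ⟨hi, h1, (h2.2.2 v hov).1 e he hev, ?_⟩
          exact h1.le_of_lt (res_mem_times he) (hxp.trans_lt hp1)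
      · intro lo hi hlo hxlo
        rcases hx with rfl | ⟨o, ⟨ho, hq, hov⟩, rfl⟩
        · exact .inl (hp2.trans (hp.le_of_lt hlo.1 hxlo))
        · exact .inr ⟨o, ho, hq, hov, hxlo⟩
    · exact ⟨0, fun e he hev => absurd ⟨e, he, hev⟩ hv⟩
  choose ge hge using hge
  have hgd : ∀ v, ∃ y, (∀ d ∈ H, d.op = .deq v → g d = y) ∧
      ((∀ d ∈ H, d.op ≠ .deq v) → ∀ lo hi, IsGap H lo hi → lo < y) := by
    intro v
    by_cases hv : ∃ d ∈ H, d.op = .deq v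
    · obtain ⟨d, hd, hdv⟩ := hv
      exact ⟨g d, fun d' hd' hdv' => by rw [hU.deq_unique hd hd' hdv hdv'],
        fun h => absurd hdv (h d hd)⟩
    · refine ⟨(times H).sup id, fun d hd hdv => absurd ⟨d, hd, hdv⟩ hv, fun _ lo hi h => ?_⟩
      exact h.2.2.1.trans_le (Finset.le_sup (f := id) h.2.1)
  choose gd hgd hgd' using hgd
  refine ⟨g, ge, gd, hgap, fun e he v hev => (hge v e he hev).1, ?_, ?_,
    fun d hd v hdv => hgd v d hd hdv, hgd', ?_⟩
  · intro o ho hq v hv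
    obtain ⟨e, he, hev⟩ := exists_enq hU ho hv
    exact (hge v e he hev).2.1 o ho hq hv
  · intro o ho hq v hv
    obtain ⟨⟨hi, h1, h2, h3, h4⟩, -⟩ := hg o ho hq
    by_cases hd : ∃ d ∈ H, d.op = .deq v
    · obtain ⟨d, hd, hdv⟩ := hd
      have hdq : ¬ d.op.IsEnq := by rw [hdv]; exact not_isEnq_deq
      have hdv' : d.op.value = some v := by rw [hdv]; rfl
      rw [← hgd v d hd hdv]
      obtain ⟨⟨hi', h1', h2', h3', h4'⟩, hmax⟩ := hg d hd hdq
      -- If the removal is already invoked at the gap of `o`, that gap is admissible for the removal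
      -- too, so maximality applies; otherwise the removal is later anyway.
      rcases le_or_gt d.inv (g o) with h | h
      · apply hmax
        refine ⟨hi, h1, ⟨h, (h2.2.2 v hv).2 d hd hdv, fun w hw => ?_⟩, ?_, fun w hw => ?_⟩
        · obtain rfl : v = w := by rw [hdv'] at hw; exact Option.some.inj hw
          exact h2.2.2 v hv
        · rw [priority_of_value hdv', ← priority_of_value hv]; exact h3
        · obtain rfl : v = w := by rw [hdv'] at hw; exact Option.some.inj hw
          exact h4 v hv
      · exact h.le.trans h2'.1
    · exact (hgd' v (fun d hd' hdv => hd ⟨d, hd', hdv⟩) _ _ h1).le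
  · intro e he v hev lo hi hlo hf h1 h2
    -- A late free gap before `gd v` would contradict the admissibility of the gap chosen for the
    -- removal. Without a removal, no gap is late.
    have hnl : ∀ lo' hi', IsGap H lo' hi' → Free H (v : WithBot V) lo' hi' → lo' < gd v →
        ¬ Late H v lo' := by
      intro lo' hi' hg' hf' hlt hl
      obtain ⟨d, hd, hdv⟩ := hl.1
      have hdq : ¬ d.op.IsEnq := by rw [hdv]; exact not_isEnq_deq
      have hdv' : d.op.value = some v := by rw [hdv]; rfl
      rw [← hgd v d hd hdv] at hlt
      obtain ⟨⟨_, _, _, _, h⟩, -⟩ := hg d hd hdq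
      exact h v hdv' lo' hi' hg' hf' hlt hl
    constructor
    · rcases (hge v e he hev).2.2 lo hi hlo h1 with h | ⟨o, ho, hq, hov, h⟩
      · exact ⟨e, he, by rw [hev]; rfl, h⟩
      -- If no operation on `v` has responded by `lo`, then `o`, placed before `lo`, could be moved
      -- to `lo`: all responses come after this gap, and no late free gap precedes it. This
      -- contradicts the maximality of `g o`.
      · by_contra! hc
        have hres : ∀ a ∈ H, a.op.value = some v → hi ≤ a.res := fun a ha hav =>
          hlo.le_of_lt (res_mem_times ha) (hc a ha hav)
        obtain ⟨⟨z, -, hz, -⟩, hmax⟩ := hg o ho hq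
        refine absurd (hmax lo ⟨hi, hlo, ⟨hz.1.trans h.le, hres o ho hov, fun w hw => ?_⟩, ?_,
          fun w hw lo' hi' hg' hf' hlt => ?_⟩) (not_le.2 h)
        · obtain rfl : v = w := by rw [hov] at hw; exact Option.some.inj hw
          exact ⟨fun a ha hav => ((hz.2.2 v hov).1 a ha hav).trans h.le,
            fun d hd hdv => hres d hd (by rw [hdv]; rfl)⟩
        · rw [priority_of_value hov]; exact hf
        · obtain rfl : v = w := by rw [hov] at hw; exact Option.some.inj hw
          exact hnl lo' hi' hg' hf' (hlt.trans h2)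
    · have := hnl lo hi hlo hf h2
      simp only [Late, not_and, not_forall, not_le] at this
      by_cases hd : ∃ d ∈ H, d.op = .deq v
      · obtain ⟨o, ho, hov, h⟩ := this hd
        exact .inl ⟨o, ho, hov, hlo.le_of_lt (inv_mem_times ho) h⟩
      · exact .inr fun d hd' hdv => hd ⟨d, hd', hdv⟩

end Placement

/-! ### The order inside a gap and sufficiency of the criterion -/

section Order

variable {P V : Type*}

/-- Position of the methods in the life of a value. -/
def AbsOp.stage : AbsOp V → ℕ
  | .enq _ => 0
  | .deq _ => 2
  | .peek _ => 1
  | .empty => 1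

theorem AbsOp.stage_pos {a : AbsOp V} (h : ¬ a.IsEnq) : 0 < a.stage := by
  cases a with
  | enq v => exact absurd ⟨v, rfl⟩ h
  | _ => simp [AbsOp.stage]

theorem AbsOp.stage_lt {a : AbsOp V} {v : V} (hv : a.value = some v) (h : a ≠ .deq v) :
    a.stage < 2 := by
  cases a with
  | deq w => cases hv; exact absurd rfl h
  | _ => simp [AbsOp.stage]

/-- The gap of an operation under a placement. -/
def place (g : Operation P V → ℚ≥0) (ge : V → ℚ≥0) (o : Operation P V) : ℚ≥0 :=
  match o.op with
  | .enq v => ge v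
  | _ => g o

theorem place_enq {g : Operation P V → ℚ≥0} {ge : V → ℚ≥0} {o : Operation P V} {v : V}
    (h : o.op = .enq v) : place g ge o = ge v := by simp [place, h]

theorem place_of_not_isEnq {g : Operation P V → ℚ≥0} {ge : V → ℚ≥0} {o : Operation P V}
    (h : ¬ o.op.IsEnq) : place g ge o = g o := by
  unfold place
  split
  · next v hv => exact absurd ⟨v, hv⟩ h
  · rfl

variable [LinearOrder V]

/-- The number of priorities in `H` up to `x`. -/
def rank (H : Finset (Operation P V)) (x : WithBot V) : ℤ :=
  ((H.image fun o => o.op.priority).filter (· ≤ x)).card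

/-- Ranks replace priorities in the sort keys because integers can be negated, which encodes falling
priority. -/
theorem rank_lt_rank {H : Finset (Operation P V)} {o : Operation P V} (ho : o ∈ H) {x : WithBot V}
    (h : x < o.op.priority) : rank H x < rank H o.op.priority := by
  unfold rank
  norm_cast
  apply Finset.card_lt_card
  refine (Finset.ssubset_iff_of_subset fun y hy => ?_).2 ⟨o.op.priority, ?_, ?_⟩
  · simp only [Finset.mem_filter] at hy ⊢
    exact ⟨hy.1, hy.2.trans h.le⟩
  · simp only [Finset.mem_filter, le_refl, and_true]
    exact Finset.mem_image_of_mem _ ho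
  · simp [h]

/-- Where the operations on `x` are executed among those in the gap `f`: first the values removed
but not inserted there, by decreasing priority, at the end the values inserted but not removed
there, by increasing priority, and the others in between. -/
def block (H : Finset (Operation P V)) (ge gd : V → ℚ≥0) (f : ℚ≥0) : WithBot V → ℤ ×ₗ ℤ
  | none => toLex (1, rank H ⊥)
  | some v =>
    if ge v < gd v ∧ f = gd v then toLex (0, - rank H v)
    else if ge v < gd v ∧ f = ge v then toLex (2, rank H v)
    else toLex (1, rank H v)

theorem block_cases (H : Finset (Operation P V)) (ge gd : V → ℚ≥0) (f : ℚ≥0) (x : WithBot V) :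
    block H ge gd f x = toLex (0, - rank H x) ∨ block H ge gd f x = toLex (1, rank H x) ∨
      block H ge gd f x = toLex (2, rank H x) := by
  cases x with
  | bot => exact .inr (.inl rfl)
  | coe v =>
    change (if _ then _ else _) = _ ∨ (if _ then _ else _) = _ ∨ (if _ then _ else _) = _
    split_ifs <;> simp

theorem block_deq {H : Finset (Operation P V)} {ge gd : V → ℚ≥0} {v : V} (h : ge v < gd v) :
    block H ge gd (gd v) (v : WithBot V) = toLex (0, - rank H v) := by
  change (if _ then _ else _) = _
  simp [h]

theorem block_enq {H : Finset (Operation P V)} {ge gd : V → ℚ≥0} {v : V} (h : ge v < gd v) :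
    block H ge gd (ge v) (v : WithBot V) = toLex (2, rank H v) := by
  change (if _ then _ else _) = _
  simp [h, h.ne]

theorem block_eq {H : Finset (Operation P V)} {ge gd : V → ℚ≥0} {v : V} (h : ge v = gd v) (f) :
    block H ge gd f (v : WithBot V) = toLex (1, rank H v) := by
  change (if _ then _ else _) = _
  simp [h]

/-- The key by which the operations are ordered. -/
def placementKey (H : Finset (Operation P V)) (g : Operation P V → ℚ≥0) (ge gd : V → ℚ≥0)
    (o : Operation P V) : ℚ≥0 ×ₗ ((ℤ ×ₗ ℤ) ×ₗ ℕ) :=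
  toLex (place g ge o, toLex (block H ge gd (place g ge o) o.op.priority, o.op.stage))

theorem placementKey_lt_of_place {H : Finset (Operation P V)} {g : Operation P V → ℚ≥0}
    {ge gd : V → ℚ≥0} {a b : Operation P V} (h : place g ge a < place g ge b) :
    placementKey H g ge gd a < placementKey H g ge gd b :=
  Prod.Lex.toLex_lt_toLex.2 (.inl h)

theorem placementKey_lt_of_block {H : Finset (Operation P V)} {g : Operation P V → ℚ≥0}
    {ge gd : V → ℚ≥0} {a b : Operation P V} (h : place g ge a = place g ge b)
    (h' : block H ge gd (place g ge a) a.op.priority < block H ge gd (place g ge b) b.op.priority) :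
    placementKey H g ge gd a < placementKey H g ge gd b :=
  Prod.Lex.toLex_lt_toLex.2 (.inr ⟨h, Prod.Lex.toLex_lt_toLex.2 (.inl h')⟩)

/-- Operations on one value in one gap share their block entry, so the stage puts the insertion
first and the removal last. -/
theorem placementKey_lt_of_stage {H : Finset (Operation P V)} {g : Operation P V → ℚ≥0}
    {ge gd : V → ℚ≥0} {a b : Operation P V} {v : V} (ha : a.op.value = some v)
    (hb : b.op.value = some v) (h : place g ge a ≤ place g ge b) (h' : a.op.stage < b.op.stage) :
    placementKey H g ge gd a < placementKey H g ge gd b := by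
  rcases h.lt_or_eq with h | h
  · exact placementKey_lt_of_place h
  · refine Prod.Lex.toLex_lt_toLex.2 (.inr ⟨h, Prod.Lex.toLex_lt_toLex.2 (.inr ⟨?_, h'⟩)⟩)
    simp only [h, priority_of_value ha, priority_of_value hb]

theorem place_le_of_key {H : Finset (Operation P V)} {g : Operation P V → ℚ≥0}
    {ge gd : V → ℚ≥0} {a b : Operation P V}
    (h : placementKey H g ge gd a ≤ placementKey H g ge gd b) : place g ge a ≤ place g ge b := by
  by_contra! hc
  exact absurd h (not_le.2 (placementKey_lt_of_place hc))

theorem block_le_of_key {H : Finset (Operation P V)} {g : Operation P V → ℚ≥0}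
    {ge gd : V → ℚ≥0} {a b : Operation P V}
    (h : placementKey H g ge gd a ≤ placementKey H g ge gd b) (h' : place g ge a = place g ge b) :
    block H ge gd (place g ge a) a.op.priority ≤ block H ge gd (place g ge b) b.op.priority := by
  by_contra! hc
  exact absurd h (not_le.2 (placementKey_lt_of_block h'.symm hc))

variable {H : Finset (Operation P V)}

/-- By `covers`, a value `w` inserted before the gap of `o` and removed after it would certainly be
present there, contrary to freeness. So the insertion or removal touches this gap, or `w` is removed
earlier. In the gap itself, a lasting insertion has a key above that of `o`, and the removal of an
old value has a key below it. -/
theorem IsPlacement.exists_deq {g : Operation P V → ℚ≥0} {ge gd : V → ℚ≥0}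
    (h : IsPlacement H g ge gd) {o e : Operation P V} (ho : o ∈ H) (hq : ¬ o.op.IsEnq) {w : V}
    (hw : o.op.priority < (w : WithBot V)) (he : e ∈ H) (hev : e.op = .enq w)
    (hk : placementKey H g ge gd e ≤ placementKey H g ge gd o) :
    ∃ d ∈ H, d.op = .deq w ∧ placementKey H g ge gd d < placementKey H g ge gd o := by
  obtain ⟨hi, hgap, -, hfree⟩ := h.gap o ho hq
  have hpe := place_enq (g := g) (ge := ge) hev
  have hpo := place_of_not_isEnq (g := g) (ge := ge) hq
  have hew : e.op.priority = (w : WithBot V) := by rw [hev]; rfl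
  have hle := place_le_of_key hk
  have hrank : rank H o.op.priority < rank H w := by
    rw [← hew]; exact rank_lt_rank he (hew ▸ hw)
  have hcase : ge w = g o ∨ gd w ≤ g o := by
    by_contra! hc
    rw [hpe, hpo] at hle
    -- Freeness for the priority of `o` implies freeness for the greater `w`, as `covers` requires.
    exact hfree w hw (h.covers e he w hev _ _ hgap (fun u hu => hfree u (hw.trans hu))
      (lt_of_le_of_ne hle hc.1) hc.2)
  have hex : ∃ d ∈ H, d.op = .deq w := by
    by_contra! hc
    have h1 := h.lt_of_no_deq w hc
    rcases hcase with h2 | h2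
    · have h3 : ge w < gd w := by rw [h2]; exact h1 _ _ hgap
      have := block_le_of_key hk (by rw [hpe, hpo, h2])
      rw [hpe, hew, block_enq h3] at this
      rcases block_cases H ge gd (place g ge o) o.op.priority with h4 | h4 | h4 <;>
      · rw [h4, Prod.Lex.toLex_le_toLex] at this
        simp only at this
        omega
    · exact absurd (h1 _ _ hgap) (not_lt.2 h2)
  obtain ⟨d, hd, hdv⟩ := hex
  have hdq : ¬ d.op.IsEnq := by rw [hdv]; exact not_isEnq_deq
  have hdw : d.op.priority = (w : WithBot V) := by rw [hdv]; rfl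
  have hpd := place_of_not_isEnq (g := g) (ge := ge) hdq
  rw [h.deq_eq d hd w hdv] at hpd
  have hed : ge w ≤ gd w := by
    rw [← h.deq_eq d hd w hdv]; exact h.enq_le d hd hdq w (by rw [hdv]; rfl)
  refine ⟨d, hd, hdv, ?_⟩
  rcases lt_trichotomy (gd w) (g o) with hlt | heq | hlt
  · apply placementKey_lt_of_place
    rwa [hpd, hpo]
  · apply placementKey_lt_of_block (by rw [hpd, hpo, heq])
    rw [hpd, hdw]
    rcases hed.lt_or_eq with h1 | h1
    · rw [block_deq h1]
      rcases block_cases H ge gd (place g ge o) o.op.priority with h4 | h4 | h4 <;>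
      · rw [h4, Prod.Lex.toLex_lt_toLex]
        simp [hrank]
    -- Here `w` is inserted and removed in this gap. As its rank exceeds that of `o`, its insertion
    -- can precede `o` only if `o` has first entry `2`; then the removal, with first entry `1`,
    -- precedes `o` as well.
    · have := block_le_of_key hk (by rw [hpe, hpo, ← heq, h1])
      rw [hew, block_eq h1] at this
      rw [block_eq h1]
      rcases block_cases H ge gd (place g ge o) o.op.priority with h4 | h4 | h4 <;>
      · rw [h4, Prod.Lex.toLex_le_toLex] at this
        rw [h4, Prod.Lex.toLex_lt_toLex]
        simp only at this ⊢
        omega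
  · have h2 := hcase.resolve_right (not_le.2 hlt)
    have h3 : ge w < gd w := by rw [h2]; exact hlt
    have := block_le_of_key hk (by rw [hpe, hpo, h2])
    rw [hpe, hew, block_enq h3] at this
    rcases block_cases H ge gd (place g ge o) o.op.priority with h4 | h4 | h4 <;>
    · rw [h4, Prod.Lex.toLex_le_toLex] at this
      simp only at this
      omega

theorem linearizable_of_placeable (hU : Unambiguous H) (hP : Placeable H) : Linearizable H := by
  obtain ⟨g, ge, gd, h⟩ := exists_isPlacement hU hP
  have hgap : ∀ o, ∃ hi, o ∈ H → IsGap H (place g ge o) hi ∧ o.inv ≤ place g ge o ∧ hi ≤ o.res := by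
    intro o
    by_cases ho : o ∈ H
    · by_cases hq : o.op.IsEnq
      · obtain ⟨v, hv⟩ := hq
        obtain ⟨hi, hh⟩ := h.gap_enq o ho v hv
        rw [place_enq hv]
        exact ⟨hi, fun _ => hh⟩
      · obtain ⟨hi, h1, h2, -⟩ := h.gap o ho hq
        rw [place_of_not_isEnq hq]
        exact ⟨hi, fun _ => ⟨h1, h2.1, h2.2.1⟩⟩
    · exact ⟨0, fun h => absurd h ho⟩
  choose hi hgap using hgap
  refine linearizable_of_key hU (placementKey H g ge gd) (place g ge) hi
    (fun o ho => ⟨(hgap o ho).2.1, (hgap o ho).1.2.2.1, (hgap o ho).2.2⟩) ?_ ?_ ?_ ?_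
  · intro a ha b hb hab
    rcases (place_le_of_key hab).lt_or_eq with hlt | heq
    · exact .inr ((hgap a ha).1.le_of_lt (hgap b hb).1.1 hlt)
    · refine .inl ⟨heq, (hgap a ha).1.unique ?_⟩
      rw [heq]; exact (hgap b hb).1
  · intro o ho hq v hv
    obtain ⟨e, he, hev⟩ := exists_enq hU ho hv
    refine ⟨e, he, hev, placementKey_lt_of_stage (by rw [hev]; rfl) hv ?_ ?_⟩
    · rw [place_enq hev, place_of_not_isEnq hq]; exact h.enq_le o ho hq v hv
    · rw [hev]; exact AbsOp.stage_pos hq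
  · intro o ho hq v hv hod d hd hdv
    refine placementKey_lt_of_stage hv (by rw [hdv]; rfl) ?_ ?_
    · rw [place_of_not_isEnq hq, place_of_not_isEnq (by rw [hdv]; exact not_isEnq_deq),
        h.deq_eq d hd v hdv]
      exact h.le_deq o ho hq v hv
    · rw [hdv]; exact AbsOp.stage_lt hv hod
  · intro o ho hq w hw e he hew hk
    exact h.exists_deq ho hq hw he hew hk

theorem linearizable_iff_placeable (hU : Unambiguous H) : Linearizable H ↔ Placeable H :=
  ⟨placeable_of_linearizable hU, linearizable_of_placeable hU⟩

end Order

/-! ### A calculus for values and numbers of function calls -/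

section Calculus

variable {P V : Type*} [LinearOrder V]

/-- The number of nodes of an expression. -/
def Expr.size : Expr → ℕ
  | .var _ => 1
  | .nil => 1
  | .pair e₁ e₂ => e₁.size + e₂.size + 1
  | .fst e => e.size + 1
  | .snd e => e.size + 1
  | .le e₁ e₂ => e₁.size + e₂.size + 1
  | .ite c e₁ e₂ => c.size + e₁.size + e₂.size + 1
  | .bind e b => e.size + b.size + 1
  | .call _ e => e.size + 1

/-- A bound for the steps of a function call other than those of the calls in it. -/
def callCost (p : Program) : ℕ := (p.map Expr.size).sum + 1

/-- The call of the function `f` on `d` returns `d'` after at most `n` function calls,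
itself included. -/
def Calls (p : Program) (f : ℕ) (d d' : Datum P V) (n : ℕ) : Prop :=
  ∃ body t, p[f]? = some body ∧ Eval p [d] body d' t ∧ t + 1 ≤ callCost p * n

theorem Calls.mono {p : Program} {f : ℕ} {d d' : Datum P V} {m n : ℕ} (h : Calls p f d d' m)
    (hmn : m ≤ n) : Calls p f d d' n := by
  obtain ⟨b, t, h1, h2, h3⟩ := h
  exact ⟨b, t, h1, h2, h3.trans (Nat.mul_le_mul_left _ hmn)⟩

/-- Weakest precondition: the expression has a value that satisfies `Q` together with the number
of function calls of the evaluation. -/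
def wp (p : Program) : Expr → List (Datum P V) → (Datum P V → ℕ → Prop) → Prop
  | .var i, env, Q => Q (env.getD i .nil) 0
  | .nil, _, Q => Q .nil 0
  | .pair e₁ e₂, env, Q =>
    wp p e₁ env fun d₁ k₁ => wp p e₂ env fun d₂ k₂ => Q (.pair d₁ d₂) (k₁ + k₂)
  | .fst e, env, Q => wp p e env fun d k => Q d.fst k
  | .snd e, env, Q => wp p e env fun d k => Q d.snd k
  | .le e₁ e₂, env, Q =>
    wp p e₁ env fun d₁ k₁ => wp p e₂ env fun d₂ k₂ => Q (Datum.le d₁ d₂) (k₁ + k₂)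
  | .ite c e₁ e₂, env, Q =>
    wp p c env fun d k => (d ≠ .nil → wp p e₁ env fun d' k' => Q d' (k + k')) ∧
      (d = .nil → wp p e₂ env fun d' k' => Q d' (k + k'))
  | .bind e b, env, Q =>
    wp p e env fun d k => wp p b (d :: env) fun d' k' => Q d' (k + k')
  | .call f e, env, Q =>
    wp p e env fun d k => ∃ d' k', Calls p f d d' k' ∧ Q d' (k + k')

/-- Outside of calls each node of an expression is evaluated at most once, so its size bounds these
steps and only calls need to be counted. -/
theorem wp_sound {p : Program} {e : Expr} {env : List (Datum P V)} {Q : Datum P V → ℕ → Prop}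
    (h : wp p e env Q) :
    ∃ d k t, Q d k ∧ Eval p env e d t ∧ t ≤ e.size + callCost p * k := by
  induction e generalizing env Q with
  | var i => exact ⟨_, _, _, h, .var env i, by simp [Expr.size]⟩
  | nil => exact ⟨_, _, _, h, .nil env, by simp [Expr.size]⟩
  | pair e₁ e₂ ih₁ ih₂ =>
    obtain ⟨d₁, k₁, t₁, h₁, ev₁, le₁⟩ := ih₁ h
    obtain ⟨d₂, k₂, t₂, h₂, ev₂, le₂⟩ := ih₂ h₁
    exact ⟨_, _, _, h₂, .pair ev₁ ev₂, by simp only [Expr.size, mul_add]; omega⟩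
  | fst e ih =>
    obtain ⟨d, k, t, h, ev, le⟩ := ih h
    exact ⟨_, _, _, h, .fst ev, by simp only [Expr.size]; omega⟩
  | snd e ih =>
    obtain ⟨d, k, t, h, ev, le⟩ := ih h
    exact ⟨_, _, _, h, .snd ev, by simp only [Expr.size]; omega⟩
  | le e₁ e₂ ih₁ ih₂ =>
    obtain ⟨d₁, k₁, t₁, h₁, ev₁, le₁⟩ := ih₁ h
    obtain ⟨d₂, k₂, t₂, h₂, ev₂, le₂⟩ := ih₂ h₁
    exact ⟨_, _, _, h₂, .le ev₁ ev₂, by simp only [Expr.size, mul_add]; omega⟩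
  | ite c e₁ e₂ ih ih₁ ih₂ =>
    obtain ⟨d, k, t, h, ev, le⟩ := ih h
    by_cases hd : d = .nil
    · obtain ⟨d', k', t', h', ev', le'⟩ := ih₂ (h.2 hd)
      exact ⟨_, _, _, h', .iteFalse ev (not_not.2 hd) ev', by simp only [Expr.size, mul_add]; omega⟩
    · obtain ⟨d', k', t', h', ev', le'⟩ := ih₁ (h.1 hd)
      exact ⟨_, _, _, h', .iteTrue ev hd ev', by simp only [Expr.size, mul_add]; omega⟩
  | bind e b ih ih' =>
    obtain ⟨d, k, t, h, ev, le⟩ := ih h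
    obtain ⟨d', k', t', h', ev', le'⟩ := ih' h
    exact ⟨_, _, _, h', .bind ev ev', by simp only [Expr.size, mul_add]; omega⟩
  | call f e ih =>
    obtain ⟨d, k, t, ⟨d', k', ⟨body, t', hb, ev', le'⟩, hQ⟩, ev, le⟩ := ih h
    exact ⟨_, _, _, hQ, .call ev hb ev', by simp only [Expr.size, mul_add]; omega⟩

/-- The additional `1` pays for this body and its call node, since `callCost` exceeds the size of
every body of the program. -/
theorem calls_of_wp {p : Program} {f n : ℕ} {body : Expr} {d x : Datum P V}
    (hb : p[f]? = some body) (h : wp p body [d] fun d' k => d' = x ∧ k + 1 ≤ n) :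
    Calls p f d x n := by
  obtain ⟨d', k, t, ⟨rfl, hk⟩, ev, le⟩ := wp_sound h
  refine ⟨body, t, hb, ev, ?_⟩
  have hs : body.size + 1 ≤ callCost p := by
    refine Nat.succ_le_succ (List.le_sum_of_mem ?_)
    exact List.mem_map_of_mem (List.mem_of_getElem? hb)
  calc t + 1 ≤ callCost p * (k + 1) := by rw [mul_add]; omega
    _ ≤ callCost p * n := Nat.mul_le_mul_left _ hk

theorem wp_mono {p : Program} {e : Expr} {env : List (Datum P V)} {Q R : Datum P V → ℕ → Prop}
    (h : wp p e env Q) (hQR : ∀ d k, Q d k → R d k) : wp p e env R := by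
  induction e generalizing env Q R with
  | var i => exact hQR _ _ h
  | nil => exact hQR _ _ h
  | pair e₁ e₂ ih₁ ih₂ => exact ih₁ h fun d k h' => ih₂ h' fun d' k' => hQR _ _
  | fst e ih => exact ih h fun d k => hQR _ _
  | snd e ih => exact ih h fun d k => hQR _ _
  | le e₁ e₂ ih₁ ih₂ => exact ih₁ h fun d k h' => ih₂ h' fun d' k' => hQR _ _
  | ite c e₁ e₂ ih ih₁ ih₂ =>
    exact ih h fun d k h' => ⟨fun hd => ih₁ (h'.1 hd) fun d' k' => hQR _ _,
      fun hd => ih₂ (h'.2 hd) fun d' k' => hQR _ _⟩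
  | bind e b ih ih' => exact ih h fun d k h' => ih' h' fun d' k' => hQR _ _
  | call f e ih =>
    refine ih h fun d k h' => ?_
    obtain ⟨d', k', h1, h2⟩ := h'
    exact ⟨d', k', h1, hQR _ _ h2⟩

/-- The expression evaluates to `d` with at most `k` function calls. -/
def Yields (p : Program) (e : Expr) (env : List (Datum P V)) (d : Datum P V) (k : ℕ) : Prop :=
  wp p e env fun d' k' => d' = d ∧ k' ≤ k

/-- Unlike `wp`, which carries exact counts, these rules compose upper bounds, so branches of
different cost can be treated together. -/
theorem Yields.pair {p : Program} {e₁ e₂ : Expr} {env : List (Datum P V)} {d₁ d₂ : Datum P V}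
    {k₁ k₂ : ℕ} (h₁ : Yields p e₁ env d₁ k₁) (h₂ : Yields p e₂ env d₂ k₂) :
    Yields p (.pair e₁ e₂) env (.pair d₁ d₂) (k₁ + k₂) := by
  simp only [Yields, wp]
  refine wp_mono h₁ fun d k hd => wp_mono h₂ fun d' k' hd' => ?_
  exact ⟨by rw [hd.1, hd'.1], add_le_add hd.2 hd'.2⟩

theorem Yields.bind {p : Program} {e b : Expr} {env : List (Datum P V)} {d₁ d₂ : Datum P V}
    {k₁ k₂ : ℕ} (h₁ : Yields p e env d₁ k₁) (h₂ : Yields p b (d₁ :: env) d₂ k₂) :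
    Yields p (.bind e b) env d₂ (k₁ + k₂) := by
  simp only [Yields, wp]
  refine wp_mono h₁ fun d k hd => ?_
  rw [hd.1]
  exact wp_mono h₂ fun d' k' hd' => ⟨hd'.1, add_le_add hd.2 hd'.2⟩

theorem Yields.call {p : Program} {f : ℕ} {e : Expr} {env : List (Datum P V)} {d₁ d₂ : Datum P V}
    {k₁ k₂ : ℕ} (h₁ : Yields p e env d₁ k₁) (h₂ : Calls p f d₁ d₂ k₂) :
    Yields p (.call f e) env d₂ (k₁ + k₂) := by
  simp only [Yields, wp]
  refine wp_mono h₁ fun d k hd => ?_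
  rw [hd.1]
  exact ⟨_, _, h₂, rfl, add_le_add_left hd.2 _⟩

theorem Yields.ite_true {p : Program} {c e₁ e₂ : Expr} {env : List (Datum P V)} {d d' : Datum P V}
    {k k' : ℕ} (h : Yields p c env d k) (hd : d ≠ .nil) (h₁ : Yields p e₁ env d' k') :
    Yields p (.ite c e₁ e₂) env d' (k + k') := by
  simp only [Yields, wp]
  refine wp_mono h fun x i hx => ?_
  rw [hx.1]
  exact ⟨fun _ => wp_mono h₁ fun y j hy => ⟨hy.1, add_le_add hx.2 hy.2⟩, fun h => absurd h hd⟩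

theorem Yields.ite_false {p : Program} {c e₁ e₂ : Expr} {env : List (Datum P V)} {d' : Datum P V}
    {k k' : ℕ} (h : Yields p c env .nil k) (h₂ : Yields p e₂ env d' k') :
    Yields p (.ite c e₁ e₂) env d' (k + k') := by
  simp only [Yields, wp]
  refine wp_mono h fun x i hx => ?_
  rw [hx.1]
  exact ⟨fun h => absurd rfl h, fun _ => wp_mono h₂ fun y j hy => ⟨hy.1, add_le_add hx.2 hy.2⟩⟩

theorem Yields.calls {p : Program} {f n k : ℕ} {body : Expr} {d x : Datum P V}
    (h : Yields p body [d] x k) (hb : p[f]? = some body) (hk : k + 1 ≤ n) : Calls p f d x n :=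
  calls_of_wp hb (wp_mono h fun _ _ hd => ⟨hd.1, (Nat.succ_le_succ hd.2).trans hk⟩)

theorem Yields.of_eq {p : Program} {e : Expr} {env : List (Datum P V)} {d d' : Datum P V}
    {k : ℕ} (h : Yields p e env d k) (hd : d = d') : Yields p e env d' k := hd ▸ h

end Calculus

/-! ### The monitor as a program -/

section MonitorProgram

namespace Expr

/-- The expression of the constant true. -/
def tru : Expr := .pair .nil .nil

/-- Conjunction. -/
def and (e₁ e₂ : Expr) : Expr := .ite e₁ e₂ .nil

/-- The method of an operation. -/
def method (e : Expr) : Expr := .fst (.snd (.snd e))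

/-- The value of an operation. -/
def value (e : Expr) : Expr := .fst (.snd (.snd (.snd e)))

/-- The invocation time of an operation. -/
def inv (e : Expr) : Expr := .fst (.snd (.snd (.snd (.snd e))))

/-- The response time of an operation. -/
def res (e : Expr) : Expr := .fst (.snd (.snd (.snd (.snd (.snd e)))))

end Expr

open PQMonitor.Expr

/-- Merges two lists of cells that are sorted by their first components. -/
def mergeBody : Expr :=
  .ite (.fst (.var 0))
    (.ite (.snd (.var 0))
      (.ite (.le (.fst (.fst (.fst (.var 0)))) (.fst (.fst (.snd (.var 0)))))
        (.pair (.fst (.fst (.var 0))) (.call 1 (.pair (.snd (.fst (.var 0))) (.snd (.var 0)))))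
        (.pair (.fst (.snd (.var 0))) (.call 1 (.pair (.fst (.var 0)) (.snd (.snd (.var 0)))))))
      (.fst (.var 0)))
    (.snd (.var 0))

/-- Joins the trees of a list in pairs. -/
def pairUpBody : Expr :=
  .ite (.snd (.var 0))
    (.pair
      (.pair (.pair (.fst (.fst (.fst (.var 0)))) (.snd (.fst (.fst (.snd (.var 0))))))
        (.pair (.fst (.var 0)) (.fst (.snd (.var 0)))))
      (.call 2 (.snd (.snd (.var 0)))))
    (.var 0)

/-- Joins the trees of a list to one tree. -/
def buildBody : Expr :=
  .ite (.snd (.var 0)) (.call 3 (.call 2 (.var 0))) (.fst (.var 0))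

/-- The sorted list of the leaves of a tree. -/
def sortBody : Expr :=
  .ite (.var 0)
    (.ite (.snd (.var 0))
      (.call 1 (.pair (.call 4 (.fst (.snd (.var 0)))) (.call 4 (.snd (.snd (.var 0))))))
      (.pair (.fst (.var 0)) .nil))
    .nil

/-- The leaves that contain the times of a history. -/
def timesBody : Expr :=
  .ite (.var 0)
    (.pair (.pair (.pair (inv (.fst (.var 0))) .nil) .nil)
      (.pair (.pair (.pair (res (.fst (.var 0))) .nil) .nil) (.call 5 (.snd (.var 0)))))
    .nil

/-- The leaves that contain the operations of a history that have a value. -/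
def valuedBody : Expr :=
  .ite (.var 0)
    (.ite (value (.fst (.var 0)))
      (.pair (.pair (.pair (value (.fst (.var 0))) (.fst (.var 0))) .nil) (.call 6 (.snd (.var 0))))
      (.call 6 (.snd (.var 0))))
    .nil

/-- The leaves that contain the gaps of a sorted list of times. -/
def gapsBody : Expr :=
  .ite (.snd (.var 0))
    (.ite (.le (.fst (.fst (.snd (.var 0)))) (.fst (.fst (.var 0))))
      (.call 7 (.snd (.var 0)))
      (.pair (.pair (.pair (.fst (.fst (.var 0))) (.fst (.fst (.snd (.var 0))))) .nil)
        (.call 7 (.snd (.var 0)))))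
    .nil

/-- Removes the gaps of an interval from a tree of gaps. -/
def coverBody : Expr :=
  .ite (.fst (.var 0))
    (.ite (.le (.snd (.fst (.fst (.var 0)))) (.fst (.snd (.var 0))))
      (.fst (.var 0))
      (.ite (.le (.snd (.snd (.var 0))) (.fst (.fst (.fst (.var 0)))))
        (.fst (.var 0))
        (.ite (and (.le (.fst (.snd (.var 0))) (.fst (.fst (.fst (.var 0)))))
            (.le (.snd (.fst (.fst (.var 0)))) (.snd (.snd (.var 0)))))
          .nil
          (.ite (.snd (.fst (.var 0)))
            (.bind (.call 8 (.pair (.fst (.snd (.fst (.var 0)))) (.snd (.var 0))))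
              (.bind (.call 8 (.pair (.snd (.snd (.fst (.var 1)))) (.snd (.var 1))))
                (.ite (.ite (.var 1) tru (.var 0))
                  (.pair (.fst (.fst (.var 2))) (.pair (.var 1) (.var 0)))
                  .nil)))
            (.fst (.var 0))))))
    .nil

/-- Tests if a tree of gaps contains a gap of an interval. -/
def queryBody : Expr :=
  .ite (.fst (.var 0))
    (.ite (.le (.snd (.fst (.fst (.var 0)))) (.fst (.snd (.var 0))))
      .nil
      (.ite (.le (.snd (.snd (.var 0))) (.fst (.fst (.fst (.var 0)))))
        .nil
        (.ite (and (.le (.fst (.snd (.var 0))) (.fst (.fst (.fst (.var 0)))))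
            (.le (.snd (.fst (.fst (.var 0)))) (.snd (.snd (.var 0)))))
          tru
          (.ite (.call 9 (.pair (.fst (.snd (.fst (.var 0)))) (.snd (.var 0))))
            tru
            (.call 9 (.pair (.snd (.snd (.fst (.var 0)))) (.snd (.var 0))))))))
    .nil

/-- Groups a sorted list of operations by value, the greatest value first. -/
def groupBody : Expr :=
  .ite (.fst (.var 0))
    (.ite (.le (.fst (.fst (.fst (.var 0)))) (.fst (.fst (.snd (.var 0)))))
      (.call 10 (.pair (.snd (.fst (.var 0)))
        (.pair (.pair (.fst (.fst (.snd (.var 0))))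
          (.pair (.snd (.fst (.fst (.var 0)))) (.snd (.fst (.snd (.var 0))))))
          (.snd (.snd (.var 0))))))
      (.call 10 (.pair (.snd (.fst (.var 0)))
        (.pair (.pair (.fst (.fst (.fst (.var 0)))) (.pair (.snd (.fst (.fst (.var 0)))) .nil))
          (.snd (.var 0))))))
    (.snd (.var 0))

/-- Five times that describe a group of operations on the same value: the invocation of the
insertion, response and invocation of the removal, the first response, the last invocation. -/
def summaryBody : Expr :=
  .ite (.fst (.var 0))
    (.bind (.call 11 (.pair (.snd (.fst (.var 0))) (.snd (.var 0))))
      (.bind (.fst (.fst (.var 1)))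
        (.pair
          (.ite (method (.var 0)) (.fst (.var 1)) (.call 15 (.pair (inv (.var 0)) (.fst (.var 1)))))
        (.pair
          (.ite (and (method (.var 0)) (.snd (method (.var 0)))) (.fst (.snd (.var 1)))
            (.ite (method (.var 0)) (.call 16 (.pair (res (.var 0)) (.fst (.snd (.var 1)))))
              (.fst (.snd (.var 1)))))
        (.pair
          (.ite (and (method (.var 0)) (.snd (method (.var 0)))) (.fst (.snd (.snd (.var 1))))
            (.ite (method (.var 0)) (inv (.var 0)) (.fst (.snd (.snd (.var 1))))))
        (.pair
          (.call 16 (.pair (res (.var 0)) (.fst (.snd (.snd (.snd (.var 1)))))))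
          (.call 15 (.pair (inv (.var 0)) (.snd (.snd (.snd (.snd (.var 1))))))) ))))))
    (.pair (.fst (.snd (.var 0))) (.pair (.snd (.snd (.var 0))) (.pair (.snd (.snd (.var 0)))
      (.pair (.snd (.snd (.var 0))) (.fst (.snd (.var 0)))))))

/-- Tests if each operation of a group other than the insertion has a gap. -/
def checkBody : Expr :=
  .ite (.fst (.var 0))
    (.ite (method (.fst (.fst (.var 0))))
      (.ite (.call 9 (.pair (.snd (.snd (.snd (.var 0))))
          (.pair (.call 15 (.pair (inv (.fst (.fst (.var 0)))) (.fst (.snd (.var 0)))))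
            (.call 16 (.pair (res (.fst (.fst (.var 0)))) (.fst (.snd (.snd (.var 0)))))))))
        (.call 12 (.pair (.snd (.fst (.var 0))) (.snd (.var 0))))
        .nil)
      (.call 12 (.pair (.snd (.fst (.var 0))) (.snd (.var 0)))))
    tru

/-- Tests the groups one after the other. -/
def loopBody : Expr :=
  .ite (.fst (.var 0))
    (.bind (.call 11 (.pair (.snd (.fst (.fst (.var 0)))) (.fst (.snd (.snd (.var 0))))))
      (.ite (.call 12 (.pair (.snd (.fst (.fst (.var 1))))
          (.pair (.fst (.var 0)) (.pair (.fst (.snd (.var 0))) (.fst (.snd (.var 1)))))))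
        (.call 13 (.pair (.snd (.fst (.var 1)))
          (.pair
            (.call 8 (.pair (.fst (.snd (.var 1))) (.pair (.fst (.snd (.snd (.snd (.var 0)))))
              (.call 15 (.pair (.snd (.snd (.snd (.snd (.var 0))))) (.fst (.snd (.snd (.var 0)))))))))
            (.snd (.snd (.var 1))))))
        .nil))
    (.call 14 (.pair (.snd (.snd (.snd (.var 0)))) (.fst (.snd (.var 0)))))

/-- Tests if each operation without value has a gap. -/
def emptiesBody : Expr :=
  .ite (.fst (.var 0))
    (.ite (value (.fst (.fst (.var 0))))
      (.call 14 (.pair (.snd (.fst (.var 0))) (.snd (.var 0))))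
      (.ite (.call 9 (.pair (.snd (.var 0))
          (.pair (inv (.fst (.fst (.var 0)))) (res (.fst (.fst (.var 0)))))))
        (.call 14 (.pair (.snd (.fst (.var 0))) (.snd (.var 0))))
        .nil))
    tru

/-- The maximum of a pair of times. -/
def maxBody : Expr :=
  .ite (.le (.fst (.var 0)) (.snd (.var 0))) (.snd (.var 0)) (.fst (.var 0))

/-- The minimum of a pair of times. -/
def minBody : Expr :=
  .ite (.le (.fst (.var 0)) (.snd (.var 0))) (.fst (.var 0)) (.snd (.var 0))

/-- Decides if a history is linearizable. -/
def mainBody : Expr :=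
  .ite (.var 0)
    (.bind (.call 3 (.call 7 (.call 4 (.call 3 (.call 5 (.var 0))))))
      (.call 13 (.pair (.call 10 (.pair (.call 4 (.call 3 (.call 6 (.var 1)))) .nil))
        (.pair (.var 0) (.pair (.fst (.var 0)) (.var 1))))))
    tru

/-- The monitor for priority queues. -/
def monitor : Program :=
  [mainBody, mergeBody, pairUpBody, buildBody, sortBody, timesBody, valuedBody, gapsBody, coverBody,
    queryBody, groupBody, summaryBody, checkBody, loopBody, emptiesBody, maxBody, minBody]

end MonitorProgram

/-! ### Encoded lists, minima and maxima, merging -/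

section BasicCalls

variable {P V : Type*}

/-- A list of cells that encode its entries. -/
def encodeList {α : Type*} (e : α → Datum P V) (l : List α) : Datum P V := .ofList (l.map e)

@[simp] theorem encodeList_nil {α : Type*} (e : α → Datum P V) : encodeList e [] = .nil := rfl

@[simp] theorem encodeList_cons {α : Type*} (e : α → Datum P V) (a : α) (l : List α) :
    encodeList e (a :: l) = .pair (e a) (encodeList e l) := rfl

@[simp] theorem Datum.fst_pair (a b : Datum P V) : (Datum.pair a b).fst = a := rfl

@[simp] theorem Datum.snd_pair (a b : Datum P V) : (Datum.pair a b).snd = b := rfl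

@[simp] theorem Datum.fst_nil : (Datum.nil : Datum P V).fst = .nil := rfl

@[simp] theorem Datum.snd_nil : (Datum.nil : Datum P V).snd = .nil := rfl

@[simp] theorem Datum.ofBool_eq_nil {b : Bool} :
    (Datum.ofBool b : Datum P V) = .nil ↔ b = false := by
  cases b <;> simp [Datum.ofBool]

@[simp] theorem Datum.ofBool_not_eq_nil {b : Bool} :
    ¬ (Datum.ofBool b : Datum P V) = .nil ↔ b = true := by
  cases b <;> simp [Datum.ofBool]

@[simp] theorem encodeOperation_method (o : Operation P V) :
    (encodeOperation o).snd.snd.fst = encodeMethod o.op := rfl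

@[simp] theorem encodeOperation_value (o : Operation P V) :
    (encodeOperation o).snd.snd.snd.fst = encodeValue o.op := rfl

@[simp] theorem encodeOperation_inv (o : Operation P V) :
    (encodeOperation o).snd.snd.snd.snd.fst = .time o.inv := rfl

@[simp] theorem encodeOperation_res (o : Operation P V) :
    (encodeOperation o).snd.snd.snd.snd.snd.fst = .time o.res := rfl

variable [LinearOrder V]

@[simp] theorem Datum.le_time (s t : ℚ≥0) :
    Datum.le (.time s : Datum P V) (.time t) = .ofBool (decide (s ≤ t)) := rfl

@[simp] theorem Datum.le_val (v w : V) :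
    Datum.le (.val v : Datum P V) (.val w) = .ofBool (decide (v ≤ w)) := rfl

-- Grouping uses this default: with an empty accumulator the comparison fails and a new group is
-- opened.
@[simp] theorem Datum.le_nil (d : Datum P V) : Datum.le d .nil = .nil := by cases d <;> rfl

theorem calls_max (s t : ℚ≥0) :
    Calls monitor 15 (.pair (.time s) (.time t) : Datum P V) (.time (max s t)) 1 := by
  refine calls_of_wp (body := maxBody) rfl ?_
  simp [maxBody, wp]
  exact le_of_lt

theorem calls_min (s t : ℚ≥0) :
    Calls monitor 16 (.pair (.time s) (.time t) : Datum P V) (.time (min s t)) 1 := by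
  refine calls_of_wp (body := minBody) rfl ?_
  simp [minBody, wp]
  exact le_of_lt

theorem calls_merge {α : Type*} (e : α → Datum P V) (le : α → α → Bool)
    (hle : ∀ a b, Datum.le (e a).fst (e b).fst = .ofBool (le a b)) (l m : List α) :
    Calls monitor 1 (.pair (encodeList e l) (encodeList e m)) (encodeList e (l.merge m le))
      (l.length + m.length + 1) := by
  induction l generalizing m with
  | nil =>
    refine calls_of_wp (body := mergeBody) rfl ?_
    simp [mergeBody, wp]
  | cons a l ihl =>
    induction m with
    | nil =>
      refine calls_of_wp (body := mergeBody) rfl ?_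
      simp [mergeBody, wp]
    | cons b m ihm =>
      refine calls_of_wp (body := mergeBody) rfl ?_
      simp only [mergeBody, wp, List.getD_cons_zero, Datum.fst_pair, Datum.snd_pair,
        encodeList_cons, hle, ne_eq, reduceCtorEq, not_false_eq_true, forall_const,
        Datum.ofBool_eq_nil, IsEmpty.forall_iff, and_true, zero_add]
      rw [List.cons_merge_cons]
      constructor <;> intro h
      · refine ⟨_, _, ihl (b :: m), ?_⟩
        simp [h]
      · refine ⟨_, _, ihm, ?_⟩
        simp [h]

end BasicCalls

/-! ### Balanced trees and merge sort along them -/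

section Trees

/-- Nonempty binary trees with an entry at each node. -/
inductive FTree (α : Type*) where
  | leaf (h : α)
  | node (h : α) (l r : FTree α)

namespace FTree

variable {α : Type*}

/-- The entry at the root. -/
def head : FTree α → α
  | leaf h => h
  | node h _ _ => h

/-- The entries at the leaves. -/
def leaves : FTree α → List α
  | leaf h => [h]
  | node _ l r => l.leaves ++ r.leaves

/-- The depth of a tree. -/
def depth : FTree α → ℕ
  | leaf _ => 0
  | node _ l r => max l.depth r.depth + 1

/-- The number of nodes of a tree. -/
def size : FTree α → ℕ
  | leaf _ => 1
  | node _ l r => l.size + r.size + 1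

/-- The entry at each inner node is obtained from those at its children by `c`. -/
def Good (c : α → α → α) : FTree α → Prop
  | leaf _ => True
  | node h l r => h = c l.head r.head ∧ l.Good c ∧ r.Good c

/-- The code of a tree. -/
def encode {P V : Type*} (e : α → Datum P V) : FTree α → Datum P V
  | leaf h => .pair (e h) .nil
  | node h l r => .pair (e h) (.pair (l.encode e) (r.encode e))

/-- Joins the trees of a list in pairs. -/
def pairUp (c : α → α → α) : List (FTree α) → List (FTree α)
  | a :: b :: l => node (c a.head b.head) a b :: pairUp c l
  | l => l

theorem length_leaves_le (T : FTree α) : T.leaves.length ≤ T.size := by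
  induction T with
  | leaf h => simp [leaves, size]
  | node h l r ihl ihr => simp [leaves, size]; omega

@[simp] theorem encode_fst {P V : Type*} (e : α → Datum P V) (T : FTree α) :
    (T.encode e).fst = e T.head := by cases T <;> rfl

theorem length_pairUp (c : α → α → α) (ls : List (FTree α)) :
    (pairUp c ls).length = (ls.length + 1) / 2 := by
  induction ls using pairUp.induct with
  | case1 a b l ih => simp only [pairUp, List.length_cons, ih]; omega
  | case2 l h =>
    match l, h with
    | [], _ => simp [pairUp]
    | [a], _ => simp [pairUp]
    | a :: b :: l, h => exact absurd rfl (h a b l)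

theorem leaves_pairUp (c : α → α → α) (ls : List (FTree α)) :
    (pairUp c ls).flatMap leaves = ls.flatMap leaves := by
  induction ls using pairUp.induct with
  | case1 a b l ih => simp [pairUp, ih, leaves]
  | case2 l h => rw [pairUp]; exact h

/-- Each joining of two trees adds one node and removes one tree from the list. -/
theorem size_pairUp (c : α → α → α) (ls : List (FTree α)) :
    ((pairUp c ls).map size).sum + (pairUp c ls).length = (ls.map size).sum + ls.length := by
  induction ls using pairUp.induct with
  | case1 a b l ih => simp [pairUp, size] at ih ⊢; omega
  | case2 l h => rw [pairUp]; exact h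

theorem depth_pairUp (c : α → α → α) (ls : List (FTree α)) {d : ℕ} (hd : ∀ t ∈ ls, t.depth ≤ d) :
    ∀ t ∈ pairUp c ls, t.depth ≤ d + 1 := by
  induction ls using pairUp.induct with
  | case1 a b l ih =>
    simp only [pairUp, List.mem_cons, forall_eq_or_imp] at hd ⊢
    exact ⟨by simp [depth, hd.1, hd.2.1], ih hd.2.2⟩
  | case2 l h => rw [pairUp]; exacts [fun t ht => (hd t ht).trans (Nat.le_succ d), h]

theorem good_pairUp (c : α → α → α) (ls : List (FTree α)) (hd : ∀ t ∈ ls, t.Good c) :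
    ∀ t ∈ pairUp c ls, t.Good c := by
  induction ls using pairUp.induct with
  | case1 a b l ih =>
    simp only [pairUp, List.mem_cons, forall_eq_or_imp] at hd ⊢
    exact ⟨⟨rfl, hd.1, hd.2.1⟩, ih hd.2.2⟩
  | case2 l h => rw [pairUp]; exacts [hd, h]

end FTree

open FTree

variable {P V : Type*} [LinearOrder V]

/-- The condition `hc` says that `c` describes how the program forms the entry of a joined tree. For
gaps this is their hull; for sorting the inner entries are never used. -/
theorem calls_pairUp {α : Type*} (e : α → Datum P V) (c : α → α → α)
    (hc : ∀ a b, e (c a b) = .pair (e a).fst (e b).snd) (ls : List (FTree α)) :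
    Calls monitor 2 (encodeList (encode e) ls) (encodeList (encode e) (pairUp c ls))
      (ls.length + 1) := by
  induction ls using pairUp.induct with
  | case1 a b l ih =>
    refine calls_of_wp (body := pairUpBody) rfl ?_
    simp [pairUpBody, wp]
    exact ⟨_, _, ih, by simp [pairUp, encode, hc], by omega⟩
  | case2 l h =>
    refine calls_of_wp (body := pairUpBody) rfl ?_
    match l, h with
    | [], _ => simp [pairUpBody, wp, pairUp]
    | [a], _ => simp [pairUpBody, wp, pairUp]
    | a :: b :: l, h => exact absurd rfl (h a b l)

theorem calls_build_nil : Calls monitor 3 (.nil : Datum P V) .nil 1 := by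
  refine calls_of_wp (body := buildBody) rfl ?_
  simp [buildBody, wp]

/-- Each round halves the number of trees, rounded up, and deepens them by at most one, giving
`clog` rounds. The first round, which is the longest, costs `n + 1` calls for pairing and one for
itself; this bound serves for all rounds. -/
theorem calls_build {α : Type*} (e : α → Datum P V) (c : α → α → α)
    (hc : ∀ a b, e (c a b) = .pair (e a).fst (e b).snd) (ls : List (FTree α)) (hls : ls ≠ []) :
    ∃ T : FTree α, Calls monitor 3 (encodeList (encode e) ls) (T.encode e)
        ((ls.length + 2) * (Nat.clog 2 ls.length + 1)) ∧
      T.leaves = ls.flatMap leaves ∧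
      (∀ d, (∀ t ∈ ls, t.depth ≤ d) → T.depth ≤ d + Nat.clog 2 ls.length) ∧
      T.size + 1 = (ls.map size).sum + ls.length ∧
      ((∀ t ∈ ls, t.Good c) → T.Good c) := by
  induction hn : ls.length using Nat.strong_induction_on generalizing ls with
  | _ n ih =>
    match ls, hls with
    | [a], _ =>
      subst hn
      refine ⟨a, ?_, by simp, by simp, by simp, by simp⟩
      refine calls_of_wp (body := buildBody) rfl ?_
      simp [buildBody, wp]
    | a :: b :: l, _ =>
      have hn2 : 2 ≤ n := by simp at hn; omega
      have hlen := length_pairUp c (a :: b :: l)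
      rw [hn] at hlen
      have hclog : Nat.clog 2 n = Nat.clog 2 ((n + 1) / 2) + 1 := by
        rw [Nat.clog_of_two_le one_lt_two hn2]; rfl
      obtain ⟨T, h1, h2, h3, h4, h5⟩ := ih ((n + 1) / 2) (by omega) (pairUp c (a :: b :: l))
        (by simp [pairUp]) hlen
      refine ⟨T, ?_, by rw [h2, leaves_pairUp], fun d hd => ?_, ?_,
        fun hg => h5 (good_pairUp c _ hg)⟩
      · refine calls_of_wp (body := buildBody) rfl ?_
        simp only [buildBody, wp, List.getD_cons_zero, encodeList_cons, Datum.snd_pair, ne_eq,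
          reduceCtorEq, not_false_eq_true, forall_const, IsEmpty.forall_iff, and_true, zero_add]
        refine ⟨_, _, calls_pairUp e c hc (a :: b :: l), _, _, h1, rfl, ?_⟩
        rw [hn, hclog]
        have : ((n + 1) / 2 + 2) * (Nat.clog 2 ((n + 1) / 2) + 1) ≤
            (n + 2) * (Nat.clog 2 ((n + 1) / 2) + 1) := Nat.mul_le_mul_right _ (by omega)
        rw [mul_add (n + 2) (_ + 1) 1]
        omega
      · have := h3 (d + 1) (depth_pairUp c _ hd)
        omega
      · rw [h4, ← hlen, size_pairUp, hn]

theorem calls_sort_nil : Calls monitor 4 (.nil : Datum P V) .nil 1 := by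
  refine calls_of_wp (body := sortBody) rfl ?_
  simp [sortBody, wp]

/-- Sorting recurses along the tree. Merging at a node costs at most the size of its subtree, and
such costs sum to at most the total size on each level. -/
theorem calls_sort {α : Type*} (e : α → Datum P V) (le : α → α → Bool)
    (hle : ∀ a b, Datum.le (e a).fst (e b).fst = .ofBool (le a b))
    (htrans : ∀ a b c, le a b → le b c → le a c) (htotal : ∀ a b, le a b || le b a)
    (T : FTree (Datum P V)) (as : List α) (has : T.leaves = as.map e) :
    ∃ bs : List α, bs.Perm as ∧ bs.Pairwise (fun a b => le a b) ∧
      Calls monitor 4 (T.encode id) (encodeList e bs) (T.size * (2 * T.depth + 2)) := by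
  induction T generalizing as with
  | leaf h =>
    obtain ⟨a, rfl, rfl⟩ : ∃ a, as = [a] ∧ h = e a := by
      match as, has with
      | [a], has => simp [leaves] at has; exact ⟨a, rfl, has⟩
    refine ⟨[a], .refl _, by simp, ?_⟩
    refine calls_of_wp (body := sortBody) rfl ?_
    simp [sortBody, wp, encode, size, depth]
  | node h l r ihl ihr =>
    obtain ⟨as₁, as₂, rfl, h₁, h₂⟩ := List.map_eq_append_iff.1 has.symm
    obtain ⟨bs₁, p₁, s₁, c₁⟩ := ihl as₁ h₁.symm
    obtain ⟨bs₂, p₂, s₂, c₂⟩ := ihr as₂ h₂.symm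
    refine ⟨bs₁.merge bs₂ le, ?_, ?_, ?_⟩
    · exact (List.merge_perm_append le).trans (p₁.append p₂)
    · exact List.pairwise_merge htrans htotal _ _ s₁ s₂
    · refine calls_of_wp (body := sortBody) rfl ?_
      simp only [sortBody, wp, List.getD_cons_zero, encode, Datum.fst_pair, Datum.snd_pair, ne_eq,
        reduceCtorEq, not_false_eq_true, forall_const, IsEmpty.forall_iff, and_true, zero_add]
      refine ⟨_, _, c₁, _, _, c₂, _, _, calls_merge e le hle bs₁ bs₂, rfl, ?_⟩
      have hl := length_leaves_le l
      have hr := length_leaves_le r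
      rw [← h₁, List.length_map, ← p₁.length_eq] at hl
      rw [← h₂, List.length_map, ← p₂.length_eq] at hr
      simp only [size, depth]
      have e₁ : l.size * (2 * l.depth + 2) ≤ l.size * (2 * max l.depth r.depth + 2) :=
        Nat.mul_le_mul_left _ (by omega)
      have e₂ : r.size * (2 * r.depth + 2) ≤ r.size * (2 * max l.depth r.depth + 2) :=
        Nat.mul_le_mul_left _ (by omega)
      generalize max l.depth r.depth = m at *
      nlinarith

end Trees

/-! ### Extraction of times, gaps and operations with values -/

section InputPasses

variable {P V : Type*}

/-- All invocation and response times of a list of operations. -/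
def timesList (L : List (Operation P V)) : List ℚ≥0 := L.flatMap fun o => [o.inv, o.res]

/-- The operations of a list that have a value, with their values. -/
def valuedList (L : List (Operation P V)) : List (V × Operation P V) :=
  L.filterMap fun o => o.op.value.map fun v => (v, o)

/-- The intervals between the consecutive distinct times of a sorted list. -/
def gapsList : List ℚ≥0 → List (ℚ≥0 × ℚ≥0)
  | s :: t :: l => if t ≤ s then gapsList (t :: l) else (s, t) :: gapsList (t :: l)
  | _ => []

/-- The code of a time as an entry to be sorted. -/
def encodeTime (t : ℚ≥0) : Datum P V := .pair (.time t) .nil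

/-- The code of an operation with its value as an entry to be sorted. -/
def encodeValued (x : V × Operation P V) : Datum P V := .pair (.val x.1) (encodeOperation x.2)

/-- The code of a gap. -/
def encodeGap (g : ℚ≥0 × ℚ≥0) : Datum P V := .pair (.time g.1) (.time g.2)

theorem length_timesList (L : List (Operation P V)) : (timesList L).length = 2 * L.length := by
  induction L with
  | nil => rfl
  | cons o L ih => simp [timesList] at ih ⊢; omega

theorem length_valuedList_le (L : List (Operation P V)) : (valuedList L).length ≤ L.length :=
  List.length_filterMap_le _ _

theorem length_gapsList_le (l : List ℚ≥0) : (gapsList l).length ≤ l.length := by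
  induction l using gapsList.induct with
  | case1 s t l h ih => simp only [gapsList, h, if_true, List.length_cons] at ih ⊢; omega
  | case2 s t l h ih => simp only [gapsList, h, if_false, List.length_cons] at ih ⊢; omega
  | case3 l h => rw [gapsList] <;> simp_all

theorem mem_timesList {H : Finset (Operation P V)} {L : List (Operation P V)}
    (hL : (L : Multiset (Operation P V)) = H.val) {t : ℚ≥0} : t ∈ timesList L ↔ t ∈ times H := by
  have hm : ∀ o, o ∈ L ↔ o ∈ H := fun o => by rw [← Finset.mem_val, ← hL, Multiset.mem_coe]
  simp only [timesList, List.mem_flatMap, hm, List.mem_cons, List.not_mem_nil, or_false, times,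
    Finset.mem_union, Finset.mem_image]
  constructor
  · rintro ⟨o, ho, rfl | rfl⟩
    · exact .inl ⟨o, ho, rfl⟩
    · exact .inr ⟨o, ho, rfl⟩
  · rintro (⟨o, ho, rfl⟩ | ⟨o, ho, rfl⟩)
    · exact ⟨o, ho, .inl rfl⟩
    · exact ⟨o, ho, .inr rfl⟩

theorem mem_valuedList {L : List (Operation P V)} {v : V} {o : Operation P V} :
    (v, o) ∈ valuedList L ↔ o ∈ L ∧ o.op.value = some v := by
  simp only [valuedList, List.mem_filterMap, Option.map_eq_some_iff, Prod.mk.injEq]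
  constructor
  · rintro ⟨a, ha, b, hb, rfl, rfl⟩; exact ⟨ha, hb⟩
  · rintro ⟨ha, hb⟩; exact ⟨o, ha, v, hb, rfl, rfl⟩

/-- The times may repeat; in a sorted list the test `t ≤ s` recognizes equal neighbours, which bound
no gap. -/
theorem mem_gapsList {l : List ℚ≥0} (hl : l.Pairwise (· ≤ ·)) {g : ℚ≥0 × ℚ≥0} :
    g ∈ gapsList l ↔ g.1 ∈ l ∧ g.2 ∈ l ∧ g.1 < g.2 ∧ ∀ t ∈ l, t ≤ g.1 ∨ g.2 ≤ t := by
  obtain ⟨lo, hi⟩ := g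
  induction l using gapsList.induct with
  | case1 s t l h ih =>
    have hst : s = t := le_antisymm ((List.pairwise_cons.1 hl).1 t (by simp)) h
    subst hst
    simp only [gapsList, le_refl, if_true]
    rw [ih (List.pairwise_cons.1 hl).2]
    simp
  | case2 s t l h ih =>
    have h1 := List.pairwise_cons.1 hl
    have h2 := (List.pairwise_cons.1 h1.2).1
    rw [not_le] at h
    simp only [gapsList, not_le.2 h, if_false, List.mem_cons, Prod.mk.injEq] at ih ⊢
    rw [ih h1.2]
    constructor
    · rintro (⟨rfl, rfl⟩ | ⟨ha, hb, hc, hd⟩)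
      · refine ⟨.inl rfl, .inr (.inl rfl), h, ?_⟩
        rintro x (rfl | rfl | hx)
        · exact .inl le_rfl
        · exact .inr le_rfl
        · exact .inr (h2 x hx)
      · refine ⟨.inr ha, .inr hb, hc, ?_⟩
        rintro x (rfl | hx)
        · exact .inl (h1.1 lo (by simpa using ha))
        · exact hd x hx
    · rintro ⟨ha, hb, hc, hd⟩
      by_cases hs : lo = s
      · subst hs
        left
        refine ⟨rfl, ?_⟩
        have h3 : hi ≤ t := (hd t (by simp)).resolve_left (not_le.2 h)
        rcases hb with rfl | hb | hb
        · exact absurd hc (lt_irrefl _)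
        · exact hb
        · exact le_antisymm h3 (h2 hi hb)
      · right
        refine ⟨ha.resolve_left hs, hb.resolve_left ?_, hc, fun x hx => hd x (.inr hx)⟩
        rintro rfl
        have := h1.1 lo (by simpa [hs] using ha)
        exact absurd hc (not_lt.2 this)
  | case3 l h =>
    have : gapsList l = [] := by rw [gapsList]; exact h
    rw [this]
    simp only [List.not_mem_nil, false_iff]
    rintro ⟨ha, hb, hc, -⟩
    match l, h with
    | [], _ => simp at ha
    | [x], _ => simp at ha hb; exact absurd hc (by simp [ha, hb])
    | a :: b :: l, h => exact h a b l rfl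

theorem pairwise_gapsList {l : List ℚ≥0} (hl : l.Pairwise (· ≤ ·)) :
    (gapsList l).Pairwise fun g g' => g.2 ≤ g'.1 := by
  induction l using gapsList.induct with
  | case1 s t l h ih =>
    simp only [gapsList, h, if_true]
    exact ih (List.pairwise_cons.1 hl).2
  | case2 s t l h ih =>
    simp only [gapsList, h, if_false]
    have h1 := (List.pairwise_cons.1 hl).2
    refine List.pairwise_cons.2 ⟨fun g hg => ?_, ih h1⟩
    have := ((mem_gapsList h1).1 hg).1
    rcases List.mem_cons.1 this with h2 | h2
    · exact h2.ge
    · exact (List.pairwise_cons.1 h1).1 _ h2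
  | case3 l h => rw [gapsList] <;> simp_all

variable [LinearOrder V]

open FTree

theorem calls_times (L : List (Operation P V)) :
    Calls monitor 5 (encodeHistory L)
      (encodeList (encode id) ((timesList L).map fun t => leaf (encodeTime t))) (L.length + 1) := by
  change Calls monitor 5 (encodeList encodeOperation L) _ _
  induction L with
  | nil =>
    refine calls_of_wp (body := timesBody) rfl ?_
    simp [timesBody, wp, timesList]
  | cons o L ih =>
    refine calls_of_wp (body := timesBody) rfl ?_
    simp [timesBody, wp, Expr.inv, Expr.res]
    exact ⟨_, _, ih, by simp [timesList, encode, encodeTime], by omega⟩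

theorem calls_valued (L : List (Operation P V)) :
    Calls monitor 6 (encodeHistory L)
      (encodeList (encode id) ((valuedList L).map fun x => leaf (encodeValued x)))
      (L.length + 1) := by
  change Calls monitor 6 (encodeList encodeOperation L) _ _
  induction L with
  | nil =>
    refine calls_of_wp (body := valuedBody) rfl ?_
    simp [valuedBody, wp, valuedList]
  | cons o L ih =>
    refine calls_of_wp (body := valuedBody) rfl ?_
    simp only [valuedBody, wp, Expr.value, List.getD_cons_zero, encodeList_cons, Datum.fst_pair,
      Datum.snd_pair, encodeOperation_value, ne_eq, reduceCtorEq, not_false_eq_true, forall_const,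
      IsEmpty.forall_iff, and_true, zero_add]
    cases hv : o.op.value with
    | none =>
      simp only [encodeValue, hv, not_true_eq_false, IsEmpty.forall_iff, true_and, forall_const]
      exact ⟨_, _, ih, by simp [valuedList, hv], by simp⟩
    | some v =>
      simp only [encodeValue, hv, reduceCtorEq, not_false_eq_true, forall_const,
        IsEmpty.forall_iff, and_true]
      exact ⟨_, _, ih, by simp [valuedList, hv, encode, encodeValued], by simp⟩

theorem calls_gaps (l : List ℚ≥0) :
    Calls monitor 7 (encodeList encodeTime l : Datum P V)
      (encodeList (encode encodeGap) ((gapsList l).map leaf)) (l.length + 1) := by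
  induction l using gapsList.induct with
  | case1 s t l h ih =>
    refine calls_of_wp (body := gapsBody) rfl ?_
    rw [encodeList_cons] at ih
    simp [gapsBody, wp, encodeTime, h, gapsList] at ih ⊢
    exact ⟨_, ih, by omega⟩
  | case2 s t l h ih =>
    refine calls_of_wp (body := gapsBody) rfl ?_
    rw [encodeList_cons] at ih
    simp [gapsBody, wp, encodeTime, h, gapsList] at ih ⊢
    exact ⟨_, ih, by simp [encode, encodeGap], by omega⟩
  | case3 l h =>
    refine calls_of_wp (body := gapsBody) rfl ?_
    match l, h with
    | [], _ => simp [gapsBody, wp, gapsList]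
    | [x], _ => simp [gapsBody, wp, gapsList]
    | a :: b :: l, h => exact absurd rfl (h a b l)

end InputPasses

/-! ### Deletion and search in a tree of gaps, with their cost -/

section SegmentTree

/-- Trees of gaps. Each node holds bounds for the gaps below it. -/
inductive Seg where
  | nil
  | leaf (h : ℚ≥0 × ℚ≥0)
  | node (h : ℚ≥0 × ℚ≥0) (l r : Seg)

namespace Seg

/-- The gaps of a tree. -/
def gaps : Seg → List (ℚ≥0 × ℚ≥0)
  | nil => []
  | leaf h => [h]
  | node _ l r => l.gaps ++ r.gaps

/-- The depth of a tree. -/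
def depth : Seg → ℕ
  | nil => 0
  | leaf _ => 0
  | node _ l r => max l.depth r.depth + 1

/-- Tests if the tree is empty. -/
def isNil : Seg → Bool
  | nil => true
  | _ => false

/-- All gaps of the tree lie between `lo` and `hi`, by the bounds at its root. -/
def Within (lo hi : ℚ≥0) : Seg → Prop
  | nil => True
  | leaf h => lo ≤ h.1 ∧ h.2 ≤ hi
  | node h _ _ => lo ≤ h.1 ∧ h.2 ≤ hi

/-- The gaps of the tree are in increasing order and within the bounds. -/
def WF : Seg → Prop
  | nil => True
  | leaf h => h.1 < h.2
  | node h l r => l.WF ∧ r.WF ∧ (l.gaps ++ r.gaps ≠ []) ∧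
      ∃ mid, l.Within h.1 mid ∧ r.Within mid h.2 ∧ h.1 ≤ mid ∧ mid ≤ h.2

/-- The tree contains a gap of the interval from `a` to `b`. -/
def query (a b : ℚ≥0) : Seg → Bool
  | nil => false
  | leaf h => if h.2 ≤ a then false else if b ≤ h.1 then false else
      if a ≤ h.1 ∧ h.2 ≤ b then true else false
  | node h l r => if h.2 ≤ a then false else if b ≤ h.1 then false else
      if a ≤ h.1 ∧ h.2 ≤ b then true else l.query a b || r.query a b

/-- Removes the gaps of the interval from `a` to `b`. -/
def cover (a b : ℚ≥0) : Seg → Seg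
  | nil => nil
  | leaf h => if h.2 ≤ a then leaf h else if b ≤ h.1 then leaf h else
      if a ≤ h.1 ∧ h.2 ≤ b then nil else leaf h
  | node h l r => if h.2 ≤ a then node h l r else if b ≤ h.1 then node h l r else
      if a ≤ h.1 ∧ h.2 ≤ b then nil else
        if (l.cover a b).isNil && (r.cover a b).isNil then nil
        else node h (l.cover a b) (r.cover a b)

/-- The number of recursive calls for the interval from `a` to `b`. -/
def cost (a b : ℚ≥0) : Seg → ℕ
  | nil => 0
  | leaf _ => 2
  | node h l r => if h.2 ≤ a ∨ b ≤ h.1 ∨ (a ≤ h.1 ∧ h.2 ≤ b) then 0 else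
      l.cost a b + r.cost a b + 2

/-- The code of a tree. -/
def encode {P V : Type*} : Seg → Datum P V
  | nil => .nil
  | leaf h => .pair (encodeGap h) .nil
  | node h l r => .pair (encodeGap h) (.pair l.encode r.encode)

theorem Within.mono {lo hi lo' hi' : ℚ≥0} {T : Seg} (h : T.Within lo hi) (hl : lo' ≤ lo)
    (hh : hi ≤ hi') : T.Within lo' hi' := by
  cases T with
  | nil => trivial
  | leaf g => exact ⟨hl.trans h.1, h.2.trans hh⟩
  | node g l r => exact ⟨hl.trans h.1, h.2.trans hh⟩

theorem WF.bounds {T : Seg} (hT : T.WF) {lo hi : ℚ≥0} (h : T.Within lo hi) :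
    ∀ g ∈ T.gaps, lo ≤ g.1 ∧ g.1 < g.2 ∧ g.2 ≤ hi := by
  induction T generalizing lo hi with
  | nil => simp [gaps]
  | leaf h' => simp only [gaps, List.mem_singleton, forall_eq]; exact ⟨h.1, hT, h.2⟩
  | node h' l r ihl ihr =>
    obtain ⟨hl, hr, -, mid, h1, h2, h3, h4⟩ := hT
    intro g hg
    rcases List.mem_append.1 hg with hg | hg
    · exact ihl hl (h1.mono h.1 (h4.trans h.2)) g hg
    · exact ihr hr (h2.mono (h.1.trans h3) h.2) g hg

/-- A node whose bounds lie in the interval can be accepted at once because well-formed nodes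
contain a gap. Its bounds need not be tight. -/
theorem WF.query_iff {T : Seg} (hT : T.WF) (a b : ℚ≥0) :
    T.query a b = true ↔ ∃ g ∈ T.gaps, a ≤ g.1 ∧ g.2 ≤ b := by
  induction T with
  | nil => simp [query, gaps]
  | leaf h =>
    have hT : h.1 < h.2 := hT
    simp only [query, gaps, List.mem_singleton, exists_eq_left]
    split_ifs with h1 h2 h3
    · simp only [false_iff]; rintro ⟨h3, -⟩
      exact absurd (hT.trans_le (h1.trans h3)) (lt_irrefl _)
    · simp only [false_iff]; rintro ⟨-, h3⟩
      exact absurd (hT.trans_le (h3.trans h2)) (lt_irrefl _)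
    · simpa using h3
    · simpa using h3
  | node h l r ihl ihr =>
    have hb := hT.bounds (lo := h.1) (hi := h.2) ⟨le_rfl, le_rfl⟩
    obtain ⟨hl, hr, hne, -⟩ := hT
    simp only [query]
    split_ifs with h1 h2 h3
    · simp only [false_iff]; rintro ⟨g, hg, h3, -⟩
      obtain ⟨h4, h5, h6⟩ := hb g hg
      exact absurd (h5.trans_le (h6.trans (h1.trans h3))) (lt_irrefl _)
    · simp only [false_iff]; rintro ⟨g, hg, -, h3⟩
      obtain ⟨h4, h5, h6⟩ := hb g hg
      exact absurd (h5.trans_le (h3.trans (h2.trans h4))) (lt_irrefl _)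
    · simp only [true_iff]
      obtain ⟨g, hg⟩ := List.exists_mem_of_ne_nil _ hne
      obtain ⟨h4, h5, h6⟩ := hb g hg
      exact ⟨g, hg, h3.1.trans h4, h6.trans h3.2⟩
    · simp only [Bool.or_eq_true, ihl hl, ihr hr, gaps, List.mem_append, or_and_right, exists_or]

theorem isNil_iff {T : Seg} : T.isNil = true ↔ T = nil := by cases T <;> simp [isNil]

theorem Within.cover {T : Seg} {lo hi : ℚ≥0} (h : T.Within lo hi) (a b : ℚ≥0) :
    (T.cover a b).Within lo hi := by
  cases T with
  | nil => trivial
  | leaf g => simp only [Seg.cover]; split_ifs <;> first | exact h | trivial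
  | node g l r => simp only [Seg.cover]; split_ifs <;> first | exact h | trivial

theorem WF.gaps_ne_nil {T : Seg} (hT : T.WF) (h : T ≠ nil) : T.gaps ≠ [] := by
  cases T with
  | nil => exact absurd rfl h
  | leaf g => simp [gaps]
  | node g l r => exact hT.2.2.1

/-- Collapsing a node with two empty children preserves the nonemptiness on which queries rely.
Bounds are left unchanged, as outer bounds suffice. -/
theorem WF.cover {T : Seg} (hT : T.WF) (a b : ℚ≥0) : (T.cover a b).WF := by
  induction T with
  | nil => trivial
  | leaf g => simp only [Seg.cover]; split_ifs <;> first | exact hT | trivial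
  | node g l r ihl ihr =>
    simp only [Seg.cover]
    split_ifs with h1 h2 h3 h4
    · exact hT
    · exact hT
    · trivial
    · trivial
    · obtain ⟨hl, hr, -, mid, h5, h6, h7, h8⟩ := hT
      refine ⟨ihl hl, ihr hr, fun hc => h4 ?_, mid, h5.cover a b, h6.cover a b, h7, h8⟩
      rw [List.append_eq_nil_iff] at hc
      have e1 : l.cover a b = nil := by
        by_contra h; exact (ihl hl).gaps_ne_nil h hc.1
      have e2 : r.cover a b = nil := by
        by_contra h; exact (ihr hr).gaps_ne_nil h hc.2
      simp [e1, e2, isNil]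

theorem WF.mem_gaps_cover {T : Seg} (hT : T.WF) (a b : ℚ≥0) (g : ℚ≥0 × ℚ≥0) :
    g ∈ (T.cover a b).gaps ↔ g ∈ T.gaps ∧ ¬ (a ≤ g.1 ∧ g.2 ≤ b) := by
  induction T with
  | nil => simp [Seg.cover, gaps]
  | leaf h =>
    have hT : h.1 < h.2 := hT
    simp only [Seg.cover]
    split_ifs with h1 h2 h3
    · simp only [gaps, List.mem_singleton, iff_self_and]
      rintro rfl ⟨h3, -⟩
      exact absurd (hT.trans_le (h1.trans h3)) (lt_irrefl _)
    · simp only [gaps, List.mem_singleton, iff_self_and]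
      rintro rfl ⟨-, h3⟩
      exact absurd (hT.trans_le (h3.trans h2)) (lt_irrefl _)
    · simp only [gaps, List.not_mem_nil, List.mem_singleton, false_iff]
      rintro ⟨rfl, h⟩; exact h h3
    · simp only [gaps, List.mem_singleton, iff_self_and]
      rintro rfl; exact h3
  | node h l r ihl ihr =>
    have hb := hT.bounds (lo := h.1) (hi := h.2) ⟨le_rfl, le_rfl⟩
    obtain ⟨hl, hr, -⟩ := hT
    simp only [Seg.cover]
    split_ifs with h1 h2 h3 h4
    · simp only [iff_self_and]
      rintro hg ⟨h3, -⟩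
      obtain ⟨h4, h5, h6⟩ := hb g hg
      exact absurd (h5.trans_le (h6.trans (h1.trans h3))) (lt_irrefl _)
    · simp only [iff_self_and]
      rintro hg ⟨-, h3⟩
      obtain ⟨h4, h5, h6⟩ := hb g hg
      exact absurd (h5.trans_le (h3.trans (h2.trans h4))) (lt_irrefl _)
    · simp only [gaps, List.not_mem_nil, false_iff]
      rintro ⟨hg, h⟩
      obtain ⟨h4, h5, h6⟩ := hb g hg
      exact h ⟨h3.1.trans h4, h6.trans h3.2⟩
    · simp only [Bool.and_eq_true, isNil_iff] at h4
      have e1 := ihl hl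
      have e2 := ihr hr
      rw [h4.1] at e1
      rw [h4.2] at e2
      simp only [gaps, List.mem_append] at e1 e2 ⊢
      tauto
    · simp only [gaps, List.mem_append, ihl hl, ihr hr]
      tauto

theorem depth_cover_le (T : Seg) (a b : ℚ≥0) : (T.cover a b).depth ≤ T.depth := by
  induction T with
  | nil => simp [Seg.cover]
  | leaf h => simp only [Seg.cover]; split_ifs <;> simp [depth]
  | node h l r ihl ihr =>
    simp only [Seg.cover]
    split_ifs <;> simp only [depth] <;> omega

/-- Inner nodes disjoint from the interval or contained in it cost nothing; the bound is `2` only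
because `cost` charges every leaf that amount. -/
theorem cost_eq_zero {T : Seg} {lo hi a b : ℚ≥0} (h : T.Within lo hi)
    (hab : hi ≤ a ∨ b ≤ lo ∨ (a ≤ lo ∧ hi ≤ b)) : T.cost a b ≤ 2 := by
  cases T with
  | nil => simp [cost]
  | leaf g => simp [cost]
  | node g l r =>
    have : g.2 ≤ a ∨ b ≤ g.1 ∨ (a ≤ g.1 ∧ g.2 ≤ b) := by
      rcases hab with hab | hab | hab
      · exact .inl (h.2.trans hab)
      · exact .inr (.inl (hab.trans h.1))
      · exact .inr (.inr ⟨hab.1.trans h.1, h.2.trans hab.2⟩)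
    simp [cost, this]

/-- When one end of the interval is outside the node, at most one child is cut by the other end, so
the search follows a single path. -/
theorem WF.cost_le_of_side {T : Seg} (hT : T.WF) {lo hi a b : ℚ≥0} (h : T.Within lo hi)
    (hab : a ≤ lo ∨ hi ≤ b) : T.cost a b ≤ 4 * T.depth + 2 := by
  induction T generalizing lo hi with
  | nil => simp [cost]
  | leaf g => simp [cost, depth]
  | node g l r ihl ihr =>
    obtain ⟨hl, hr, -, mid, h1, h2, h3, h4⟩ := hT
    have hab' : a ≤ g.1 ∨ g.2 ≤ b := hab.imp (fun h' => h'.trans h.1) (fun h' => h.2.trans h')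
    have key : l.cost a b + r.cost a b ≤ 4 * max l.depth r.depth + 4 := by
      rcases hab' with ha | hb
      · rcases le_total b mid with hb | hb
        · have := ihl hl h1 (.inl ha)
          have := cost_eq_zero (a := a) h2 (.inr (.inl hb))
          omega
        · have := ihr hr h2 (.inl (ha.trans h3))
          have := cost_eq_zero h1 (.inr (.inr ⟨ha, hb⟩))
          omega
      · rcases le_total a mid with ha | ha
        · have := ihl hl h1 (.inr (h4.trans hb))
          have := cost_eq_zero h2 (.inr (.inr ⟨ha, hb⟩))
          omega
        · have := ihr hr h2 (.inr hb)
          have := cost_eq_zero (b := b) h1 (.inl ha)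
          omega
    simp only [cost, depth]
    split_ifs <;> omega

/-- The search follows a single path until the two ends of the interval separate at some `mid`; from
there it consists of two one-sided searches. -/
theorem WF.cost_le {T : Seg} (hT : T.WF) (a b : ℚ≥0) : T.cost a b ≤ 8 * T.depth + 2 := by
  induction T with
  | nil => simp [cost]
  | leaf g => simp [cost, depth]
  | node g l r ihl ihr =>
    obtain ⟨hl, hr, -, mid, h1, h2, h3, h4⟩ := hT
    have key : l.cost a b + r.cost a b ≤ 8 * max l.depth r.depth + 4 := by
      rcases le_total b mid with hb | hb
      · have := ihl hl
        have := cost_eq_zero (a := a) h2 (.inr (.inl hb))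
        omega
      · rcases le_total mid a with ha | ha
        · have := ihr hr
          have := cost_eq_zero (b := b) h1 (.inl ha)
          omega
        · have := hl.cost_le_of_side (a := a) h1 (.inr hb)
          have := hr.cost_le_of_side (b := b) h2 (.inl ha)
          omega
    simp only [cost, depth]
    split_ifs <;> omega

end Seg

/-- A tree as a tree of gaps. -/
def FTree.toSeg : FTree (ℚ≥0 × ℚ≥0) → Seg
  | leaf h => .leaf h
  | node h l r => .node h l.toSeg r.toSeg

theorem FTree.encode_toSeg {P V : Type*} (T : FTree (ℚ≥0 × ℚ≥0)) :
    (T.toSeg.encode : Datum P V) = T.encode encodeGap := by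
  induction T with
  | leaf h => rfl
  | node h l r ihl ihr => simp [toSeg, Seg.encode, FTree.encode, ihl, ihr]

theorem FTree.gaps_toSeg (T : FTree (ℚ≥0 × ℚ≥0)) : T.toSeg.gaps = T.leaves := by
  induction T with
  | leaf h => rfl
  | node h l r ihl ihr => simp [toSeg, Seg.gaps, leaves, ihl, ihr]

theorem FTree.depth_toSeg (T : FTree (ℚ≥0 × ℚ≥0)) : T.toSeg.depth = T.depth := by
  induction T with
  | leaf h => rfl
  | node h l r ihl ihr => simp [toSeg, Seg.depth, depth, ihl, ihr]

theorem FTree.within_toSeg (T : FTree (ℚ≥0 × ℚ≥0)) : T.toSeg.Within T.head.1 T.head.2 := by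
  cases T <;> exact ⟨le_rfl, le_rfl⟩

theorem FTree.leaves_ne_nil {α : Type*} (T : FTree α) : T.leaves ≠ [] := by
  induction T with
  | leaf h => simp [leaves]
  | node h l r ihl ihr => simp [leaves, ihl]

theorem FTree.Good.exists_head {T : FTree (ℚ≥0 × ℚ≥0)} (hT : T.Good fun g g' => (g.1, g'.2)) :
    (∃ g ∈ T.leaves, g.1 = T.head.1) ∧ ∃ g ∈ T.leaves, g.2 = T.head.2 := by
  induction T with
  | leaf h => exact ⟨⟨h, by simp [leaves], rfl⟩, ⟨h, by simp [leaves], rfl⟩⟩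
  | node h l r ihl ihr =>
    obtain ⟨rfl, hl, hr⟩ := hT
    obtain ⟨g, hg, h1⟩ := (ihl hl).1
    obtain ⟨g', hg', h2⟩ := (ihr hr).2
    exact ⟨⟨g, by simp [leaves, hg], h1⟩, ⟨g', by simp [leaves, hg'], h2⟩⟩

/-- Root entries are hulls of the leaves, which are ordered and disjoint. The right end of the left
hull therefore separates the children. -/
theorem FTree.Good.wf_toSeg {T : FTree (ℚ≥0 × ℚ≥0)} (hT : T.Good fun g g' => (g.1, g'.2))
    (hlt : ∀ g ∈ T.leaves, g.1 < g.2) (hs : T.leaves.Pairwise fun g g' => g.2 ≤ g'.1) :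
    T.toSeg.WF := by
  induction T with
  | leaf h => exact hlt h (by simp [leaves])
  | node h l r ihl ihr =>
    obtain ⟨rfl, hl, hr⟩ := hT
    have hs' := List.pairwise_append.1 hs
    have wl := ihl hl (fun g hg => hlt g (by simp [leaves, hg])) hs'.1
    have wr := ihr hr (fun g hg => hlt g (by simp [leaves, hg])) hs'.2.1
    obtain ⟨a, ha, ha'⟩ := hl.exists_head.2
    obtain ⟨b, hb, hb'⟩ := hr.exists_head.1
    have hmid : l.head.2 ≤ r.head.1 := by rw [← ha', ← hb']; exact hs'.2.2 a ha b hb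
    obtain ⟨x, hx⟩ := List.exists_mem_of_ne_nil _ l.leaves_ne_nil
    have hx' := wl.bounds l.within_toSeg x (by rw [gaps_toSeg]; exact hx)
    obtain ⟨y, hy⟩ := List.exists_mem_of_ne_nil _ r.leaves_ne_nil
    have hy' := wr.bounds r.within_toSeg y (by rw [gaps_toSeg]; exact hy)
    refine ⟨wl, wr, ?_, l.head.2, l.within_toSeg, r.within_toSeg.mono hmid le_rfl,
      (hx'.1.trans hx'.2.1.le).trans hx'.2.2,
      hmid.trans ((hy'.1.trans hy'.2.1.le).trans hy'.2.2)⟩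
    simp [gaps_toSeg, l.leaves_ne_nil]

end SegmentTree

/-! ### The program performs deletion and search -/

section SegmentTreeCalls

variable {P V : Type*}

theorem Seg.encode_eq_nil {T : Seg} : (T.encode : Datum P V) = .nil ↔ T.isNil = true := by
  cases T <;> simp [Seg.encode, isNil]

variable [LinearOrder V]

theorem calls_query (T : Seg) (a b : ℚ≥0) :
    Calls monitor 9 (.pair T.encode (.pair (.time a) (.time b)) : Datum P V)
      (.ofBool (T.query a b)) (T.cost a b + 1) := by
  induction T with
  | nil =>
    refine calls_of_wp (body := queryBody) rfl ?_
    simp [queryBody, wp, Seg.encode, Seg.query, Datum.ofBool]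
  | leaf h =>
    -- The search treats an undecided leaf like an inner node and recurses into two empty children;
    -- these are the two calls charged to a leaf.
    have hnil : Calls monitor 9 (.pair .nil (.pair (.time a) (.time b)) : Datum P V) .nil 1 := by
      refine calls_of_wp (body := queryBody) rfl ?_
      simp [queryBody, wp]
    refine calls_of_wp (body := queryBody) rfl ?_
    by_cases h1 : h.2 ≤ a
    · simp [queryBody, wp, Seg.encode, encodeGap, Seg.query, Seg.cost, h1, Datum.ofBool, -not_le]
    by_cases h2 : b ≤ h.1
    · simp [queryBody, wp, Seg.encode, encodeGap, Seg.query, Seg.cost, h1, h2, Datum.ofBool,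
        -not_le]
    by_cases h3 : a ≤ h.1 <;> by_cases h4 : h.2 ≤ b <;>
      simp [queryBody, wp, Seg.encode, encodeGap, Seg.query, Seg.cost, h1, h2, h3, h4, Expr.and,
        Expr.tru, Datum.ofBool, -not_le]
    all_goals exact ⟨_, hnil, _, hnil, by omega⟩
  | node h l r ihl ihr =>
    refine calls_of_wp (body := queryBody) rfl ?_
    by_cases h1 : h.2 ≤ a
    · simp [queryBody, wp, Seg.encode, encodeGap, Seg.query, Seg.cost, h1, Datum.ofBool, -not_le]
    by_cases h2 : b ≤ h.1
    · simp [queryBody, wp, Seg.encode, encodeGap, Seg.query, Seg.cost, h1, h2, Datum.ofBool,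
        -not_le]
    by_cases h3 : a ≤ h.1 <;> by_cases h4 : h.2 ≤ b <;>
      simp [queryBody, wp, Seg.encode, encodeGap, Seg.query, Seg.cost, h1, h2, h3, h4, Expr.and,
        Expr.tru, Datum.ofBool, -not_le]
    all_goals
      refine ⟨_, _, ihl, fun h => ?_, fun h => ⟨r.cost a b + 1, ?_, ?_⟩⟩
      · simp at h
        simp [h]
        omega
      · simp at h
        rw [h, Bool.false_or]
        exact ihr
      · omega

theorem calls_cover (T : Seg) (a b : ℚ≥0) :
    Calls monitor 8 (.pair T.encode (.pair (.time a) (.time b)) : Datum P V)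
      (T.cover a b).encode (T.cost a b + 1) := by
  induction T with
  | nil =>
    refine calls_of_wp (body := coverBody) rfl ?_
    simp [coverBody, wp, Seg.encode, Seg.cover]
  | leaf h =>
    refine calls_of_wp (body := coverBody) rfl ?_
    by_cases h1 : h.2 ≤ a
    · simp [coverBody, wp, Seg.encode, encodeGap, Seg.cover, Seg.cost, h1, -not_le]
    by_cases h2 : b ≤ h.1
    · simp [coverBody, wp, Seg.encode, encodeGap, Seg.cover, Seg.cost, h1, h2, -not_le]
    by_cases h3 : a ≤ h.1 <;> by_cases h4 : h.2 ≤ b <;>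
      simp [coverBody, wp, Seg.encode, encodeGap, Seg.cover, Seg.cost, h1, h2, h3, h4, Expr.and,
        Expr.tru, -not_le]
  | node h l r ihl ihr =>
    refine calls_of_wp (body := coverBody) rfl ?_
    by_cases h1 : h.2 ≤ a
    · simp [coverBody, wp, Seg.encode, encodeGap, Seg.cover, Seg.cost, h1, -not_le]
    by_cases h2 : b ≤ h.1
    · simp [coverBody, wp, Seg.encode, encodeGap, Seg.cover, Seg.cost, h1, h2, -not_le]
    by_cases h3 : a ≤ h.1 <;> by_cases h4 : h.2 ≤ b <;>
      simp [coverBody, wp, Seg.encode, encodeGap, Seg.cover, Seg.cost, h1, h2, h3, h4, Expr.and,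
        Expr.tru, -not_le]
    all_goals
      refine ⟨_, _, ihl, _, _, ihr, ?_⟩
      rw [Seg.encode_eq_nil, Seg.encode_eq_nil]
      cases hl : (l.cover a b).isNil <;> cases hr : (r.cover a b).isNil <;>
        simp [Seg.encode, encodeGap] <;> omega

end SegmentTreeCalls

/-! ### Grouping by value and the main loop -/

section Groups

variable {P V : Type*}

/-- The code of a group of operations on a value. -/
def encodeGroup (x : V × List (Operation P V)) : Datum P V :=
  .pair (.val x.1) (encodeList encodeOperation x.2)

/-- Adds the operations of a sorted list to a list of groups. -/
def groupList [LinearOrder V] : List (V × Operation P V) → List (V × List (Operation P V)) →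
    List (V × List (Operation P V))
  | [], acc => acc
  | (v, o) :: l, [] => groupList l [(v, [o])]
  | (v, o) :: l, (w, g) :: acc =>
    if v ≤ w then groupList l ((w, o :: g) :: acc) else groupList l ((v, [o]) :: (w, g) :: acc)

/-- Times that describe a group of operations on the same value. -/
structure Summary where
  enqInv : ℚ≥0
  deqRes : ℚ≥0
  deqInv : ℚ≥0
  firstRes : ℚ≥0
  lastInv : ℚ≥0

/-- The summary of a group in a history with times between `lo` and `hi`. -/
def summary (lo hi : ℚ≥0) : List (Operation P V) → Summary
  | [] => ⟨lo, hi, hi, hi, lo⟩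
  | o :: g =>
    { enqInv := match o.op with
        | .enq _ => max o.inv (summary lo hi g).enqInv
        | _ => (summary lo hi g).enqInv
      deqRes := match o.op with
        | .deq _ => min o.res (summary lo hi g).deqRes
        | _ => (summary lo hi g).deqRes
      deqInv := match o.op with
        | .deq _ => o.inv
        | _ => (summary lo hi g).deqInv
      firstRes := min o.res (summary lo hi g).firstRes
      lastInv := max o.inv (summary lo hi g).lastInv }

/-- The code of a summary. -/
def encodeSummary (s : Summary) : Datum P V :=
  .pair (.time s.enqInv) (.pair (.time s.deqRes) (.pair (.time s.deqInv)
    (.pair (.time s.firstRes) (.time s.lastInv))))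

/-- Tests if the operation is an insertion. -/
def AbsOp.isEnqB : AbsOp V → Bool
  | .enq _ => true
  | _ => false

/-- Tests if each operation of a group other than the insertion has a gap in the tree. -/
def check (s : Summary) (T : Seg) : List (Operation P V) → Bool
  | [] => true
  | o :: g =>
    if o.op.isEnqB then check s T g
    else T.query (max o.inv s.enqInv) (min o.res s.deqRes) && check s T g

/-- Tests if each operation without value has a gap in the tree. -/
def checkEmpties (T : Seg) : List (Operation P V) → Bool
  | [] => true
  | o :: g =>
    if o.op.value.isSome then checkEmpties T g else T.query o.inv o.res && checkEmpties T g

/-- Tests the groups one after the other, removing the gaps in which their values are present, and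
finally the operations without value. -/
def loop (lo hi : ℚ≥0) (L : List (Operation P V)) :
    List (V × List (Operation P V)) → Seg → Bool
  | [], T => checkEmpties T L
  | x :: gs, T =>
    let s := summary lo hi x.2
    check s T x.2 && loop lo hi L gs (T.cover s.firstRes (max s.lastInv s.deqInv))

variable [LinearOrder V]

theorem calls_group (l : List (V × Operation P V)) (acc : List (V × List (Operation P V))) :
    Calls monitor 10 (.pair (encodeList encodeValued l) (encodeList encodeGroup acc))
      (encodeList encodeGroup (groupList l acc)) (l.length + 1) := by
  induction l generalizing acc with
  | nil =>
    refine calls_of_wp (body := groupBody) rfl ?_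
    simp [groupBody, wp, groupList]
  | cons x l ih =>
    obtain ⟨v, o⟩ := x
    refine calls_of_wp (body := groupBody) rfl ?_
    cases acc with
    | nil =>
      simp [groupBody, wp, groupList, encodeValued]
      refine ⟨_, ih [(v, [o])], ?_⟩
      omega
    | cons y acc =>
      obtain ⟨w, g⟩ := y
      by_cases h : v ≤ w
      · simp [groupBody, wp, groupList, encodeValued, encodeGroup, h, -not_le]
        refine ⟨_, ih ((w, o :: g) :: acc), ?_⟩
        omega
      · simp [groupBody, wp, groupList, encodeValued, encodeGroup, h, -not_le]
        refine ⟨_, ih ((v, [o]) :: (w, g) :: acc), ?_⟩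
        omega

theorem calls_summary (lo hi : ℚ≥0) (g : List (Operation P V)) :
    Calls monitor 11 (.pair (encodeList encodeOperation g) (encodeGap (lo, hi)))
      (encodeSummary (summary lo hi g)) (5 * g.length + 1) := by
  induction g with
  | nil =>
    refine calls_of_wp (body := summaryBody) rfl ?_
    simp [summaryBody, wp, summary, encodeGap, encodeSummary]
  | cons o g ih =>
    set s := summary lo hi g with hs
    -- Besides the recursive call, there are at most four calls of maximum or minimum, and one call
    -- for the body itself: five per operation.
    refine Yields.calls (body := summaryBody) (k := 0 + (0 + (5 * g.length + 1) +
      (0 + (1 + (1 + (0 + (1 + 1))))))) ?_ rfl (by simp; omega)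
    refine Yields.ite_true (d := encodeList encodeOperation (o :: g)) ?_ (by simp)
      (Yields.bind (Yields.call ?_ ih) (Yields.bind (d₁ := encodeOperation o) ?_
        (Yields.pair ?_ (Yields.pair ?_ (Yields.pair ?_ (Yields.pair ?_ ?_))))))
    · simp [Yields, wp]
    · simp [Yields, wp]
    · simp [Yields, wp]
    · cases ho : o.op <;>
        simp [Yields, wp, Expr.method, Expr.inv, ho, encodeMethod, Datum.ofNat, encodeSummary,
          summary, ← hs]
      exact ⟨_, calls_max _ _, le_rfl⟩
    · cases ho : o.op <;>
        simp [Yields, wp, Expr.method, Expr.and, Expr.res, ho, encodeMethod, Datum.ofNat,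
          encodeSummary, summary, ← hs]
      exact ⟨_, calls_min _ _, le_rfl⟩
    · cases ho : o.op <;>
        simp [Yields, wp, Expr.method, Expr.and, Expr.inv, ho, encodeMethod, Datum.ofNat,
          encodeSummary, summary, ← hs]
    · simp only [Yields, wp, Expr.res, encodeSummary, List.getD_cons_zero]
      exact ⟨_, _, calls_min _ _, rfl, le_rfl⟩
    · simp only [Yields, wp, Expr.inv, encodeSummary, List.getD_cons_zero]
      exact ⟨_, _, calls_max _ _, rfl, le_rfl⟩

theorem calls_check (s : Summary) (T : Seg) {c : ℕ} (hc : ∀ a b, T.cost a b ≤ c)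
    (g : List (Operation P V)) :
    Calls monitor 12 (.pair (encodeList encodeOperation g)
        (.pair (.time s.enqInv) (.pair (.time s.deqRes) T.encode)))
      (.ofBool (check s T g)) (g.length * (c + 4) + 1) := by
  induction g with
  | nil =>
    refine calls_of_wp (body := checkBody) rfl ?_
    simp [checkBody, wp, check, Expr.tru, Datum.ofBool]
  | cons o g ih =>
    have hlen : (o :: g).length * (c + 4) + 1 = g.length * (c + 4) + 1 + (c + 4) := by
      simp only [List.length_cons]; ring
    rw [hlen]
    have hmethod : ∀ k, Yields monitor (.method (.fst (.fst (.var 0))))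
        [.pair (encodeList encodeOperation (o :: g))
          (.pair (.time s.enqInv) (.pair (.time s.deqRes) T.encode))] (encodeMethod o.op) k := by
      simp [Yields, wp, Expr.method]
    -- The surcharge `c + 3` is the search with `c + 1` calls and the two calls that compute its
    -- window.
    refine Yields.calls (body := checkBody) (k := 0 + (0 + (g.length * (c + 4) + 1 + (c + 3)))) ?_
      rfl (by omega)
    refine Yields.ite_true (d := encodeList encodeOperation (o :: g)) (by simp [Yields, wp])
      (by simp) ?_
    cases ho : o.op.isEnqB with
    | true =>
      refine Yields.ite_false ((hmethod 0).of_eq ?_) ?_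
      · cases h : o.op <;> simp [h, AbsOp.isEnqB] at ho; rfl
      · simp only [Yields, wp]
        exact ⟨_, _, ih, by simp [check, ho], by omega⟩
    | false =>
      refine Yields.ite_true (hmethod 0) ?_ ?_
      · cases h : o.op <;> simp [h, AbsOp.isEnqB] at ho <;> simp [encodeMethod, Datum.ofNat]
      · have hq := (calls_query (P := P) (V := V) T (max o.inv s.enqInv)
          (min o.res s.deqRes)).mono (Nat.succ_le_succ (hc _ _))
        have hquery : Yields (P := P) (V := V) monitor _ _ _ (0 + (1 + 1) + (c + 1)) := Yields.call
          (Yields.pair (e₁ := .snd (.snd (.snd (.var 0))))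
            (env := [.pair (encodeList encodeOperation (o :: g))
              (.pair (.time s.enqInv) (.pair (.time s.deqRes) T.encode))]) (k₁ := 0)
            (by simp [Yields, wp]) (Yields.pair
              (e₁ := .call 15 (.pair (.inv (.fst (.fst (.var 0)))) (.fst (.snd (.var 0))))) (k₁ := 1)
              (e₂ := .call 16 (.pair (.res (.fst (.fst (.var 0)))) (.fst (.snd (.snd (.var 0))))))
              (k₂ := 1) ⟨_, _, calls_max _ _, rfl, le_rfl⟩ ⟨_, _, calls_min _ _, rfl, le_rfl⟩)) hq
        cases hb : T.query (max o.inv s.enqInv) (min o.res s.deqRes) with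
        | true =>
          rw [hb] at hquery
          refine wp_mono (Yields.ite_true hquery (by simp) (d' := .ofBool (check s T (o :: g)))
            (k' := g.length * (c + 4) + 1) ?_) fun d k h => ⟨h.1, h.2.trans (by omega)⟩
          simp only [Yields, wp]
          exact ⟨_, _, ih, by simp [check, ho, hb], by omega⟩
        | false =>
          rw [hb] at hquery
          refine wp_mono (Yields.ite_false hquery (d' := .ofBool (check s T (o :: g)))
            (k' := g.length * (c + 4) + 1) ?_) fun d k h => ⟨h.1, h.2.trans (by omega)⟩
          simp [Yields, wp, check, ho, hb, Datum.ofBool]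

theorem calls_empties (T : Seg) {c : ℕ} (hc : ∀ a b, T.cost a b ≤ c) (L : List (Operation P V)) :
    Calls monitor 14 (.pair (encodeHistory L) T.encode) (.ofBool (checkEmpties T L))
      (L.length * (c + 2) + 1) := by
  change Calls monitor 14 (.pair (encodeList encodeOperation L) _) _ _
  induction L with
  | nil =>
    refine calls_of_wp (body := emptiesBody) rfl ?_
    simp [emptiesBody, wp, checkEmpties, Expr.tru, Datum.ofBool]
  | cons o L ih =>
    have hlen : (o :: L).length * (c + 2) + 1 = L.length * (c + 2) + 1 + (c + 2) := by
      simp only [List.length_cons]; ring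
    rw [hlen]
    have hq := (calls_query (P := P) (V := V) T o.inv o.res).mono (Nat.succ_le_succ (hc _ _))
    refine calls_of_wp (body := emptiesBody) rfl ?_
    cases hv : o.op.value with
    | some v =>
      simp [emptiesBody, wp, Expr.value, encodeValue, hv, checkEmpties]
      exact ⟨_, ih, by omega⟩
    | none =>
      simp [emptiesBody, wp, Expr.value, Expr.inv, Expr.res, encodeValue, hv, checkEmpties]
      refine ⟨_, _, hq, fun h => ?_, fun h => ?_⟩
      · simp at h
        simp [h]
        exact ⟨_, ih, by omega⟩
      · simp at h
        simp [h, Datum.ofBool]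
        omega

theorem calls_loop (lo hi : ℚ≥0) (L : List (Operation P V)) {D : ℕ}
    (gs : List (V × List (Operation P V))) (T : Seg) (hT : T.WF) (hD : T.depth ≤ D) :
    Calls monitor 13 (.pair (encodeList encodeGroup gs)
        (.pair T.encode (.pair (encodeGap (lo, hi)) (encodeHistory L))))
      (.ofBool (loop lo hi L gs T))
      ((gs.map fun x => x.2.length).sum * (8 * D + 11) + gs.length * (8 * D + 7) +
        L.length * (8 * D + 4) + 2) := by
  induction gs generalizing T with
  | nil =>
    have hc : ∀ a b, T.cost a b ≤ 8 * D + 2 := fun a b => (hT.cost_le a b).trans (by omega)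
    refine calls_of_wp (body := loopBody) rfl ?_
    simp [loopBody, wp, loop]
    refine ⟨_, calls_empties T hc L, ?_⟩
    rw [show 8 * D + 2 + 2 = 8 * D + 4 by omega]
  | cons x gs ih =>
    have hc : ∀ a b, T.cost a b ≤ 8 * D + 2 := fun a b => (hT.cost_le a b).trans (by omega)
    obtain ⟨v, g⟩ := x
    set s := summary lo hi g with hs
    have ih' := ih (T.cover s.firstRes (max s.lastInv s.deqInv)) (hT.cover _ _)
      ((T.depth_cover_le _ _).trans hD)
    set N := (gs.map fun x => x.2.length).sum * (8 * D + 11) + gs.length * (8 * D + 7) +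
        L.length * (8 * D + 4) + 2 with hN
    -- Per group: `8 * D + 3` calls for deletion, one maximum, the call itself, and the last calls
    -- of summary and check. Per operation in it: `5` for the summary and `8 * D + 6` for the check.
    have hlen : ((((v, g) :: gs).map fun x => x.2.length).sum * (8 * D + 11) +
        ((v, g) :: gs).length * (8 * D + 7) + L.length * (8 * D + 4) + 2) =
        N + (5 * g.length + 1) + (g.length * (8 * D + 2 + 4) + 1) + (8 * D + 5) := by
      rw [hN]; simp only [List.map_cons, List.sum_cons, List.length_cons]; ring
    rw [hlen]
    have hcov := (calls_cover (P := P) (V := V) T s.firstRes (max s.lastInv s.deqInv)).mono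
      (Nat.succ_le_succ (hc _ _))
    refine Yields.calls (body := loopBody) (k := 0 + (0 + (5 * g.length + 1) +
      (0 + (g.length * (8 * D + 2 + 4) + 1) + (N + (8 * D + 4))))) ?_ rfl (by omega)
    refine Yields.ite_true (d := encodeList encodeGroup ((v, g) :: gs)) (by simp [Yields, wp])
      (by simp) (Yields.bind (d₁ := encodeSummary s) (Yields.call (d₁ := .pair
        (encodeList encodeOperation g) (encodeGap (lo, hi))) ?_ (calls_summary lo hi g)) ?_)
    · simp [Yields, wp, encodeGroup]
    have hcheck : Yields (P := P) (V := V) monitor _ _ _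
        (0 + (g.length * (8 * D + 2 + 4) + 1)) := Yields.call
      (e := .pair (.snd (.fst (.fst (.var 1))))
          (.pair (.fst (.var 0)) (.pair (.fst (.snd (.var 0))) (.fst (.snd (.var 1))))))
      (env := [encodeSummary s, .pair (encodeList encodeGroup ((v, g) :: gs))
        (.pair T.encode (.pair (encodeGap (lo, hi)) (encodeHistory L)))])
      (k₁ := 0) (by simp [Yields, wp, encodeSummary, encodeGroup]) (calls_check s T hc g)
    cases hb : check s T g with
    | true =>
      rw [hb] at hcheck
      refine Yields.ite_true hcheck (by simp) ?_
      simp only [Yields, wp]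
      refine ⟨_, _, calls_max _ _, _, _, hcov, _, _, ih', ?_, by omega⟩
      simp [loop, ← hs, hb]
    | false =>
      rw [hb] at hcheck
      refine Yields.ite_false hcheck ?_
      simp [Yields, wp, loop, ← hs, hb, Datum.ofBool]

end Groups

/-! ### The tests of the monitor express the gap criterion -/

section Correctness

variable {P V : Type*}

/-- The operation removes a value. -/
def AbsOp.IsDeq (a : AbsOp V) : Prop := ∃ v, a = .deq v

theorem AbsOp.isEnqB_iff {a : AbsOp V} : a.isEnqB = true ↔ a.IsEnq := by
  cases a with
  | enq v => exact ⟨fun _ => ⟨v, rfl⟩, fun _ => rfl⟩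
  | _ =>
    refine ⟨fun h => (by cases h), ?_⟩
    rintro ⟨w, hw⟩
    cases hw

theorem summary_enqInv_le {lo hi x : ℚ≥0} (hx : lo ≤ x) (g : List (Operation P V)) :
    (summary lo hi g).enqInv ≤ x ↔ ∀ o ∈ g, o.op.IsEnq → o.inv ≤ x := by
  induction g with
  | nil => simpa [summary] using hx
  | cons o g ih =>
    cases ho : o.op <;> simp [summary, ho, ih, AbsOp.IsEnq]

theorem le_summary_deqRes {lo hi y : ℚ≥0} (hy : y ≤ hi) (g : List (Operation P V)) :
    y ≤ (summary lo hi g).deqRes ↔ ∀ o ∈ g, o.op.IsDeq → y ≤ o.res := by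
  induction g with
  | nil => simpa [summary] using hy
  | cons o g ih =>
    cases ho : o.op <;> simp [summary, ho, ih, AbsOp.IsDeq]

/-- The default `hi` is neutral for the minimum. Strictness of `x < hi` makes the claim correct for
the empty group. -/
theorem summary_firstRes_le {lo hi x : ℚ≥0} (hx : x < hi) (g : List (Operation P V)) :
    (summary lo hi g).firstRes ≤ x ↔ ∃ o ∈ g, o.res ≤ x := by
  induction g with
  | nil => simpa [summary] using hx
  | cons o g ih => simp [summary, ih]

theorem le_summary_lastInv {lo hi y : ℚ≥0} (hy : lo < y) (g : List (Operation P V)) :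
    y ≤ (summary lo hi g).lastInv ↔ ∃ o ∈ g, y ≤ o.inv := by
  induction g with
  | nil => simpa [summary] using hy
  | cons o g ih => simp [summary, ih]

theorem summary_deqInv (lo hi : ℚ≥0) (g : List (Operation P V)) :
    ((∀ o ∈ g, ¬ o.op.IsDeq) ∧ (summary lo hi g).deqInv = hi) ∨
      ∃ o ∈ g, o.op.IsDeq ∧ (summary lo hi g).deqInv = o.inv := by
  induction g with
  | nil => simp [summary]
  | cons o g ih =>
    cases ho : o.op with
    | deq v => exact .inr ⟨o, by simp, ⟨v, ho⟩, by simp [summary, ho]⟩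
    | _ => simpa [summary, ho, AbsOp.IsDeq] using ih

/-- If the value is removed, `deqInv` is the invocation of an operation of the group and adds
nothing new; otherwise it is `hi`, so the certain presence extends to the end of the history. -/
theorem le_summary_max {lo hi y : ℚ≥0} (hlo : lo < y) (hy : y ≤ hi) (g : List (Operation P V)) :
    y ≤ max (summary lo hi g).lastInv (summary lo hi g).deqInv ↔
      (∃ o ∈ g, y ≤ o.inv) ∨ ∀ o ∈ g, ¬ o.op.IsDeq := by
  rw [le_max_iff, le_summary_lastInv hlo]
  constructor
  · rintro (h | h)
    · exact .inl h
    · rcases summary_deqInv lo hi g with ⟨h1, -⟩ | ⟨o, ho, -, h2⟩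
      · exact .inr h1
      · exact .inl ⟨o, ho, h2 ▸ h⟩
  · rintro (h | h)
    · exact .inl h
    · rcases summary_deqInv lo hi g with ⟨-, h1⟩ | ⟨o, ho, h1, -⟩
      · exact .inr (by rw [h1]; exact hy)
      · exact absurd h1 (h o ho)

theorem check_iff {s : Summary} {T : Seg} (hT : T.WF) (g : List (Operation P V)) :
    check s T g = true ↔ ∀ o ∈ g, ¬ o.op.IsEnq → ∃ x ∈ T.gaps,
      (o.inv ≤ x.1 ∧ s.enqInv ≤ x.1) ∧ x.2 ≤ o.res ∧ x.2 ≤ s.deqRes := by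
  induction g with
  | nil => simp [check]
  | cons o g ih =>
    simp only [check, List.mem_cons, forall_eq_or_imp, ← AbsOp.isEnqB_iff] at ih ⊢
    split_ifs with h
    · simp [h, ih]
    · rw [Bool.and_eq_true, hT.query_iff, ih]
      simp [h]

theorem checkEmpties_iff {T : Seg} (hT : T.WF) (g : List (Operation P V)) :
    checkEmpties T g = true ↔ ∀ o ∈ g, o.op.value = none → ∃ x ∈ T.gaps,
      o.inv ≤ x.1 ∧ x.2 ≤ o.res := by
  induction g with
  | nil => simp [checkEmpties]
  | cons o g ih =>
    simp only [checkEmpties, List.mem_cons, forall_eq_or_imp]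
    cases h : o.op.value with
    | some v => simp [ih]
    | none => simp [hT.query_iff, ih]

/-- The gap belongs to the interval in which the values of the group are forced to be present. -/
def GroupCovers (lo hi : ℚ≥0) (g : List (Operation P V)) (x : ℚ≥0 × ℚ≥0) : Prop :=
  (summary lo hi g).firstRes ≤ x.1 ∧
    x.2 ≤ max (summary lo hi g).lastInv (summary lo hi g).deqInv

variable [LinearOrder V]

/-- Groups come by falling value, so when a group is tested exactly the gaps covered by groups of
greater value have been deleted. At the end all covered gaps are gone, as `empty` requires. -/
theorem loop_iff (lo hi : ℚ≥0) (L : List (Operation P V)) {T : Seg} (hT : T.WF)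
    {gs : List (V × List (Operation P V))} (hgs : gs.Pairwise fun x y => y.1 < x.1) :
    loop lo hi L gs T = true ↔
      (∀ v g, (v, g) ∈ gs → ∀ o ∈ g, ¬ o.op.IsEnq → ∃ x ∈ T.gaps,
        ((o.inv ≤ x.1 ∧ (summary lo hi g).enqInv ≤ x.1) ∧
          x.2 ≤ o.res ∧ x.2 ≤ (summary lo hi g).deqRes) ∧
        ∀ w g', (w, g') ∈ gs → v < w → ¬ GroupCovers lo hi g' x) ∧
      ∀ o ∈ L, o.op.value = none → ∃ x ∈ T.gaps, (o.inv ≤ x.1 ∧ x.2 ≤ o.res) ∧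
        ∀ w g', (w, g') ∈ gs → ¬ GroupCovers lo hi g' x := by
  induction gs generalizing T with
  | nil => simp [loop, checkEmpties_iff hT]
  | cons y gs ih =>
    obtain ⟨u, h⟩ := y
    obtain ⟨hu, hgs'⟩ := List.pairwise_cons.1 hgs
    simp only [loop, Bool.and_eq_true, check_iff hT, ih (hT.cover _ _) hgs', hT.mem_gaps_cover]
    have hcov : ∀ x, ¬ ((summary lo hi h).firstRes ≤ x.1 ∧
        x.2 ≤ max (summary lo hi h).lastInv (summary lo hi h).deqInv) ↔ ¬ GroupCovers lo hi h x :=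
      fun x => Iff.rfl
    simp only [hcov]
    constructor
    · rintro ⟨h1, h2, h3⟩
      refine ⟨fun v g hvg o ho hq => ?_, fun o ho hv => ?_⟩
      · rcases List.mem_cons.1 hvg with heq | hvg
        · cases heq
          obtain ⟨x, hx, hx'⟩ := h1 o ho hq
          refine ⟨x, hx, hx', fun w g' hw hlt => ?_⟩
          rcases List.mem_cons.1 hw with heq | hw
          · cases heq; exact absurd hlt (lt_irrefl _)
          · exact absurd hlt (not_lt.2 (hu _ hw).le)
        · obtain ⟨x, ⟨hx, hc⟩, hx', hx''⟩ := h2 v g hvg o ho hq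
          refine ⟨x, hx, hx', fun w g' hw hlt => ?_⟩
          rcases List.mem_cons.1 hw with heq | hw
          · cases heq; exact hc
          · exact hx'' w g' hw hlt
      · obtain ⟨x, ⟨hx, hc⟩, hx', hx''⟩ := h3 o ho hv
        refine ⟨x, hx, hx', fun w g' hw => ?_⟩
        rcases List.mem_cons.1 hw with heq | hw
        · cases heq; exact hc
        · exact hx'' w g' hw
    · rintro ⟨h1, h2⟩
      refine ⟨fun o ho hq => ?_, fun v g hvg o ho hq => ?_, fun o ho hv => ?_⟩
      · obtain ⟨x, hx, hx', -⟩ := h1 u h (by simp) o ho hq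
        exact ⟨x, hx, hx'⟩
      · obtain ⟨x, hx, hx', hx''⟩ := h1 v g (List.mem_cons_of_mem _ hvg) o ho hq
        exact ⟨x, ⟨hx, hx'' u h (by simp) (hu _ hvg)⟩, hx',
          fun w g' hw => hx'' w g' (List.mem_cons_of_mem _ hw)⟩
      · obtain ⟨x, hx, hx', hx''⟩ := h2 o ho hv
        exact ⟨x, ⟨hx, hx'' u h (by simp)⟩, hx',
          fun w g' hw => hx'' w g' (List.mem_cons_of_mem _ hw)⟩

/-- The input is ascending and each new group is pushed in front, so the groups end up descending,
as the loop needs. -/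
theorem groupList_pairwise {l : List (V × Operation P V)} {acc : List (V × List (Operation P V))}
    (hl : l.Pairwise fun x y => x.1 ≤ y.1) (hacc : acc.Pairwise fun x y => y.1 < x.1)
    (hla : ∀ x ∈ l, ∀ y ∈ acc, y.1 ≤ x.1) :
    (groupList l acc).Pairwise fun x y => y.1 < x.1 := by
  induction l, acc using groupList.induct with
  | case1 acc => simpa [groupList] using hacc
  | case2 v o l ih =>
    rw [groupList]
    exact ih (List.pairwise_cons.1 hl).2 (by simp)
      (by simpa using fun a b => (List.pairwise_cons.1 hl).1 (a, b))
  | case3 v o l w g acc h ih =>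
    simp only [groupList, h, if_true]
    refine ih (List.pairwise_cons.1 hl).2 ?_ ?_
    · exact List.pairwise_cons.2 ⟨(List.pairwise_cons.1 hacc).1, (List.pairwise_cons.1 hacc).2⟩
    · intro x hx y hy
      rcases List.mem_cons.1 hy with rfl | hy
      · exact hla x (List.mem_cons_of_mem _ hx) (w, g) (by simp)
      · exact hla x (List.mem_cons_of_mem _ hx) y (List.mem_cons_of_mem _ hy)
  | case4 v o l w g acc h ih =>
    simp only [groupList, h, if_false]
    refine ih (List.pairwise_cons.1 hl).2 (List.pairwise_cons.2 ⟨fun y hy => ?_, hacc⟩) ?_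
    · rcases List.mem_cons.1 hy with rfl | hy
      · exact not_le.1 h
      · exact ((List.pairwise_cons.1 hacc).1 y hy).trans (not_le.1 h)
    · intro x hx y hy
      rcases List.mem_cons.1 hy with rfl | hy
      · exact (List.pairwise_cons.1 hl).1 x hx
      · exact hla x (List.mem_cons_of_mem _ hx) y hy

theorem mem_groupList {l : List (V × Operation P V)} {acc : List (V × List (Operation P V))}
    (hl : l.Pairwise fun x y => x.1 ≤ y.1) (hla : ∀ x ∈ l, ∀ y ∈ acc, y.1 ≤ x.1)
    {v : V} {o : Operation P V} :
    (∃ g, (v, g) ∈ groupList l acc ∧ o ∈ g) ↔ (v, o) ∈ l ∨ ∃ g, (v, g) ∈ acc ∧ o ∈ g := by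
  induction l, acc using groupList.induct with
  | case1 acc => simp [groupList]
  | case2 u a l ih =>
    rw [groupList, ih (List.pairwise_cons.1 hl).2
      (by simpa using fun a b => (List.pairwise_cons.1 hl).1 (a, b))]
    simp only [List.mem_cons, Prod.mk.injEq, List.not_mem_nil, or_false, false_and,
      exists_false]
    constructor
    · rintro (h | ⟨g, ⟨rfl, rfl⟩, h⟩)
      · exact .inr h
      · exact .inl ⟨rfl, by simpa using h⟩
    · rintro (⟨rfl, rfl⟩ | h)
      · exact .inr ⟨[o], ⟨rfl, rfl⟩, by simp⟩
      · exact .inl h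
  | case3 u a l w g acc h ih =>
    have huw : u = w := le_antisymm h (hla (u, a) (by simp) (w, g) (by simp))
    subst huw
    simp only [groupList, h, if_true]
    rw [ih (List.pairwise_cons.1 hl).2]
    · simp only [List.mem_cons, Prod.mk.injEq]
      constructor
      · rintro (h | ⟨g', ⟨rfl, rfl⟩ | h, h'⟩)
        · exact .inl (.inr h)
        · rcases List.mem_cons.1 h' with rfl | h'
          · exact .inl (.inl ⟨rfl, rfl⟩)
          · exact .inr ⟨g, .inl ⟨rfl, rfl⟩, h'⟩
        · exact .inr ⟨g', .inr h, h'⟩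
      · rintro ((⟨rfl, rfl⟩ | h) | ⟨g', ⟨rfl, rfl⟩ | h, h'⟩)
        · exact .inr ⟨o :: g, .inl ⟨rfl, rfl⟩, by simp⟩
        · exact .inl h
        · exact .inr ⟨a :: g', .inl ⟨rfl, rfl⟩, by simp [h']⟩
        · exact .inr ⟨g', .inr h, h'⟩
    · intro x hx y hy
      rcases List.mem_cons.1 hy with rfl | hy
      · exact hla x (List.mem_cons_of_mem _ hx) (u, g) (by simp)
      · exact hla x (List.mem_cons_of_mem _ hx) y (List.mem_cons_of_mem _ hy)
  | case4 u a l w g acc h ih =>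
    simp only [groupList, h, if_false]
    rw [ih (List.pairwise_cons.1 hl).2]
    · simp only [List.mem_cons, Prod.mk.injEq]
      constructor
      · rintro (h | ⟨g', ⟨rfl, rfl⟩ | h, h'⟩)
        · exact .inl (.inr h)
        · exact .inl (.inl ⟨rfl, by simpa using h'⟩)
        · exact .inr ⟨g', h, h'⟩
      · rintro ((⟨rfl, rfl⟩ | h) | ⟨g', h, h'⟩)
        · exact .inr ⟨[o], .inl ⟨rfl, rfl⟩, by simp⟩
        · exact .inl h
        · exact .inr ⟨g', .inr h, h'⟩
    · intro x hx y hy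
      rcases List.mem_cons.1 hy with rfl | hy
      · exact (List.pairwise_cons.1 hl).1 x hx
      · exact hla x (List.mem_cons_of_mem _ hx) y hy

theorem length_groupList_le (l : List (V × Operation P V)) (acc : List (V × List (Operation P V))) :
    (groupList l acc).length ≤ l.length + acc.length := by
  induction l, acc using groupList.induct with
  | case1 acc => simp [groupList]
  | case2 u a l ih => rw [groupList]; simp at ih ⊢; omega
  | case3 u a l w g acc h ih => simp only [groupList, h, if_true, List.length_cons] at ih ⊢; omega
  | case4 u a l w g acc h ih => simp only [groupList, h, if_false, List.length_cons] at ih ⊢; omega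

theorem sum_groupList (l : List (V × Operation P V)) (acc : List (V × List (Operation P V))) :
    ((groupList l acc).map fun x => x.2.length).sum =
      l.length + (acc.map fun x => x.2.length).sum := by
  induction l, acc using groupList.induct with
  | case1 acc => simp [groupList]
  | case2 u a l ih => rw [groupList, ih]; simp
  | case3 u a l w g acc h ih =>
    simp only [groupList, h, if_true, List.length_cons, List.map_cons, List.sum_cons] at ih ⊢; omega
  | case4 u a l w g acc h ih =>
    simp only [groupList, h, if_false, List.length_cons, List.map_cons, List.sum_cons,
      List.length_nil] at ih ⊢
    omega

/-- The tests of the monitor succeed if and only if each operation can be placed. -/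
theorem loop_iff_placeable {H : Finset (Operation P V)} {L : List (Operation P V)}
    (hL : (L : Multiset (Operation P V)) = H.val) {lo hi : ℚ≥0} {T : Seg} (hT : T.WF)
    (hW : T.Within lo hi) (hgaps : ∀ x, x ∈ T.gaps ↔ IsGap H x.1 x.2)
    {l : List (V × Operation P V)} (hl : l.Pairwise fun x y => x.1 ≤ y.1)
    (hlp : l.Perm (valuedList L)) :
    loop lo hi L (groupList l []) T = true ↔ Placeable H := by
  have hm : ∀ o, o ∈ L ↔ o ∈ H := fun o => by rw [← Finset.mem_val, ← hL, Multiset.mem_coe]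
  have hpw := groupList_pairwise hl (acc := []) (by simp) (by simp)
  have hmem : ∀ v o, (∃ g, (v, g) ∈ groupList l [] ∧ o ∈ g) ↔ o ∈ H ∧ o.op.value = some v := by
    intro v o
    rw [mem_groupList hl (by simp), hlp.mem_iff, mem_valuedList, hm]
    simp
  have hgroup : ∀ v g, (v, g) ∈ groupList l [] → ∀ o, o ∈ g ↔ o ∈ H ∧ o.op.value = some v := by
    intro v g hg o
    rw [← hmem]
    refine ⟨fun ho => ⟨g, hg, ho⟩, ?_⟩
    rintro ⟨g', hg', ho⟩
    by_cases h : g' = g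
    · exact h ▸ ho
    -- Values of the groups strictly decrease, so two different groups cannot have the same value.
    · exfalso
      have hirr : ∀ x ∈ groupList l [], ∀ y ∈ groupList l [], x ≠ y → x.1 ≠ y.1 := by
        intro x hx y hy hne
        have : Std.Symm fun x y : V × List (Operation P V) => x.1 ≠ y.1 := ⟨fun _ _ h => h.symm⟩
        exact (hpw.imp (S := fun x y => x.1 ≠ y.1) fun h => h.ne').forall hx hy hne
      exact hirr _ hg' _ hg (fun heq => h (congrArg Prod.snd heq)) rfl
  have hb : ∀ x ∈ T.gaps, lo ≤ x.1 ∧ x.1 < x.2 ∧ x.2 ≤ hi := hT.bounds hW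
  have hcov : ∀ x ∈ T.gaps, ∀ w,
      CoreCovers H w x.1 x.2 ↔ ∃ g, (w, g) ∈ groupList l [] ∧ GroupCovers lo hi g x := by
    intro x hx w
    obtain ⟨b1, b2, b3⟩ := hb x hx
    have key : ∀ g, (w, g) ∈ groupList l [] → (CoreCovers H w x.1 x.2 ↔ GroupCovers lo hi g x) := by
      intro g hg
      have hg' := hgroup w g hg
      rw [GroupCovers, summary_firstRes_le (b2.trans_le b3), le_summary_max (b1.trans_lt b2) b3]
      simp only [CoreCovers, hg', and_assoc]
      have : (∀ o ∈ H, o.op ≠ .deq w) ↔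
          ∀ o, o ∈ H ∧ o.op.value = some w → ¬ o.op.IsDeq := by
        constructor
        · rintro h o ⟨ho, hv⟩ ⟨u, hu⟩
          rw [hu] at hv; cases hv
          exact h o ho hu
        · intro h o ho hd
          exact h o ⟨ho, by rw [hd]; rfl⟩ ⟨w, hd⟩
      rw [this]
    constructor
    · intro h
      obtain ⟨⟨o, ho, hv, -⟩, -⟩ := id h
      obtain ⟨g, hg, -⟩ := (hmem w o).2 ⟨ho, hv⟩
      exact ⟨g, hg, (key g hg).1 h⟩
    · rintro ⟨g, hg, h⟩
      exact (key g hg).2 h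
  have hfree : ∀ x ∈ T.gaps, ∀ p : WithBot V, Free H p x.1 x.2 ↔
      ∀ w g, (w, g) ∈ groupList l [] → p < (w : WithBot V) → ¬ GroupCovers lo hi g x := by
    intro x hx p
    constructor
    · intro h w g hg hp hc
      exact h w hp ((hcov x hx w).2 ⟨g, hg, hc⟩)
    · intro h w hp hc
      obtain ⟨g, hg, hc⟩ := (hcov x hx w).1 hc
      exact h w g hg hp hc
  have hclip : ∀ v g, (v, g) ∈ groupList l [] → ∀ o ∈ g, ∀ x ∈ T.gaps,
      (InClip H o x.1 x.2 ↔ (o.inv ≤ x.1 ∧ (summary lo hi g).enqInv ≤ x.1) ∧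
          x.2 ≤ o.res ∧ x.2 ≤ (summary lo hi g).deqRes) := by
    intro v g hg o ho x hx
    obtain ⟨b1, b2, b3⟩ := hb x hx
    have hg' := hgroup v g hg
    have hov := ((hg' o).1 ho).2
    rw [summary_enqInv_le b1, le_summary_deqRes b3]
    constructor
    · rintro ⟨h1, h2, h3⟩
      refine ⟨⟨h1, ?_⟩, h2, ?_⟩
      · rintro e he ⟨u, hu⟩
        obtain ⟨heH, hev⟩ := (hg' e).1 he
        rw [hu] at hev; cases hev
        exact (h3 _ hov).1 e heH hu
      · rintro e he ⟨u, hu⟩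
        obtain ⟨heH, hev⟩ := (hg' e).1 he
        rw [hu] at hev; cases hev
        exact (h3 _ hov).2 e heH hu
    · rintro ⟨⟨h1, h2⟩, h3, h4⟩
      refine ⟨h1, h3, fun u hu => ?_⟩
      obtain rfl : v = u := by rw [hov] at hu; exact Option.some.inj hu
      exact ⟨fun e he hev => h2 e ((hg' e).2 ⟨he, by rw [hev]; rfl⟩) ⟨v, hev⟩,
        fun e he hev => h4 e ((hg' e).2 ⟨he, by rw [hev]; rfl⟩) ⟨v, hev⟩⟩
  rw [loop_iff lo hi L hT hpw]
  constructor
  · rintro ⟨h1, h2⟩ o ho hq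
    cases hv : o.op.value with
    | none =>
      obtain ⟨x, hx, hx', hx''⟩ := h2 o ((hm o).2 ho) hv
      refine ⟨x.1, x.2, (hgaps x).1 hx, ⟨hx'.1, hx'.2, fun v h => ?_⟩,
        (hfree x hx _).2 fun w g hg _ => hx'' w g hg⟩
      rw [hv] at h; cases h
    | some v =>
      obtain ⟨g, hg, hog⟩ := (hmem v o).2 ⟨ho, hv⟩
      obtain ⟨x, hx, hx', hx''⟩ := h1 v g hg o hog hq
      refine ⟨x.1, x.2, (hgaps x).1 hx, (hclip v g hg o hog x hx).2 hx',
        (hfree x hx _).2 fun w g' hg' hw => hx'' w g' hg' ?_⟩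
      rw [priority_of_value hv] at hw
      exact WithBot.coe_lt_coe.1 hw
  · intro h
    constructor
    · intro v g hg o ho hq
      obtain ⟨hoH, hv⟩ := (hgroup v g hg o).1 ho
      obtain ⟨x, y, hxy, hc, hf⟩ := h o hoH hq
      have hx : (x, y) ∈ T.gaps := (hgaps (x, y)).2 hxy
      refine ⟨(x, y), hx, (hclip v g hg o ho _ hx).1 hc, fun w g' hg' hw => ?_⟩
      refine (hfree _ hx _).1 hf w g' hg' ?_
      rw [priority_of_value hv]
      exact WithBot.coe_lt_coe.2 hw
    · intro o ho hv
      have hq : ¬ o.op.IsEnq := by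
        rintro ⟨u, hu⟩; rw [hu] at hv; cases hv
      obtain ⟨x, y, hxy, hc, hf⟩ := h o ((hm o).1 ho) hq
      have hx : (x, y) ∈ T.gaps := (hgaps (x, y)).2 hxy
      refine ⟨(x, y), hx, ⟨hc.1, hc.2.1⟩, fun w g' hg' => (hfree _ hx _).1 hf w g' hg' ?_⟩
      have : o.op.priority = ⊥ := hv
      rw [this]
      exact WithBot.bot_lt_coe w

end Correctness

/-! ### Correctness and running time of the whole program -/

section Monitor

open FTree

variable {P V : Type*} [LinearOrder V]

/-- A tree with `m` leaves has fewer than `2 * m` nodes and, when built in rounds, depth at most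
`clog 2 m`. The empty list is separate, as it has no tree. -/
theorem yields_sort {α : Type*} (e : α → Datum P V) (le : α → α → Bool)
    (hle : ∀ a b, Datum.le (e a).fst (e b).fst = .ofBool (le a b))
    (htrans : ∀ a b c, le a b → le b c → le a c) (htotal : ∀ a b, le a b || le b a)
    (as : List α) {ex : Expr} {env : List (Datum P V)} {k : ℕ}
    (h : Yields monitor ex env (encodeList (encode id) (as.map fun a => leaf (e a))) k) :
    ∃ bs : List α, bs.Perm as ∧ bs.Pairwise (fun a b => le a b) ∧
      Yields monitor (.call 4 (.call 3 ex)) env (encodeList e bs)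
        (k + (as.length + 2) * (Nat.clog 2 as.length + 1) +
          2 * as.length * (2 * Nat.clog 2 as.length + 2)) := by
  rcases eq_or_ne as [] with rfl | has
  · exact ⟨[], .refl _, by simp, (h.call calls_build_nil).call calls_sort_nil⟩
  · obtain ⟨T, h1, h2, h3, h4, -⟩ := calls_build (id : Datum P V → Datum P V)
      (fun a b => .pair a.fst b.snd) (fun _ _ => rfl) (as.map fun a => leaf (e a)) (by simpa)
    rw [List.length_map] at h1 h3 h4
    have h5 : T.leaves = as.map e := by
      rw [h2, List.flatMap_map]
      simp [leaves, List.map_eq_flatMap]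
    have h6 : T.depth ≤ Nat.clog 2 as.length := by simpa using h3 0 (by simp [FTree.depth])
    have h7 : T.size ≤ 2 * as.length := by
      have : ((as.map fun a => leaf (e a)).map FTree.size).sum = as.length := by
        simp [FTree.size, Function.comp_def]
      omega
    obtain ⟨bs, hp, hs, hc⟩ := calls_sort e le hle htrans htotal T as h5
    refine ⟨bs, hp, hs, (h.call h1).call (hc.mono ?_)⟩
    exact Nat.mul_le_mul h7 (by omega)

theorem monitor_correct {H : Finset (Operation P V)} {L : List (Operation P V)}
    (hL : (L : Multiset (Operation P V)) = H.val) :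
    ∃ d : Datum P V,
      Calls monitor 0 (encodeHistory L) d (60 * (L.length + 1) * (Nat.clog 2 (2 * L.length) + 1)) ∧
      (d.IsTrue ↔ Placeable H) := by
  have hm : ∀ o, o ∈ L ↔ o ∈ H := fun o => by rw [← Finset.mem_val, ← hL, Multiset.mem_coe]
  rcases eq_or_ne L [] with rfl | hne
  · refine ⟨.pair .nil .nil, ?_, ?_⟩
    · refine calls_of_wp (body := mainBody) rfl ?_
      simp [mainBody, wp, encodeHistory, Datum.ofList, Expr.tru]
    · refine ⟨fun _ o ho => ?_, fun _ => by simp [Datum.IsTrue]⟩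
      exact absurd ((hm o).2 ho) (by simp)
  have hcons : encodeHistory L ≠ .nil := by
    match L, hne with
    | o :: L, _ => simp [encodeHistory, Datum.ofList]
  set n := L.length with hn
  set c := Nat.clog 2 (2 * n) with hc
  -- the gaps
  obtain ⟨ts, htp, hts, hty⟩ := yields_sort (P := P) (V := V) encodeTime
    (fun a b => decide (a ≤ b)) (fun a b => rfl) (by simpa using fun a b c => le_trans)
    (by simpa using le_total) (timesList L)
    (ex := .call 5 (.var 0)) (env := [encodeHistory L]) (k := 0 + (n + 1))
    (Yields.call (by simp [Yields, wp]) (calls_times L))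
  rw [length_timesList] at hty
  have hts' : ts.Pairwise (· ≤ ·) := hts.imp fun h => by simpa using h
  have hmem : ∀ t, t ∈ ts ↔ t ∈ times H := fun t => by rw [htp.mem_iff, mem_timesList hL]
  have hgap : ∀ x, x ∈ gapsList ts ↔ IsGap H x.1 x.2 := by
    intro x
    rw [mem_gapsList hts']
    simp only [hmem]
    rfl
  have hgne : gapsList ts ≠ [] := by
    match L, hne with
    | o :: L, _ =>
      have ho : o ∈ H := (hm o).1 (by simp)
      obtain ⟨x, y, hxy, -⟩ := exists_isGap_of_lt (inv_mem_times ho) (res_mem_times ho)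
        o.inv_lt_res le_rfl
      exact List.ne_nil_of_mem ((hgap (x, y)).2 hxy)
  obtain ⟨T, h1, h2, h3, -, h5⟩ := calls_build (P := P) (V := V) encodeGap
    (fun g g' => (g.1, g'.2)) (fun _ _ => rfl) ((gapsList ts).map leaf) (by simpa)
  rw [List.length_map] at h1 h3
  -- There are `2 * n` times with repetitions; hence all logarithms are bounded by `c = clog 2 (2 *
  -- n)`.
  have hlen : (gapsList ts).length ≤ 2 * n := by
    rw [hn, ← length_timesList, ← htp.length_eq]; exact length_gapsList_le ts
  have hclog : Nat.clog 2 (gapsList ts).length ≤ c := Nat.clog_mono_right 2 hlen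
  have hleaves : T.leaves = gapsList ts := by
    rw [h2, List.flatMap_map]
    simp [leaves]
  have hgood : T.Good fun g g' => (g.1, g'.2) := h5 fun t ht => by
    obtain ⟨x, -, rfl⟩ := List.mem_map.1 ht
    trivial
  have hwf : T.toSeg.WF := hgood.wf_toSeg
    (fun x hx => ((hgap x).1 (hleaves ▸ hx)).2.2.1) (hleaves ▸ pairwise_gapsList hts')
  have hdepth : T.toSeg.depth ≤ c := by
    rw [depth_toSeg]
    have := h3 0 fun t ht => by
      obtain ⟨x, -, rfl⟩ := List.mem_map.1 ht
      exact le_rfl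
    omega
  rw [← encode_toSeg] at h1
  have hT : Yields monitor
      (.call 3 (.call 7 (.call 4 (.call 3 (.call 5 (.var 0)))))) [encodeHistory L]
      T.toSeg.encode _ := (hty.call (calls_gaps ts)).call (h1.mono (Nat.mul_le_mul
        (Nat.add_le_add_right hlen 2) (Nat.add_le_add_right hclog 1)))
  -- the groups
  obtain ⟨l, hlp, hl, hly⟩ := yields_sort (P := P) (V := V) encodeValued
    (fun a b => decide (a.1 ≤ b.1)) (fun a b => rfl) (by simpa using fun a b _ _ c _ => le_trans)
    (by simpa using fun a _ b _ => le_total a b) (valuedList L)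
    (ex := .call 6 (.var 1)) (env := [T.toSeg.encode, encodeHistory L]) (k := 0 + (n + 1))
    (Yields.call (by simp [Yields, wp]) (calls_valued L))
  have hl' : l.Pairwise fun x y => x.1 ≤ y.1 := hl.imp fun h => by simpa using h
  have hG := (Yields.pair (d₂ := encodeList encodeGroup []) (e₂ := .nil) (k₂ := 0) hly
    (by simp [Yields, wp])).call (calls_group l [])
  have hmain : Yields monitor _ [encodeHistory L] _ _ := Yields.ite_true (c := .var 0)
    (e₂ := .tru) (d := encodeHistory L) (k := 0)
    (by simp [Yields, wp]) hcons (Yields.bind hT (Yields.call (f := 13)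
    (Yields.pair hG (Yields.pair (e₁ := .var 0) (e₂ := .pair (.fst (.var 0)) (.var 1)) (k₁ := 0)
      (k₂ := 0) (d₁ := T.toSeg.encode)
      (d₂ := .pair (encodeGap (T.head.1, T.head.2)) (encodeHistory L))
      (by simp [Yields, wp]) (by simp [Yields, wp, encode_toSeg])))
    (calls_loop T.head.1 T.head.2 L (groupList l []) T.toSeg hwf hdepth)))
  refine ⟨.ofBool (loop T.head.1 T.head.2 L (groupList l []) T.toSeg), hmain.calls rfl ?_, ?_⟩
  · have hl1 : l.length ≤ n := hlp.length_eq ▸ length_valuedList_le L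
    have hg1 := length_groupList_le l []
    rw [sum_groupList]
    have hc2 : Nat.clog 2 (valuedList L).length ≤ c :=
      Nat.clog_mono_right 2 ((length_valuedList_le L).trans (by omega))
    have hv := length_valuedList_le L
    simp only [List.map_nil, List.sum_nil, List.length_nil, add_zero] at hg1 ⊢
    have hts1 : ts.length = 2 * n := by rw [htp.length_eq, length_timesList]
    rw [← hn] at hv ⊢
    rw [← hc, hts1]
    have e1 : ((valuedList L).length + 2) * (Nat.clog 2 (valuedList L).length + 1) ≤
        (n + 2) * (c + 1) := Nat.mul_le_mul (by omega) (by omega)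
    have e2 : 2 * (valuedList L).length * (2 * Nat.clog 2 (valuedList L).length + 2) ≤
        2 * n * (2 * c + 2) := Nat.mul_le_mul (by omega) (by omega)
    have e3 : l.length * (8 * c + 11) ≤ n * (8 * c + 11) := Nat.mul_le_mul_right _ hl1
    have e4 : (groupList l []).length * (8 * c + 7) ≤ n * (8 * c + 7) :=
      Nat.mul_le_mul_right _ (hg1.trans hl1)
    have e5 : 0 ≤ n * c := Nat.zero_le _
    have e6 : 0 ≤ c := Nat.zero_le _
    -- Every pass costs at most a constant times `(n + 1) * (c + 1)`; the constant `60` leaves room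
    -- for all of them.
    linarith
  · rw [← loop_iff_placeable hL hwf T.within_toSeg (fun x => by rw [gaps_toSeg, hleaves, hgap x])
      hl' hlp]
    simp [Datum.IsTrue]

end Monitor

/-! ### The call bound is of order n log n -/

section Asymptotics

theorem isBigO_mul_clog (C : ℕ) :
    (fun n : ℕ => ((C * ((n + 1) * (Nat.clog 2 (2 * n) + 1)) : ℕ) : ℝ)) =O[Filter.atTop]
      (fun n : ℕ => (n : ℝ) * Real.log (n : ℝ)) := by
  -- For `n ≥ 2` one has `n + 1 ≤ 2 * n`, and `clog 2 (2 * n) + 1` is at most the binary logarithm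
  -- of `n` plus `3`, hence at most four times that logarithm.
  refine Asymptotics.IsBigO.of_bound (C * (2 * (4 / Real.log 2))) ?_
  filter_upwards [Filter.eventually_ge_atTop 2] with n hn
  have hn' : (2 : ℝ) ≤ n := by exact_mod_cast hn
  have h2 : 0 < Real.log 2 := Real.log_pos one_lt_two
  have hlog : Real.log 2 ≤ Real.log n := Real.log_le_log two_pos hn'
  have h1 : (Nat.clog 2 (2 * n) : ℝ) ≤ Real.log n / Real.log 2 + 2 := by
    have h3 : Nat.clog 2 (2 * n) ≤ Nat.log 2 n + 2 := by
      refine Nat.clog_le_of_le_pow ?_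
      have := Nat.lt_pow_succ_log_self one_lt_two n
      rw [pow_succ]
      omega
    have h4 : (Nat.log 2 n : ℝ) ≤ Real.log n / Real.log 2 := by
      rw [le_div_iff₀ h2, ← Real.log_pow]
      apply Real.log_le_log (by positivity)
      exact_mod_cast Nat.pow_log_le_self 2 (by omega)
    calc (Nat.clog 2 (2 * n) : ℝ) ≤ (Nat.log 2 n + 2 : ℕ) := by exact_mod_cast h3
      _ ≤ _ := by push_cast; linarith
  have h5 : 1 ≤ Real.log n / Real.log 2 := (one_le_div h2).2 hlog
  have h6 : (Nat.clog 2 (2 * n) : ℝ) + 1 ≤ 4 / Real.log 2 * Real.log n := by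
    calc (Nat.clog 2 (2 * n) : ℝ) + 1 ≤ 4 * (Real.log n / Real.log 2) := by linarith
      _ = _ := by ring
  have hpos : 0 ≤ (n : ℝ) * Real.log n := mul_nonneg (by linarith) (h2.le.trans hlog)
  rw [Real.norm_of_nonneg (by positivity), Real.norm_of_nonneg hpos]
  push_cast
  calc (C : ℝ) * ((n + 1) * (Nat.clog 2 (2 * n) + 1))
      ≤ C * ((2 * n) * (4 / Real.log 2 * Real.log n)) := by
        gcongr
        linarith
    _ = _ := by ring

end Asymptotics

end PQMonitor

/-- There is one program that decides linearizability of unambiguous priority-queue histories, for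
all linearly ordered sets of values and for every order in which the operations of the history are
listed, and whose number of steps on histories of `n` operations is `O(n log n)`. -/
theorem mainTheorem3 :
    ∃ (prog : PQMonitor.Program) (T : ℕ → ℕ),
      (fun n : ℕ => (T n : ℝ)) =O[Filter.atTop] (fun n : ℕ => (n : ℝ) * Real.log (n : ℝ)) ∧
      ∀ (P : Type*) (V : Type*) [LinearOrder V] (H : Finset (PQMonitor.Operation P V)),
        PQMonitor.Unambiguous H →
        ∀ L : List (PQMonitor.Operation P V),
          (L : Multiset (PQMonitor.Operation P V)) = H.val →
          ∃ (d : PQMonitor.Datum P V) (t : ℕ),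
            PQMonitor.Runs prog (PQMonitor.encodeHistory L) d t ∧
            t ≤ T H.card ∧
            (d.IsTrue ↔ PQMonitor.Linearizable H) := by
  refine ⟨PQMonitor.monitor, fun n => PQMonitor.callCost PQMonitor.monitor * 60 *
    ((n + 1) * (Nat.clog 2 (2 * n) + 1)), PQMonitor.isBigO_mul_clog _, ?_⟩
  intro P V _ H hU L hL
  obtain ⟨d, ⟨body, t, hb, ht, hle⟩, hd⟩ := PQMonitor.monitor_correct hL
  have hlen : L.length = H.card := by
    rw [Finset.card, ← hL, Multiset.coe_card]
  refine ⟨d, t, ⟨body, hb, ht⟩, ?_, hd.trans (PQMonitor.linearizable_iff_placeable hU).symm⟩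
  rw [hlen] at hle
  -- `Calls` also pays for a call node, whereas a run starts directly in the body of function `0`.
  calc t ≤ t + 1 := Nat.le_succ t
    _ ≤ _ := hle
    _ = _ := by ring
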